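/- **Setting.** Let $\eta$ be a Poisson random measure with $\sigma$-finite intensity $\mu$ on a measurable space $(\mathcal Z,\mathscr Z)$, defined on a probability space $(\Omega,\mathscr F,\mathbb P)$. For $q\ge 0$ let $I_q : L^2(\mu^q)\to L^2(\mathbb P)$ be the multiple Wiener–Itô integral of order $q$ with respect to the compensated measure $\eta-\mu$ (with $L^2(\mu^0)=\mathbb R$ and $I_0(c)=c$), and let $C_q=\{I_q(h): h\in L^2(\mu^q)\}$ be the $q$-th Wiener chaos. Every $\sigma(\eta)$-measurable $\Phi\in L^2(\mathbb P)$ has a unique chaos decomposition $\Phi=\mathbb E[\Phi]+\sum_{q\ge 1} I_q(h_q)$, converging in $L^2(\mathbb P)$, with symmetric kernels $h_q\in L^2(\mu^q)$. For a random variable $F=\mathfrak f(\eta)$ with $\mathfrak f$ measurable, and $z\in\mathcal Z$, put $D^+_zF=\mathfrak f(\eta+\delta_z)-\mathfrak f(\eta)$. For $\emptyset\ne A\subseteq[m]=\{1,\dots,m\}$ let $D^A_z(F_1,\dots,F_m)=(X_1,\dots,X_m)$ with $X_i=D^+_zF_i$ if $i\in A$ and $X_i=F_i$ otherwise. A word of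 length $|W|=q$ is a vector $W=(A_1,\dots,A_q)$ of non-empty subsets of $[m]$, and $D^{[W]}_{z_1,\dots,z_q}=D^{A_1}_{z_1}\circ\cdots\circ D^{A_q}_{z_q}$. Put $Q(X_1,\dots,X_m)=\prod_{i=1}^m X_i$. **Theorem.** Fix $m\ge 1$ and integers $k_1,\dots,k_m\ge 1$. Let $F_1,\dots,F_m\in L^2(\mathbb P)$ be such that $F_i\in\bigoplus_{q=0}^{k_i}C_q$ for $i=1,\dots,m$, and set $K=k_1+\cdots+k_m$ and $\Phi=\prod_{i=1}^mF_i$. For $p\in[1,2]$ consider the conditions: * **(i-$p$)** $\Phi\in L^p(\mathbb P)$; * **(ii-$p$)** for every $q=1,\dots,K$, one has $\sum_{|W|=q}Q\big(D^{[W]}_{z_1,\dots,z_q}(F_1,\dots,F_m)\big)\in L^1(\mathbb P)$ for $\mu^q$-almost every $(z_1,\dots,z_q)$, and the mapping $(z_1,\dots,z_q)\mapsto \mathbb E\big[\sum_{|W|=q}Q\big(D^{[W]}_{z_1,\dots,z_q}(F_1,\dots,F_m)\big)\big]$ belongs to $L^p(\mu^q)$. Then (ii-$p$) implies (i-$p$)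 for every $p\in[1,2]$, and (i-$2$) and (ii-$2$) are equivalent. Moreover, if (i-$2$) or, equivalently, (ii-$2$) holds, then the kernels of the chaos decomposition of $\Phi$ satisfy $h_q=0$ for all $q>K$ and, for $q=1,\dots,K$ and $\mu^q$-almost every $(z_1,\dots,z_q)$, $$h_q(z_1,\dots,z_q)=\frac1{q!}\,\mathbb E\Big[\sum_{|W|=q}Q\big(D^{[W]}_{z_1,\dots,z_q}(F_1,\dots,F_m)\big)\Big].$$ -/

import Mathlib

open MeasureTheory ProbabilityTheory
open scoped ENNReal

noncomputable section

namespace PoissonChaos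

/-! ### Poisson random measures -/

/-- The Poisson distribution with mean `r ∈ [0, ∞]`, as a measure on `[0, ∞]`; for `r = ∞` it is
the Dirac mass at `∞`. -/
def extPoisson (r : ℝ≥0∞) : Measure ℝ≥0∞ :=
  open Classical in
  if r = ∞ then Measure.dirac ∞
  else (poissonMeasure r.toNNReal).map (fun n : ℕ => (n : ℝ≥0∞))

/-- Membership in the space of `σ`-finite point measures: `σ`-finite measures with values in
`{0, 1, 2, …} ∪ {∞}`. -/
structure IsPointMeasure {Z : Type*} [MeasurableSpace Z] (χ : Measure Z) : Prop where
  sigmaFinite : SigmaFinite χ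
  integer_valued : ∀ B : Set Z, MeasurableSet B → χ B = ∞ ∨ ∃ n : ℕ, χ B = n

/-- `η` is a Poisson random measure with intensity `μ`, defined on the probability space
`(Ω, P)`. -/
structure IsPoissonRandomMeasure {Ω Z : Type*} [MeasurableSpace Ω] [MeasurableSpace Z]
    (η : Ω → Measure Z) (μ : Measure Z) (P : Measure Ω) : Prop where
  measurable : Measurable η
  isPointMeasure : ∀ ω, IsPointMeasure (η ω)
  law : ∀ B : Set Z, MeasurableSet B → P.map (fun ω => η ω B) = extPoisson (μ B)
  indep : ∀ (n : ℕ) (B : Fin n → Set Z), (∀ i, MeasurableSet (B i)) →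
    Pairwise (fun i j => Disjoint (B i) (B j)) → iIndepFun (fun i ω => η ω (B i)) P

/-- The product measure `μ^q` on `Z^q`; for `q = 0` it is the unit mass on a point. -/
abbrev powMeasure {Z : Type*} [MeasurableSpace Z] (μ : Measure Z) (q : ℕ) :
    Measure (Fin q → Z) :=
  Measure.pi (fun _ => μ)

/-! ### Multiple Wiener-Itô integrals and Wiener chaoses -/

/-- The value `χ⁽ⁿ⁾(B₁ × ⋯ × Bₙ)` of the `n`-th factorial measure of the point measure `χ` on a
rectangle, that is, the number of `n`-tuples of distinct points of `χ` (counted with multiplicity)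
whose `i`-th entry lies in `Bᵢ`. The last point is free to be any point of `χ` in the last set,
except for those that were already chosen. -/
def factorialRect {Z : Type*} [MeasurableSpace Z] (χ : Measure Z) :
    (n : ℕ) → (Fin n → Set Z) → ℝ
  | 0, _ => 1
  | n + 1, B =>
      factorialRect χ n (Fin.init B) * χ.real (B (Fin.last n))
        - ∑ j : Fin n,
            factorialRect χ n
              (Function.update (Fin.init B) j (B j.castSucc ∩ B (Fin.last n)))

/-- The pathwise multiple integral of order `n`, with respect to the compensated measure `χ - μ`, of
the indicator of the rectangle `B₁ × ⋯ × Bₙ`: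
`∑_{J ⊆ [n]} (-1)^{n - |J|} χ^{(|J|)}(∏_{j ∈ J} B_j) ∏_{j ∉ J} μ(B_j)`. -/
def rectIntegral {Z : Type*} [MeasurableSpace Z] (μ χ : Measure Z) (n : ℕ)
    (B : Fin n → Set Z) : ℝ :=
  ∑ J : Finset (Fin n),
    (-1 : ℝ) ^ (n - J.card) * factorialRect χ J.card (fun i => B (J.orderEmbOfFin rfl i))
      * ∏ j ∈ Jᶜ, μ.real (B j)

/-- The graph of the multiple Wiener-Itô integral `I_q : L²(μ^q) → L²(P)` with respect to the
compensated measure `η - μ`: the pair `(h, G)` belongs to it if and only if `G = I_q(h)`. As usual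
`I_q` is given pathwise on the indicators of rectangles whose sides have finite measure, and is
extended to `L²(μ^q)` by linearity and continuity, so its graph is the closed linear span of the
pairs (indicator of a rectangle, integral of this indicator). -/
def integralGraph {Ω Z : Type*} [MeasurableSpace Ω] [MeasurableSpace Z]
    (η : Ω → Measure Z) (μ : Measure Z) [SigmaFinite μ] (P : Measure Ω) (q : ℕ) :
    Submodule ℝ (Lp ℝ 2 (powMeasure μ q) × Lp ℝ 2 P) :=
  (Submodule.span ℝ
    {x : Lp ℝ 2 (powMeasure μ q) × Lp ℝ 2 P |
      ∃ B : Fin q → Set Z, (∀ i, MeasurableSet (B i)) ∧ (∀ i, μ (B i) < ∞) ∧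
        x.1 =ᵐ[powMeasure μ q] (Set.univ.pi B).indicator (fun _ => (1 : ℝ)) ∧
        x.2 =ᵐ[P] fun ω => rectIntegral μ (η ω) q B}).topologicalClosure

/-- The `q`-th Wiener chaos `C_q = {I_q(h) : h ∈ L²(μ^q)}`. -/
def wienerChaos {Ω Z : Type*} [MeasurableSpace Ω] [MeasurableSpace Z]
    (η : Ω → Measure Z) (μ : Measure Z) [SigmaFinite μ] (P : Measure Ω) (q : ℕ) :
    Submodule ℝ (Lp ℝ 2 P) :=
  (integralGraph η μ P q).map (LinearMap.snd ℝ (Lp ℝ 2 (powMeasure μ q)) (Lp ℝ 2 P))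

/-- `h` is a Wiener-Itô chaos decomposition of `Φ ∈ L²(P)`: the kernels `h_q ∈ L²(μ^q)` are
symmetric and `Φ = ∑_{q ≥ 0} I_q(h_q)`, with convergence in `L²(P)`. -/
def IsChaosDecomposition {Ω Z : Type*} [MeasurableSpace Ω] [MeasurableSpace Z]
    (η : Ω → Measure Z) (μ : Measure Z) [SigmaFinite μ] (P : Measure Ω)
    (h : (q : ℕ) → Lp ℝ 2 (powMeasure μ q)) (Φ : Lp ℝ 2 P) : Prop :=
  (∀ (q : ℕ) (s : Equiv.Perm (Fin q)),
    (fun z : Fin q → Z => h q (fun i => z (s i))) =ᵐ[powMeasure μ q] h q) ∧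
  ∃ G : ℕ → Lp ℝ 2 P, (∀ q, (h q, G q) ∈ integralGraph η μ P q) ∧ HasSum G Φ

/-! ### Add-one cost operators

A random variable `F = f(η)` is represented by a measurable functional `f` of measures. A
measurable function on the set of point measures, with the `σ`-field generated by the evaluations
`χ ↦ χ(B)`, always extends to a measurable function on `Measure Z`. -/

/-- The add-one cost operator: `D⁺_z f (χ) = f (χ + δ_z) - f χ`. -/
def addOneCost {Z : Type*} [MeasurableSpace Z] (z : Z) (f : Measure Z → ℝ) : Measure Z → ℝ :=
  fun χ => f (χ + Measure.dirac z) - f χ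

/-- The operator `D^A_z` on `m`-tuples: `D⁺_z` acts on the entries with index in `A`, and the
other entries are left unchanged. -/
def letterDiff {Z : Type*} [MeasurableSpace Z] {m : ℕ} (A : Finset (Fin m)) (z : Z)
    (f : Fin m → Measure Z → ℝ) : Fin m → Measure Z → ℝ :=
  fun i => if i ∈ A then addOneCost z (f i) else f i

/-- Words of length `q` in the alphabet of non-empty subsets of `[m]`. -/
abbrev Word (m q : ℕ) : Type := Fin q → {A : Finset (Fin m) // A.Nonempty}

/-- `D^{[W]}_{z₁, …, z_q} = D^{A₁}_{z₁} ∘ ⋯ ∘ D^{A_q}_{z_q}` for the word `W = (A₁, …, A_q)`. -/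
def wordDiff {Z : Type*} [MeasurableSpace Z] {m : ℕ} :
    (q : ℕ) → Word m q → (Fin q → Z) → (Fin m → Measure Z → ℝ) → Fin m → Measure Z → ℝ
  | 0, _, _, f => f
  | q + 1, W, z, f => letterDiff (W 0).1 (z 0) (wordDiff q (Fin.tail W) (Fin.tail z) f)

/-- `∑_{|W| = q} Q(D^{[W]}_{z₁, …, z_q}(f₁, …, f_m))`, where `Q` multiplies the `m` entries. -/
def wordExpansion {Z : Type*} [MeasurableSpace Z] {m : ℕ} (f : Fin m → Measure Z → ℝ) (q : ℕ)
    (z : Fin q → Z) (χ : Measure Z) : ℝ :=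
  ∑ W : Word m q, ∏ i : Fin m, wordDiff q W z f i χ

/-- The expectation `E[∑_{|W| = q} Q(D^{[W]}_{z₁, …, z_q}(F₁, …, F_m))]` for `F_i = f_i(η)`. -/
def meanWordExpansion {Ω Z : Type*} [MeasurableSpace Ω] [MeasurableSpace Z]
    (η : Ω → Measure Z) (P : Measure Ω) {m : ℕ} (f : Fin m → Measure Z → ℝ) (q : ℕ)
    (z : Fin q → Z) : ℝ :=
  ∫ ω, wordExpansion f q z (η ω) ∂P

/-- For all `q = 1, …, K`, the word expansion of order `q` is integrable for `μ^q`-almost every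
`(z₁, …, z_q)`, and its expectation belongs to `L^p(μ^q)`. -/
def WordCondition {Ω Z : Type*} [MeasurableSpace Ω] [MeasurableSpace Z]
    (η : Ω → Measure Z) (μ : Measure Z) [SigmaFinite μ] (P : Measure Ω) {m : ℕ}
    (f : Fin m → Measure Z → ℝ) (K : ℕ) (p : ℝ≥0∞) : Prop :=
  ∀ q : ℕ, 1 ≤ q → q ≤ K →
    (∀ᵐ z ∂(powMeasure μ q), Integrable (fun ω => wordExpansion f q z (η ω)) P) ∧
    MemLp (meanWordExpansion η P f q) p (powMeasure μ q)

end PoissonChaos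

end

/-! The sum over words collapses. The discrete Leibniz rule says that the difference at `z` of a
product of `m` factors is the sum, over non-empty `A ⊆ [m]`, of the products in which the factors
with index in `A` are differenced. Iterating it, the word expansion of order `q` is the `q`-fold
difference `D^q_z φ` of the single functional `φ = ∏ f_i` (`wordExpansion_eq`). What has to be
understood is how the means `E[D^q_z φ]` (`meanDiff`) control `φ`. All of this depends only on the
law `Λ` of `η`, and of that law only the Mecke equation and integer-valuedness are used
(`IsMeckeLaw`).

Sufficiency. A variable in the chaoses of order at most `k_i` has vanishing differences of order
`k_i + 1`, and by the product rule such orders behave like degrees of polynomials, so `D^{K+1} φ =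
0` (`VanishAfter.prod`); no integrability of `φ` is needed for this. For `1 ≤ p ≤ 2` there is a
Poincaré inequality `E|g|^p ≤ 2 |E g|^p + 192 ∫ E|D_z g|^p μ(dz)`. Applied to `g = D^q_z φ` and
integrated in `z`, it bounds the `L^p`-norm of `D^q φ` by those of `E[D^q φ]` and of `D^{q+1} φ`.
Descending from order `K + 1` to order `1` shows that `φ` has finite energy, and finite energy alone
already forces a finite `p`-th moment (`lintegral_lt_top_of_energy`).

The Poincaré inequality comes straight from the Mecke equation when the intensity has mass at most
`1/4`. Having coefficient `1` in front of `|E f|^p`, it tensorizes without loss, which reaches every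
finite intensity. A `σ`-finite intensity is exhausted by sets of finite measure: a Mecke law splits
as an independent superposition (`lintegral_split`), and martingale convergence with Fatou's lemma
concludes.

Necessity for `p = 2`. Integration by parts gives `E[φ I_q(1_B)] = ∫_B E[D^q φ]` for rectangles `B`,
so `E[D^q φ]` is the adjoint of `I_q` applied to `φ`, and lies in `L²` as soon as `I_q` is bounded.
Boundedness is obtained from the Poincaré inequality and not from the isometry formula: `I_q(h)` has
vanishing differences of order `q + 1`, and its mean differences vanish except at order `q`, where
they equal the sum of `h` over permutations of its arguments. These properties (`IsIntegral`) are
checked on rectangles and are closed in `L²`, so they hold on the whole graph of `I_q`.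

Kernels. The same properties show that the kernels of any chaos decomposition are `E[D^q φ] / q!`.
Conversely, subtracting from `φ` the integrals of these kernels of order at most `K` leaves a
functional with vanishing differences of order `K + 1` and vanishing mean differences of all orders
up to `K`; by the iterated Poincaré inequality it is zero. -/

namespace PoissonChaos

variable {Z : Type*} [MeasurableSpace Z]

/-! ### Iterated add-one costs -/

/-- The iterated add-one cost `D⁺_{z₁} ∘ ⋯ ∘ D⁺_{z_q}`. -/
noncomputable def iterDiff : (q : ℕ) → (Fin q → Z) → (Measure Z → ℝ) → Measure Z → ℝ
  | 0, _, f => f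
  | q + 1, z, f => addOneCost (z 0) (iterDiff q (Fin.tail z) f)

@[simp] lemma iterDiff_zero (z : Fin 0 → Z) (f : Measure Z → ℝ) : iterDiff 0 z f = f := rfl

lemma iterDiff_succ (q : ℕ) (z : Fin (q + 1) → Z) (f : Measure Z → ℝ) :
    iterDiff (q + 1) z f = addOneCost (z 0) (iterDiff q (Fin.tail z) f) := rfl

@[simp] lemma iterDiff_cons (q : ℕ) (w : Z) (z : Fin q → Z) (f : Measure Z → ℝ) :
    iterDiff (q + 1) (Fin.cons w z) f = addOneCost w (iterDiff q z f) := by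
  simp [iterDiff_succ]

lemma addOneCost_comm (w z : Z) (f : Measure Z → ℝ) :
    addOneCost w (addOneCost z f) = addOneCost z (addOneCost w f) := by
  funext χ
  simp only [addOneCost]
  rw [add_right_comm χ (Measure.dirac w)]
  ring

/-- Differences at different points commute, so the recursion may be unfolded at either end.
Inductions over functionals peel off the innermost difference. -/
lemma iterDiff_addOneCost (q : ℕ) (z : Fin q → Z) (w : Z) (f : Measure Z → ℝ) :
    iterDiff q z (addOneCost w f) = addOneCost w (iterDiff q z f) := by
  induction q with
  | zero => rfl
  | succ q ih => rw [iterDiff_succ, ih, addOneCost_comm, ← iterDiff_succ]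

lemma iterDiff_eq_foldr (q : ℕ) (z : Fin q → Z) (f : Measure Z → ℝ) :
    iterDiff q z f = (List.ofFn z).foldr addOneCost f := by
  induction q with
  | zero => simp
  | succ q ih => rw [iterDiff_succ, List.ofFn_succ, List.foldr_cons, ih]; rfl

lemma iterDiff_perm (q : ℕ) (z : Fin q → Z) (s : Equiv.Perm (Fin q)) (f : Measure Z → ℝ) :
    iterDiff q (fun i => z (s i)) f = iterDiff q z f := by
  have : LeftCommutative (addOneCost : Z → (Measure Z → ℝ) → Measure Z → ℝ) :=
    ⟨addOneCost_comm⟩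
  rw [iterDiff_eq_foldr, iterDiff_eq_foldr]
  exact (Equiv.Perm.ofFn_comp_perm s z).foldr_eq f

lemma addOneCost_add (z : Z) (f g : Measure Z → ℝ) :
    addOneCost z (f + g) = addOneCost z f + addOneCost z g := by
  funext χ; simp only [addOneCost, Pi.add_apply]; ring

lemma addOneCost_smul (z : Z) (c : ℝ) (f : Measure Z → ℝ) :
    addOneCost z (c • f) = c • addOneCost z f := by
  funext χ; simp only [addOneCost, Pi.smul_apply, smul_eq_mul]; ring

/-- The iterated add-one cost as a linear map. -/
noncomputable def iterDiffLM (q : ℕ) (z : Fin q → Z) : (Measure Z → ℝ) →ₗ[ℝ] (Measure Z → ℝ) where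
  toFun := iterDiff q z
  map_add' f g := by
    induction q with
    | zero => rfl
    | succ q ih => simp only [iterDiff_succ, ih, addOneCost_add]
  map_smul' c f := by
    induction q with
    | zero => rfl
    | succ q ih => simp only [iterDiff_succ, ih, addOneCost_smul, RingHom.id_apply]

lemma iterDiff_add (q : ℕ) (z : Fin q → Z) (f g : Measure Z → ℝ) :
    iterDiff q z (f + g) = iterDiff q z f + iterDiff q z g := (iterDiffLM q z).map_add f g

lemma iterDiff_sub (q : ℕ) (z : Fin q → Z) (f g : Measure Z → ℝ) :
    iterDiff q z (f - g) = iterDiff q z f - iterDiff q z g := (iterDiffLM q z).map_sub f g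

lemma iterDiff_smul (q : ℕ) (z : Fin q → Z) (c : ℝ) (f : Measure Z → ℝ) :
    iterDiff q z (c • f) = c • iterDiff q z f := (iterDiffLM q z).map_smul c f

lemma iterDiff_sum {ι : Type*} (s : Finset ι) (q : ℕ) (z : Fin q → Z) (f : ι → Measure Z → ℝ) :
    iterDiff q z (∑ i ∈ s, f i) = ∑ i ∈ s, iterDiff q z (f i) :=
  map_sum (iterDiffLM q z) f s

lemma addOneCost_sum {ι : Type*} (s : Finset ι) (z : Z) (f : ι → Measure Z → ℝ) :
    addOneCost z (∑ i ∈ s, f i) = ∑ i ∈ s, addOneCost z (f i) :=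
  iterDiff_sum s 1 (fun _ => z) f

@[fun_prop]
lemma measurable_add_dirac : Measurable fun p : Z × Measure Z => p.2 + Measure.dirac p.1 :=
  measurable_snd.add (Measure.measurable_dirac.comp measurable_fst)

lemma measurable_addOneCost_uncurry {f : Measure Z → ℝ} (hf : Measurable f) :
    Measurable fun p : Z × Measure Z => addOneCost p.1 f p.2 :=
  (hf.comp measurable_add_dirac).sub (hf.comp measurable_snd)

lemma measurable_addOneCost {f : Measure Z → ℝ} (hf : Measurable f) (z : Z) :
    Measurable (addOneCost z f) :=
  (measurable_addOneCost_uncurry hf).comp measurable_prodMk_left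

lemma measurable_tail (q : ℕ) : Measurable fun z : Fin (q + 1) → Z => Fin.tail z :=
  measurable_pi_lambda _ fun i => measurable_pi_apply i.succ

lemma measurable_iterDiff_uncurry {f : Measure Z → ℝ} (hf : Measurable f) (q : ℕ) :
    Measurable fun p : (Fin q → Z) × Measure Z => iterDiff q p.1 f p.2 := by
  induction q with
  | zero => exact hf.comp measurable_snd
  | succ q ih =>
    have h1 : Measurable fun p : (Fin (q + 1) → Z) × Measure Z => Fin.tail p.1 :=
      (measurable_tail q).comp measurable_fst
    have h2 : Measurable fun p : (Fin (q + 1) → Z) × Measure Z => p.2 + Measure.dirac (p.1 0) :=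
      measurable_snd.add (Measure.measurable_dirac.comp ((measurable_pi_apply 0).comp measurable_fst))
    exact (ih.comp (h1.prodMk h2)).sub (ih.comp (h1.prodMk measurable_snd))

lemma measurable_iterDiff {f : Measure Z → ℝ} (hf : Measurable f) (q : ℕ) (z : Fin q → Z) :
    Measurable (iterDiff q z f) :=
  (measurable_iterDiff_uncurry hf q).comp measurable_prodMk_left

/-- The discrete Leibniz rule: write each shifted factor as `D_z f_i + f_i` and expand the product
over subsets of `[m]`. The empty subset contributes the unshifted product, which the difference
removes. -/
lemma sum_prod_letterDiff {m : ℕ} (z : Z) (f : Fin m → Measure Z → ℝ) (χ : Measure Z) :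
    ∑ A : {A : Finset (Fin m) // A.Nonempty}, ∏ i, letterDiff A.1 z f i χ
      = addOneCost z (fun χ => ∏ i, f i χ) χ := by
  classical
  have key : ∏ i, f i (χ + Measure.dirac z)
      = ∑ A : Finset (Fin m), ∏ i, letterDiff A z f i χ := by
    have : ∀ i, f i (χ + Measure.dirac z) = addOneCost z (f i) χ + f i χ := by
      intro i; simp [addOneCost]
    simp_rw [this]
    rw [Finset.prod_add]
    rw [Finset.powerset_univ]
    refine Finset.sum_congr rfl fun A _ => ?_
    rw [← Finset.prod_mul_prod_compl A (fun i => letterDiff A z f i χ)]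
    congr 1
    · exact Finset.prod_congr rfl fun i hi => by simp [letterDiff, hi]
    · rw [← Finset.compl_eq_univ_sdiff]
      exact Finset.prod_congr rfl fun i hi => by
        simp [letterDiff, Finset.mem_compl.1 hi]
  have h2 : ∑ A : Finset (Fin m), ∏ i, letterDiff A z f i χ
      = ∏ i, f i χ + ∑ A : {A : Finset (Fin m) // A.Nonempty}, ∏ i, letterDiff A.1 z f i χ := by
    rw [← Finset.add_sum_erase _ _ (Finset.mem_univ ∅)]
    have h3 : ∏ i, letterDiff ∅ z f i χ = ∏ i, f i χ := by simp [letterDiff]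
    rw [h3]
    congr 1
    refine (Finset.sum_subtype _ (fun A => ?_) _)
    simp [Finset.nonempty_iff_ne_empty]
  simp only [addOneCost]
  rw [key, h2]; ring

/-- The word expansion is the iterated add-one cost of the product. -/
lemma wordExpansion_eq {m : ℕ} (f : Fin m → Measure Z → ℝ) (q : ℕ) (z : Fin q → Z) :
    wordExpansion f q z = iterDiff q z (fun χ => ∏ i, f i χ) := by
  induction q with
  | zero =>
    funext χ
    simp [wordExpansion, wordDiff]
  | succ q ih =>
    funext χ
    rw [iterDiff_succ, ← ih]
    have hsum : wordExpansion f q (Fin.tail z)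
        = ∑ W : Word m q, fun χ => ∏ i, wordDiff q W (Fin.tail z) f i χ := by
      funext χ; simp [wordExpansion]
    rw [hsum, addOneCost_sum, Finset.sum_apply]
    simp_rw [← sum_prod_letterDiff]
    unfold wordExpansion
    rw [← (Fin.consEquiv fun _ : Fin (q + 1) => {A : Finset (Fin m) // A.Nonempty}).sum_comp,
      Fintype.sum_prod_type, Finset.sum_comm]
    refine Finset.sum_congr rfl fun W _ => Finset.sum_congr rfl fun A _ => ?_
    simp [wordDiff, Fin.consEquiv]

/-! ### Powers of a measure -/

lemma measurable_cons (q : ℕ) : Measurable fun p : Z × (Fin q → Z) =>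
    (Fin.cons p.1 p.2 : Fin (q + 1) → Z) := by
  refine measurable_pi_lambda _ fun i => ?_
  refine Fin.cases ?_ (fun j => ?_) i
  · simpa using measurable_fst
  · simpa [Function.comp_def] using (measurable_pi_apply j).comp measurable_snd

lemma measurePreserving_cons (μ : Measure Z) [SigmaFinite μ] (q : ℕ) :
    MeasurePreserving (fun p : Z × (Fin q → Z) => (Fin.cons p.1 p.2 : Fin (q + 1) → Z))
      (μ.prod (powMeasure μ q)) (powMeasure μ (q + 1)) := by
  have := (measurePreserving_piFinSuccAbove (fun _ : Fin (q + 1) => μ) 0).symm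
  convert this using 1
  funext p
  simp [MeasurableEquiv.piFinSuccAbove, Fin.insertNthEquiv]

lemma lintegral_powMeasure_succ (μ : Measure Z) [SigmaFinite μ] (q : ℕ)
    {F : (Fin (q + 1) → Z) → ℝ≥0∞} (hF : Measurable F) :
    ∫⁻ z, F z ∂(powMeasure μ (q + 1)) = ∫⁻ w, ∫⁻ z, F (Fin.cons w z) ∂(powMeasure μ q) ∂μ := by
  rw [← (measurePreserving_cons μ q).map_eq, lintegral_map hF (measurable_cons q)]
  exact lintegral_prod _ (hF.comp (measurable_cons q)).aemeasurable

lemma ae_powMeasure_succ (μ : Measure Z) [SigmaFinite μ] (q : ℕ) {p : (Fin (q + 1) → Z) → Prop}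
    (hp : MeasurableSet {z | p z}) :
    (∀ᵐ z ∂(powMeasure μ (q + 1)), p z) ↔
      ∀ᵐ w ∂μ, ∀ᵐ z ∂(powMeasure μ q), p (Fin.cons w z) := by
  rw [← (measurePreserving_cons μ q).map_eq, ae_map_iff (measurable_cons q).aemeasurable hp]
  exact Measure.ae_prod_iff_ae_ae (measurable_cons q hp)

lemma measurePreserving_comp_perm (μ : Measure Z) [SigmaFinite μ] (q : ℕ)
    (s : Equiv.Perm (Fin q)) :
    MeasurePreserving (fun z : Fin q → Z => fun i => z (s i)) (powMeasure μ q)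
      (powMeasure μ q) := by
  have := (measurePreserving_piCongrLeft (fun _ : Fin q => μ) s).symm
  convert this using 1
  funext z i
  simp [MeasurableEquiv.piCongrLeft]

end PoissonChaos

namespace PoissonChaos

variable {Z : Type*} [MeasurableSpace Z]

/-! ### The Mecke equation -/

/-- `Λ` is the law of a random measure that is integer-valued on sets of finite intensity and that
satisfies the Mecke equation with intensity `μ`. -/
structure IsMeckeLaw (Λ : Measure (Measure Z)) (μ : Measure Z) : Prop where
  prob : IsProbabilityMeasure Λ
  natValued : ∀ B, MeasurableSet B → μ B < ∞ → ∀ᵐ χ ∂Λ, ∃ n : ℕ, χ B = (n : ℝ≥0∞)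
  mecke : ∀ B, MeasurableSet B → μ B < ∞ → ∀ g : Measure Z → ℝ≥0∞, Measurable g →
    ∫⁻ χ, χ B * g χ ∂Λ = ∫⁻ z in B, ∫⁻ χ, g (χ + Measure.dirac z) ∂Λ ∂μ

lemma lintegral_extPoisson {r : ℝ≥0∞} (hr : r ≠ ∞) {h : ℝ≥0∞ → ℝ≥0∞} (hh : Measurable h) :
    ∫⁻ x, h x ∂(extPoisson r)
      = ∑' n : ℕ, ENNReal.ofReal (Real.exp (-r.toReal) * r.toReal ^ n / n.factorial) * h n := by
  rw [extPoisson, if_neg hr, lintegral_map hh (by fun_prop), poissonMeasure, lintegral_sum_measure]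
  refine tsum_congr fun n => ?_
  rw [lintegral_smul_measure, lintegral_dirac]
  rfl

/-- The Mecke equation for a single Poisson variable. The term of index `0` drops out and the others
shift by one, because `(n + 1) r^(n+1) / (n + 1)! = r · r^n / n!`. -/
lemma lintegral_extPoisson_mul {r : ℝ≥0∞} (hr : r ≠ ∞) {h : ℝ≥0∞ → ℝ≥0∞} (hh : Measurable h) :
    ∫⁻ x, x * h x ∂(extPoisson r) = r * ∫⁻ x, h (x + 1) ∂(extPoisson r) := by
  rw [lintegral_extPoisson hr (by fun_prop), lintegral_extPoisson hr (by fun_prop),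
    ← ENNReal.tsum_mul_left, tsum_eq_zero_add' ENNReal.summable]
  simp only [Nat.cast_zero, zero_mul, mul_zero, zero_add]
  refine tsum_congr fun n => ?_
  have h1 : (((n + 1 : ℕ) : ℝ≥0∞)) = ENNReal.ofReal (n + 1 : ℝ) := by
    rw [← ENNReal.ofReal_natCast]; push_cast; rfl
  have h2 : r = ENNReal.ofReal r.toReal := (ENNReal.ofReal_toReal hr).symm
  have h3 : ENNReal.ofReal (Real.exp (-r.toReal) * r.toReal ^ (n + 1) / (n + 1).factorial)
      * ((n + 1 : ℕ) : ℝ≥0∞)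
      = r * ENNReal.ofReal (Real.exp (-r.toReal) * r.toReal ^ n / n.factorial) := by
    rw [h1]
    nth_rewrite 3 [h2]
    rw [← ENNReal.ofReal_mul (by positivity), ← ENNReal.ofReal_mul (by positivity)]
    congr 1
    rw [Nat.factorial_succ]
    push_cast
    field_simp
    ring
  rw [← mul_assoc, ← mul_assoc, h3]
  push_cast
  rfl

instance isProbabilityMeasure_extPoisson (r : ℝ≥0∞) : IsProbabilityMeasure (extPoisson r) := by
  rw [extPoisson]
  split_ifs
  · infer_instance
  · exact Measure.isProbabilityMeasure_map .of_discrete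

lemma lintegral_pi_extPoisson_mul {n : ℕ} (r : Fin n → ℝ≥0∞) (j : Fin n) (hr : r j ≠ ∞)
    {G : (Fin n → ℝ≥0∞) → ℝ≥0∞} (hG : Measurable G) :
    ∫⁻ x, x j * G x ∂(Measure.pi fun i => extPoisson (r i))
      = r j * ∫⁻ x, G (Function.update x j (x j + 1)) ∂(Measure.pi fun i => extPoisson (r i)) := by
  cases n with
  | zero => exact j.elim0
  | succ n =>
    have hmp := (measurePreserving_piFinSuccAbove (fun i => extPoisson (r i)) j).symm
    have hme : Measurable fun p : ℝ≥0∞ × (Fin n → ℝ≥0∞) =>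
        (j.insertNth p.1 p.2 : Fin (n + 1) → ℝ≥0∞) :=
      (MeasurableEquiv.piFinSuccAbove (fun _ : Fin (n + 1) => ℝ≥0∞) j).symm.measurable
    have key : ∀ H : (Fin (n + 1) → ℝ≥0∞) → ℝ≥0∞, Measurable H →
        ∫⁻ x, H x ∂(Measure.pi fun i => extPoisson (r i))
          = ∫⁻ y, ∫⁻ x, H (j.insertNth x y) ∂(extPoisson (r j))
              ∂(Measure.pi fun i => extPoisson (r (j.succAbove i))) := by
      intro H hH
      rw [← hmp.map_eq, lintegral_map hH hmp.measurable]
      exact lintegral_prod_symm _ (hH.comp hmp.measurable).aemeasurable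
    have hup : Measurable fun x : Fin (n + 1) → ℝ≥0∞ => Function.update x j (x j + 1) := by
      refine measurable_pi_lambda _ fun i => ?_
      by_cases h : i = j
      · subst h; simp only [Function.update_self]; exact (measurable_pi_apply i).add_const 1
      · simpa [h] using measurable_pi_apply i
    have hGu : Measurable fun x : Fin (n + 1) → ℝ≥0∞ => G (Function.update x j (x j + 1)) :=
      hG.comp hup
    rw [key _ (by fun_prop), key _ hGu, ← lintegral_const_mul]
    · refine lintegral_congr fun y => ?_
      simp only [Fin.insertNth_apply_same, Fin.update_insertNth]
      exact lintegral_extPoisson_mul hr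
        (hG.comp (hme.comp (measurable_id.prodMk measurable_const)))
    · refine Measurable.lintegral_prod_left' (f := fun p : ℝ≥0∞ × (Fin n → ℝ≥0∞) =>
        G (Function.update (j.insertNth p.1 p.2 : Fin (n + 1) → ℝ≥0∞) j
          ((j.insertNth p.1 p.2 : Fin (n + 1) → ℝ≥0∞) j + 1))) ?_
      exact (hG.comp hup).comp hme

section Poisson

variable {Ω : Type*} [MeasurableSpace Ω] {η : Ω → Measure Z} {μ : Measure Z} {P : Measure Ω}
  [IsProbabilityMeasure P]

/-- The Mecke equation for functionals of the numbers of points in the cells of a partition. -/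
lemma IsPoissonRandomMeasure.mecke_cell (hη : IsPoissonRandomMeasure η μ P) {n : ℕ}
    (D : Fin n → Set Z) (hD : ∀ i, MeasurableSet (D i))
    (hdisj : Pairwise fun i j => Disjoint (D i) (D j)) (j : Fin n) (hj : μ (D j) < ∞)
    {G : (Fin n → ℝ≥0∞) → ℝ≥0∞} (hG : Measurable G) :
    ∫⁻ χ, χ (D j) * G (fun i => χ (D i)) ∂(P.map η)
      = ∫⁻ z in D j, ∫⁻ χ, G (fun i => (χ + Measure.dirac z) (D i)) ∂(P.map η) ∂μ := by
  have hm : Measurable fun χ : Measure Z => fun i => χ (D i) :=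
    measurable_pi_lambda _ fun i => Measure.measurable_coe (hD i)
  have hlaw : (P.map η).map (fun χ : Measure Z => fun i => χ (D i))
      = Measure.pi fun i => extPoisson (μ (D i)) := by
    rw [Measure.map_map hm hη.measurable]
    have := (hη.indep n D hD hdisj).map_fun_eq_pi_map
      (fun i => ((Measure.measurable_coe (hD i)).comp hη.measurable).aemeasurable)
    rw [show (fun i => extPoisson (μ (D i))) = fun i => P.map fun ω => η ω (D i) from
      funext fun i => (hη.law _ (hD i)).symm]
    exact this
  have hup : Measurable fun x : Fin n → ℝ≥0∞ => Function.update x j (x j + 1) := by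
    refine measurable_pi_lambda _ fun i => ?_
    by_cases h : i = j
    · rw [h]; simp only [Function.update_self]; exact (measurable_pi_apply j).add_const 1
    · simpa [h] using measurable_pi_apply i
  have h1 := lintegral_pi_extPoisson_mul (fun i => μ (D i)) j hj.ne hG
  have hGu : Measurable fun x : Fin n → ℝ≥0∞ => G (Function.update x j (x j + 1)) :=
    hG.comp hup
  rw [← hlaw, lintegral_map (by fun_prop) hm, lintegral_map hGu hm] at h1
  rw [h1]
  have h2 : ∀ z ∈ D j, ∫⁻ χ, G (fun i => (χ + Measure.dirac z) (D i)) ∂(P.map η)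
      = ∫⁻ χ, G (Function.update (fun i => χ (D i)) j (χ (D j) + 1)) ∂(P.map η) := by
    intro z hz
    refine lintegral_congr fun χ => ?_
    congr 1
    funext i
    by_cases h : i = j
    · subst h
      simp [Measure.dirac_apply' _ (hD i), hz]
    · have : z ∉ D i := fun hzi => Set.disjoint_left.1 (hdisj h) hzi hz
      simp [Measure.dirac_apply' _ (hD i), this, h]
  rw [setLIntegral_congr_fun (hD j) h2, lintegral_const, Measure.restrict_apply_univ, mul_comm]

/-- The map `f` encodes a finite partition and `J` selects the cells that make up a set of finite
intensity. The count on that set is the sum of the counts of its cells, so `mecke_cell` can be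
summed; cells outside `J` may have infinite intensity. -/
lemma IsPoissonRandomMeasure.mecke_partition (hη : IsPoissonRandomMeasure η μ P) {n : ℕ}
    (f : Z → Fin n) (hf : ∀ i, MeasurableSet (f ⁻¹' {i})) (J : Finset (Fin n))
    (hJ : μ (f ⁻¹' J) < ∞) {G : (Fin n → ℝ≥0∞) → ℝ≥0∞} (hG : Measurable G) :
    ∫⁻ χ, χ (f ⁻¹' J) * G (fun i => χ (f ⁻¹' {i})) ∂(P.map η)
      = ∫⁻ z in f ⁻¹' J, ∫⁻ χ, G (fun i => (χ + Measure.dirac z) (f ⁻¹' {i})) ∂(P.map η) ∂μ := by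
  have hm : Measurable fun χ : Measure Z => fun i => χ (f ⁻¹' {i}) :=
    measurable_pi_lambda _ fun i => Measure.measurable_coe (hf i)
  have hdisj : Pairwise fun i j => Disjoint (f ⁻¹' {i}) (f ⁻¹' {j}) := by
    intro i j hij
    exact Disjoint.preimage f (by simpa using hij)
  have hU : f ⁻¹' J = ⋃ i ∈ J, f ⁻¹' {i} := by
    ext z; simp
  have h1 : ∀ χ : Measure Z, χ (f ⁻¹' J) = ∑ i ∈ J, χ (f ⁻¹' {i}) := fun χ =>
    (sum_measure_preimage_singleton J fun i _ => hf i).symm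
  simp_rw [h1, Finset.sum_mul]
  have hGm : Measurable fun χ : Measure Z => G fun i => χ (f ⁻¹' {i}) := hG.comp hm
  rw [lintegral_finsetSum _ fun i _ => Measurable.fun_mul (Measure.measurable_coe (hf i)) hGm, hU,
    lintegral_biUnion_finset (fun i _ j _ hij => hdisj hij) (fun i _ => hf i)]
  refine Finset.sum_congr rfl fun i hi => ?_
  refine hη.mecke_cell _ hf hdisj i (lt_of_le_of_lt (measure_mono ?_) hJ) hG
  intro z hz
  simp only [Set.mem_preimage, Set.mem_singleton_iff] at hz
  simp [hz, hi]

/-- A Poisson random measure satisfies the Mecke equation. -/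
theorem IsPoissonRandomMeasure.isMeckeLaw (hη : IsPoissonRandomMeasure η μ P) [SigmaFinite μ] :
    IsMeckeLaw (P.map η) μ := by
  classical
  have hprob : IsProbabilityMeasure (P.map η) :=
    Measure.isProbabilityMeasure_map hη.measurable.aemeasurable
  have hmean : ∀ B, MeasurableSet B → μ B < ∞ → ∫⁻ χ, χ B ∂(P.map η) = μ B := by
    intro B hB hfin
    have h1 : ∫⁻ χ, χ B ∂(P.map η) = ∫⁻ x, x * 1 ∂(extPoisson (μ B)) := by
      have hm : Measurable fun ω => η ω B := (Measure.measurable_coe hB).comp hη.measurable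
      rw [← hη.law B hB, lintegral_map (by fun_prop) hm,
        lintegral_map (Measure.measurable_coe hB) hη.measurable]
      simp
    rw [h1, lintegral_extPoisson_mul (h := fun _ => 1) hfin.ne measurable_const]
    simp
  refine ⟨hprob, ?_, ?_⟩
  · intro B hB hfin
    have h1 : ∀ᵐ χ ∂(P.map η), χ B < ∞ :=
      ae_lt_top (Measure.measurable_coe hB) (by rw [hmean B hB hfin]; exact hfin.ne)
    have h2 := ae_of_ae_map hη.measurable.aemeasurable h1
    have hms : MeasurableSet {χ : Measure Z | ∃ n : ℕ, χ B = (n : ℝ≥0∞)} := by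
      have : {χ : Measure Z | ∃ n : ℕ, χ B = (n : ℝ≥0∞)}
          = ⋃ n : ℕ, (fun χ : Measure Z => χ B) ⁻¹' {(n : ℝ≥0∞)} := by ext; simp
      rw [this]
      exact MeasurableSet.iUnion fun n => Measure.measurable_coe hB (measurableSet_singleton _)
    refine (ae_map_iff hη.measurable.aemeasurable hms).2 ?_
    filter_upwards [h2] with ω hω
    exact ((hη.isPointMeasure ω).integer_valued B hB).resolve_left hω.ne
  · intro B hB hfin g hg
    have hadd : Measurable fun p : Z × Measure Z => p.2 + Measure.dirac p.1 := measurable_add_dirac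
    -- The Mecke equation on `B` is an identity of finite measures on the space of measures. It
    -- therefore suffices to test it on the π-system of events determined by the values on finitely
    -- many sets.
    have key : (P.map η).withDensity (fun χ => χ B)
        = ((μ.restrict B).prod (P.map η)).map (fun p => p.2 + Measure.dirac p.1) := by
      have : IsFiniteMeasure ((P.map η).withDensity (fun χ => χ B)) :=
        isFiniteMeasure_withDensity (by rw [hmean B hB hfin]; exact hfin.ne)
      have hkey : ∀ A ∈ piiUnionInter (fun s : Set Z => {A : Set (Measure Z) |
          MeasurableSet[(borel ℝ≥0∞).comap fun χ : Measure Z => χ s] A}) {s | MeasurableSet s},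
          (P.map η).withDensity (fun χ => χ B) A
            = ((μ.restrict B).prod (P.map η)).map (fun p => p.2 + Measure.dirac p.1) A := by
        rintro A ⟨t, ht, F, hF, hA⟩
        -- The cells are the atoms of the algebra generated by `B` and the finitely many sets in
        -- `t`; each point is sent to its pattern of memberships.
        let β := {s : Set Z // s ∈ insert B t} → Prop
        let e : β ≃ Fin (Fintype.card β) := Fintype.equivFin β
        let τ : Z → β := fun z s => z ∈ s.1
        let f : Z → Fin (Fintype.card β) := fun z => e (τ z)
        have hmeas : ∀ s : {s : Set Z // s ∈ insert B t}, MeasurableSet s.1 := by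
          rintro ⟨s, hs⟩
          rcases Finset.mem_insert.1 hs with rfl | hs
          · exact hB
          · exact ht hs
        have hf : ∀ i, MeasurableSet (f ⁻¹' {i}) := by
          intro i
          have : f ⁻¹' {i} = ⋂ s : {s : Set Z // s ∈ insert B t}, {z | z ∈ s.1 ↔ e.symm i s} := by
            ext z
            simp only [f, Set.mem_preimage, Set.mem_singleton_iff, Set.mem_iInter,
              Set.mem_ofPred_eq]
            rw [← Equiv.eq_symm_apply, funext_iff]
            simp [τ]
          rw [this]
          refine MeasurableSet.iInter fun s => ?_
          by_cases h : e.symm i s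
          · simpa [h] using hmeas s
          · simp only [h, iff_false]; exact (hmeas s).compl
        let I : {s : Set Z // s ∈ insert B t} → Finset (Fin (Fintype.card β)) :=
          fun s => Finset.univ.filter fun i => e.symm i s
        have hI : ∀ s : {s : Set Z // s ∈ insert B t}, f ⁻¹' (I s) = s.1 := by
          intro s
          ext z
          simp [I, f, τ]
        have hval : ∀ (χ : Measure Z) (s : {s : Set Z // s ∈ insert B t}),
            χ s.1 = ∑ i ∈ I s, χ (f ⁻¹' {i}) := by
          intro χ s
          rw [sum_measure_preimage_singleton (I s) fun i _ => hf i, hI]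
        have hE : ∀ s : {s : Set Z // s ∈ t}, ∃ E : Set ℝ≥0∞, MeasurableSet E ∧
            (fun χ : Measure Z => χ s.1) ⁻¹' E = F s.1 := by
          intro s
          obtain ⟨E, hE1, hE2⟩ := hF s.1 s.2
          refine ⟨E, ?_, hE2⟩
          rwa [BorelSpace.measurable_eq (α := ℝ≥0∞)]
        choose E hE1 hE2 using hE
        let T : Set (Fin (Fintype.card β) → ℝ≥0∞) := ⋂ s : {s : Set Z // s ∈ t},
          {x | ∑ i ∈ I ⟨s.1, Finset.mem_insert_of_mem s.2⟩, x i ∈ E s}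
        have hT : MeasurableSet T := MeasurableSet.iInter fun s =>
          (Finset.measurable_sum _ fun i _ => measurable_pi_apply i) (hE1 s)
        have hAT : ∀ χ : Measure Z, χ ∈ A ↔ (fun i => χ (f ⁻¹' {i})) ∈ T := by
          intro χ
          rw [hA]
          simp only [T, Set.mem_iInter, Set.mem_ofPred_eq, Subtype.forall]
          refine forall₂_congr fun s hs => ?_
          rw [← hval χ ⟨s, Finset.mem_insert_of_mem hs⟩, ← hE2 ⟨s, hs⟩]
          rfl
        have hmp : Measurable fun χ : Measure Z => fun i => χ (f ⁻¹' {i}) :=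
          measurable_pi_lambda _ fun i => Measure.measurable_coe (hf i)
        have hAm : MeasurableSet A := by
          have : A = (fun χ : Measure Z => fun i => χ (f ⁻¹' {i})) ⁻¹' T := by
            ext χ; exact hAT χ
          rw [this]; exact hmp hT
        have hBI := hI ⟨B, Finset.mem_insert_self _ _⟩
        simp only at hBI
        have hG : Measurable (T.indicator fun _ => (1 : ℝ≥0∞)) := measurable_const.indicator hT
        have := hη.mecke_partition f hf (I ⟨B, Finset.mem_insert_self _ _⟩)
          (by rw [hBI]; exact hfin) hG
        rw [hBI] at this
        have hind : ∀ χ : Measure Z, T.indicator (fun _ => (1 : ℝ≥0∞)) (fun i => χ (f ⁻¹' {i}))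
            = A.indicator (fun _ => 1) χ := by
          intro χ
          by_cases h : χ ∈ A
          · rw [Set.indicator_of_mem h, Set.indicator_of_mem ((hAT χ).1 h)]
          · rw [Set.indicator_of_notMem h, Set.indicator_of_notMem (fun h' => h ((hAT χ).2 h'))]
        simp_rw [hind] at this
        rw [withDensity_apply _ hAm, ← lintegral_indicator hAm, ← lintegral_indicator_one hAm,
          lintegral_map (measurable_one.indicator hAm) hadd, lintegral_prod]
        · refine Eq.trans ?_ this
          refine lintegral_congr fun χ => ?_
          by_cases h : χ ∈ A <;> simp [h]
        · exact ((measurable_one.indicator hAm).comp hadd).aemeasurable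
      refine ext_of_generate_finite _ ?_ (isPiSystem_piiUnionInter _ (fun s => ?_) _) hkey ?_
      · exact (generateFrom_piiUnionInter_measurableSet _ _).symm
      · exact @MeasurableSpace.isPiSystem_measurableSet _
          ((borel ℝ≥0∞).comap fun χ : Measure Z => χ s)
      · refine hkey _ ⟨∅, by simp, fun _ => Set.univ, by simp, by simp⟩
    calc ∫⁻ χ, χ B * g χ ∂(P.map η)
        = ∫⁻ χ, g χ ∂((P.map η).withDensity (fun χ => χ B)) := by
          rw [lintegral_withDensity_eq_lintegral_mul _ (Measure.measurable_coe hB) hg]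
          rfl
      _ = _ := by
          rw [key, lintegral_map hg hadd]
          exact lintegral_prod _ (hg.comp hadd).aemeasurable

end Poisson

end PoissonChaos

namespace PoissonChaos

variable {Z : Type*} [MeasurableSpace Z]

/-! ### Poisson laws with finite intensity -/

/-- The point measure `δ_{z₁} + ⋯ + δ_{z_n}`. -/
noncomputable def pointSum (n : ℕ) (z : Fin n → Z) : Measure Z := ∑ i, Measure.dirac (z i)

lemma measurable_pointSum (n : ℕ) : Measurable (pointSum n : (Fin n → Z) → Measure Z) :=
  Finset.measurable_fun_sum _ fun i _ => Measure.measurable_dirac.comp (measurable_pi_apply i)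

lemma pointSum_insertNth (n : ℕ) (i : Fin (n + 1)) (w : Z) (z : Fin n → Z) :
    pointSum (n + 1) (i.insertNth w z : Fin (n + 1) → Z) = pointSum n z + Measure.dirac w := by
  rw [pointSum, Fin.sum_univ_succAbove _ i, add_comm]
  simp [pointSum]

lemma measurable_insertNth (n : ℕ) (i : Fin (n + 1)) :
    Measurable fun p : Z × (Fin n → Z) => (i.insertNth p.1 p.2 : Fin (n + 1) → Z) :=
  (MeasurableEquiv.piFinSuccAbove (fun _ : Fin (n + 1) => Z) i).symm.measurable

lemma measurePreserving_insertNth (μ : Measure Z) [SigmaFinite μ] (n : ℕ) (i : Fin (n + 1)) :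
    MeasurePreserving (fun p : Z × (Fin n → Z) => (i.insertNth p.1 p.2 : Fin (n + 1) → Z))
      (μ.prod (powMeasure μ n)) (powMeasure μ (n + 1)) :=
  (measurePreserving_piFinSuccAbove (fun _ : Fin (n + 1) => μ) i).symm

/-- The law of a Poisson random measure with finite intensity `ν`. -/
noncomputable def poissonLaw (ν : Measure Z) : Measure (Measure Z) :=
  Measure.sum fun n : ℕ => ENNReal.ofReal (Real.exp (-(ν.real Set.univ)) / n.factorial) •
    (powMeasure ν n).map (pointSum n)

lemma lintegral_poissonLaw (ν : Measure Z) {g : Measure Z → ℝ≥0∞} (hg : Measurable g) :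
    ∫⁻ χ, g χ ∂(poissonLaw ν) = ∑' n : ℕ,
      ENNReal.ofReal (Real.exp (-(ν.real Set.univ)) / n.factorial)
        * ∫⁻ z, g (pointSum n z) ∂(powMeasure ν n) := by
  rw [poissonLaw, lintegral_sum_measure]
  refine tsum_congr fun n => ?_
  rw [lintegral_smul_measure, lintegral_map hg (measurable_pointSum n), smul_eq_mul]

/-- Under `powMeasure ν (n + 1)` the count on `B` is a sum of `n + 1` indicators, all giving the
same integral by symmetry. Isolating the chosen point leaves `n` points, and the factor `n + 1`
turns the weight `1 / (n + 1)!` into `1 / n!`. The term with no points contributes nothing. -/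
lemma isMeckeLaw_poissonLaw (ν : Measure Z) [IsFiniteMeasure ν] :
    IsMeckeLaw (poissonLaw ν) ν := by
  refine ⟨⟨?_⟩, ?_, ?_⟩
  · have h1 : poissonLaw ν Set.univ = ∫⁻ χ, 1 ∂(poissonLaw ν) := by simp
    rw [h1, lintegral_poissonLaw ν measurable_const]
    have h2 : ∀ n : ℕ, ENNReal.ofReal (Real.exp (-(ν.real Set.univ)) / n.factorial)
        * ∫⁻ _, 1 ∂(powMeasure ν n)
        = ENNReal.ofReal (Real.exp (-(ν.real Set.univ)) * (ν.real Set.univ) ^ n / n.factorial) := by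
      intro n
      have : ∫⁻ _, 1 ∂(powMeasure ν n) = ENNReal.ofReal ((ν.real Set.univ) ^ n) := by
        rw [lintegral_one, Measure.pi_univ, Finset.prod_const, Finset.card_univ, Fintype.card_fin,
          ENNReal.ofReal_pow (by positivity), measureReal_def,
          ENNReal.ofReal_toReal (measure_ne_top _ _)]
      rw [this, ← ENNReal.ofReal_mul (by positivity)]
      congr 1; ring
    simp_rw [h2]
    have h3 : HasSum (fun n : ℕ => Real.exp (-ν.real Set.univ) * ν.real Set.univ ^ n / n.factorial) 1 :=
      hasSum_one_poissonMeasure ⟨ν.real Set.univ, measureReal_nonneg⟩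
    rw [← ENNReal.ofReal_tsum_of_nonneg (fun n => by have : 0 ≤ ν.real Set.univ := measureReal_nonneg
                                                     positivity) h3.summable]
    exact (congrArg ENNReal.ofReal h3.tsum_eq).trans ENNReal.ofReal_one
  · intro B hB _
    have hms : MeasurableSet {χ : Measure Z | ∃ n : ℕ, χ B = (n : ℝ≥0∞)} := by
      have : {χ : Measure Z | ∃ n : ℕ, χ B = (n : ℝ≥0∞)}
          = ⋃ n : ℕ, (fun χ : Measure Z => χ B) ⁻¹' {(n : ℝ≥0∞)} := by ext; simp
      rw [this]
      exact MeasurableSet.iUnion fun n => Measure.measurable_coe hB (measurableSet_singleton _)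
    rw [poissonLaw, Measure.ae_sum_iff' hms]
    intro n
    refine Measure.ae_smul_measure ?_ _
    rw [ae_map_iff (measurable_pointSum n).aemeasurable hms]
    refine Filter.Eventually.of_forall fun z => ?_
    classical
    refine ⟨∑ i, if z i ∈ B then 1 else 0, ?_⟩
    rw [pointSum, Measure.coe_finsetSum, Finset.sum_apply]
    push_cast
    exact Finset.sum_congr rfl fun i _ => by
      rw [Measure.dirac_apply' _ hB]
      by_cases h : z i ∈ B <;> simp [h]
  · intro B hB _ g hg
    have hms : Measurable fun χ : Measure Z => χ B := Measure.measurable_coe hB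
    have hadd : Measurable fun p : Z × Measure Z => g (p.2 + Measure.dirac p.1) :=
      hg.comp measurable_add_dirac
    have hc : ∀ n : ℕ, ENNReal.ofReal (Real.exp (-(ν.real Set.univ)) / (n + 1).factorial)
        * (n + 1 : ℕ) = ENNReal.ofReal (Real.exp (-(ν.real Set.univ)) / n.factorial) := by
      intro n
      rw [← ENNReal.ofReal_natCast, ← ENNReal.ofReal_mul (by positivity)]
      congr 1
      rw [Nat.factorial_succ]
      push_cast
      field_simp
    have hterm : ∀ n : ℕ, ∫⁻ z, (pointSum (n + 1) z) B * g (pointSum (n + 1) z)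
          ∂(powMeasure ν (n + 1))
        = (n + 1 : ℕ) * ∫⁻ w in B, ∫⁻ z, g (pointSum n z + Measure.dirac w) ∂(powMeasure ν n) ∂ν := by
      intro n
      have hpg : Measurable fun z : Fin (n + 1) → Z => g (pointSum (n + 1) z) :=
        hg.comp (measurable_pointSum _)
      have h1 : ∀ z : Fin (n + 1) → Z, (pointSum (n + 1) z) B * g (pointSum (n + 1) z)
          = ∑ i, B.indicator 1 (z i) * g (pointSum (n + 1) z) := by
        intro z
        rw [pointSum, Measure.coe_finsetSum, Finset.sum_apply, Finset.sum_mul]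
        simp_rw [Measure.dirac_apply' _ hB]
      simp_rw [h1]
      have hi : ∀ i : Fin (n + 1), Measurable fun z : Fin (n + 1) → Z =>
          (B.indicator 1 (z i) : ℝ≥0∞) * g (pointSum (n + 1) z) := fun i =>
        Measurable.fun_mul ((measurable_one.indicator hB).comp (measurable_pi_apply i)) hpg
      rw [lintegral_finsetSum _ fun i _ => hi i]
      have h2 : ∀ i : Fin (n + 1), ∫⁻ z, (B.indicator 1 (z i) : ℝ≥0∞) * g (pointSum (n + 1) z)
          ∂(powMeasure ν (n + 1))
          = ∫⁻ w in B, ∫⁻ z, g (pointSum n z + Measure.dirac w) ∂(powMeasure ν n) ∂ν := by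
        intro i
        rw [← (measurePreserving_insertNth ν n i).map_eq,
          lintegral_map (hi i) (measurable_insertNth n i), ← lintegral_indicator hB]
        refine (lintegral_prod _
          ((hi i).comp (measurable_insertNth n i)).aemeasurable).trans ?_
        refine lintegral_congr fun w => ?_
        have h5 : ∀ z : Fin n → Z, (B.indicator 1 ((i.insertNth w z : Fin (n + 1) → Z) i) : ℝ≥0∞)
            * g (pointSum (n + 1) (i.insertNth w z : Fin (n + 1) → Z))
            = B.indicator 1 w * g (pointSum n z + Measure.dirac w) := fun z => by
          rw [Fin.insertNth_apply_same, pointSum_insertNth]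
        refine (lintegral_congr h5).trans ?_
        by_cases hw : w ∈ B <;> simp [hw]
      simp_rw [h2]
      simp
    rw [lintegral_poissonLaw ν (Measurable.fun_mul hms hg), tsum_eq_zero_add' ENNReal.summable]
    have h0 : ∫⁻ z, ((pointSum 0 z) B * g (pointSum 0 z)) ∂(powMeasure ν 0) = 0 := by
      simp [pointSum]
    simp only [h0, mul_zero, zero_add]
    simp_rw [hterm, ← mul_assoc, hc]
    have h3 : ∀ w, ∫⁻ χ, g (χ + Measure.dirac w) ∂(poissonLaw ν) = ∑' n : ℕ,
        ENNReal.ofReal (Real.exp (-(ν.real Set.univ)) / n.factorial)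
        * ∫⁻ z, g (pointSum n z + Measure.dirac w) ∂(powMeasure ν n) := fun w =>
      lintegral_poissonLaw ν (hadd.comp measurable_prodMk_left)
    simp_rw [h3]
    have h4 : ∀ n, Measurable fun w => ∫⁻ z, g (pointSum n z + Measure.dirac w)
        ∂(powMeasure ν n) := by
      intro n
      refine Measurable.lintegral_prod_right' (f := fun p : Z × (Fin n → Z) =>
        g (pointSum n p.2 + Measure.dirac p.1)) ?_
      exact hadd.comp (measurable_fst.prodMk ((measurable_pointSum n).comp measurable_snd))
    rw [lintegral_tsum fun n => ((h4 n).const_mul _).aemeasurable]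
    refine tsum_congr fun n => ?_
    rw [lintegral_const_mul _ (h4 n)]

/-! ### Superposition and restriction of Mecke laws -/

lemma isMeckeLaw_dirac_zero : IsMeckeLaw (Measure.dirac (0 : Measure Z)) 0 := by
  refine ⟨inferInstance, ?_, ?_⟩
  · intro B hB _
    have hms : MeasurableSet {χ : Measure Z | ∃ n : ℕ, χ B = (n : ℝ≥0∞)} := by
      have : {χ : Measure Z | ∃ n : ℕ, χ B = (n : ℝ≥0∞)}
          = ⋃ n : ℕ, (fun χ : Measure Z => χ B) ⁻¹' {(n : ℝ≥0∞)} := by ext; simp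
      rw [this]
      exact MeasurableSet.iUnion fun n => Measure.measurable_coe hB (measurableSet_singleton _)
    rw [ae_dirac_iff hms]
    exact ⟨0, by simp⟩
  · intro B hB _ g hg
    rw [lintegral_dirac' _ (Measurable.fun_mul (Measure.measurable_coe hB) hg)]
    simp

/-- Superposition of independent point processes: the count splits as `χ₁ B + χ₂ B`, and each
summand is treated by its own Mecke equation with the other process frozen. -/
lemma IsMeckeLaw.conv {Λ₁ Λ₂ : Measure (Measure Z)} {μ₁ μ₂ : Measure Z} [SigmaFinite μ₁]
    [SigmaFinite μ₂] (h₁ : IsMeckeLaw Λ₁ μ₁) (h₂ : IsMeckeLaw Λ₂ μ₂) :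
    IsMeckeLaw (Λ₁.conv Λ₂) (μ₁ + μ₂) := by
  have := h₁.prob
  have := h₂.prob
  refine ⟨inferInstance, ?_, ?_⟩
  · intro B hB hfin
    have hlt : μ₁ B < ∞ ∧ μ₂ B < ∞ := by simpa using hfin
    have hms : MeasurableSet {χ : Measure Z | ∃ n : ℕ, χ B = (n : ℝ≥0∞)} := by
      have : {χ : Measure Z | ∃ n : ℕ, χ B = (n : ℝ≥0∞)}
          = ⋃ n : ℕ, (fun χ : Measure Z => χ B) ⁻¹' {(n : ℝ≥0∞)} := by ext; simp
      rw [this]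
      exact MeasurableSet.iUnion fun n => Measure.measurable_coe hB (measurableSet_singleton _)
    have hadd : Measurable fun p : Measure Z × Measure Z => p.1 + p.2 := measurable_add
    rw [Measure.conv, ae_map_iff hadd.aemeasurable hms]
    refine (Measure.ae_prod_iff_ae_ae (hadd hms)).2 ?_
    filter_upwards [h₁.natValued B hB hlt.1] with χ₁ hχ₁
    filter_upwards [h₂.natValued B hB hlt.2] with χ₂ hχ₂
    obtain ⟨n, hn⟩ := hχ₁
    obtain ⟨k, hk⟩ := hχ₂
    exact ⟨n + k, by simp [hn, hk]⟩
  · intro B hB hfin g hg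
    have hlt : μ₁ B < ∞ ∧ μ₂ B < ∞ := by simpa using hfin
    have hms : Measurable fun χ : Measure Z => χ B := Measure.measurable_coe hB
    have hgadd : Measurable fun p : Measure Z × Measure Z => g (p.1 + p.2) :=
      hg.comp measurable_add
    have hgx : ∀ x : Measure Z, Measurable fun y => g (x + y) := fun x =>
      hgadd.comp measurable_prodMk_left
    have hgy : ∀ y : Measure Z, Measurable fun x => g (x + y) := fun y =>
      hgadd.comp measurable_prodMk_right
    have hgd : Measurable fun p : Z × (Measure Z × Measure Z) =>
        g (p.2.1 + p.2.2 + Measure.dirac p.1) := hg.comp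
      ((measurable_add.comp measurable_snd).add (Measure.measurable_dirac.comp measurable_fst))
    rw [Measure.lintegral_conv (Measurable.fun_mul hms hg)]
    simp only [Measure.coe_add, Pi.add_apply, add_mul]
    have hA : Measurable fun p : Measure Z × Measure Z => p.1 B * g (p.1 + p.2) :=
      Measurable.fun_mul (hms.comp measurable_fst) hgadd
    have hA2 : Measurable fun p : Measure Z × Measure Z => p.2 B * g (p.1 + p.2) :=
      Measurable.fun_mul (hms.comp measurable_snd) hgadd
    have hsplit : ∫⁻ x, ∫⁻ y, (x B * g (x + y) + y B * g (x + y)) ∂Λ₂ ∂Λ₁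
        = ∫⁻ y, ∫⁻ x, x B * g (x + y) ∂Λ₁ ∂Λ₂ + ∫⁻ x, ∫⁻ y, y B * g (x + y) ∂Λ₂ ∂Λ₁ := by
      rw [lintegral_lintegral_swap (f := fun y x => x B * g (x + y)) (μ := Λ₂) (ν := Λ₁)
        (hA.comp measurable_swap).aemeasurable, ← lintegral_add_left hA.lintegral_prod_right']
      refine lintegral_congr fun x => ?_
      exact lintegral_add_left (hA.comp measurable_prodMk_left) _
    have hc : ∀ z, ∫⁻ χ, g (χ + Measure.dirac z) ∂(Λ₁.conv Λ₂)
        = ∫⁻ x, ∫⁻ y, g (x + y + Measure.dirac z) ∂Λ₂ ∂Λ₁ := fun z =>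
      Measure.lintegral_conv ((hg.comp measurable_add_dirac).comp measurable_prodMk_left)
    rw [hsplit, Measure.restrict_add, lintegral_add_measure]
    simp_rw [hc]
    congr 1
    · simp_rw [fun y : Measure Z => h₁.mecke B hB hlt.1 _ (hgy y)]
      rw [lintegral_lintegral_swap]
      · refine lintegral_congr fun z => ?_
        rw [lintegral_lintegral_swap]
        · refine lintegral_congr fun x => lintegral_congr fun y => ?_
          rw [add_right_comm]
        · exact (hgadd.comp (((measurable_snd.add measurable_const)).prodMk
            measurable_fst)).aemeasurable
      · refine Measurable.aemeasurable ?_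
        refine Measurable.lintegral_prod_right' (f := fun p : (Measure Z × Z) × Measure Z =>
          g (p.2 + Measure.dirac p.1.2 + p.1.1)) ?_
        exact hgadd.comp (((measurable_snd.add (Measure.measurable_dirac.comp
          (measurable_snd.comp measurable_fst)))).prodMk (measurable_fst.comp measurable_fst))
    · simp_rw [fun x : Measure Z => h₂.mecke B hB hlt.2 _ (hgx x)]
      rw [lintegral_lintegral_swap]
      · refine lintegral_congr fun z => lintegral_congr fun x => lintegral_congr fun y => ?_
        rw [add_assoc]
      · refine Measurable.aemeasurable ?_
        refine Measurable.lintegral_prod_right' (f := fun p : (Measure Z × Z) × Measure Z =>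
          g (p.1.1 + (p.2 + Measure.dirac p.1.2))) ?_
        exact hgadd.comp ((measurable_fst.comp measurable_fst).prodMk (measurable_snd.add
          (Measure.measurable_dirac.comp (measurable_snd.comp measurable_fst))))

open Classical in
/-- The restriction of a functional to the event that `n` points lie in `S`. -/
noncomputable def onLevel (S : Set Z) (n : ℕ) (h : Measure Z → ℝ≥0∞) : Measure Z → ℝ≥0∞ :=
  fun χ => if χ S = n then h χ else 0

lemma measurable_onLevel {S : Set Z} (hS : MeasurableSet S) (n : ℕ) {h : Measure Z → ℝ≥0∞}
    (hh : Measurable h) : Measurable (onLevel S n h) :=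
  Measurable.ite (Measure.measurable_coe hS (measurableSet_singleton (n : ℝ≥0∞))) hh
    measurable_const

/-- On the event of `n + 1` points in `S` the factor `χ S` of the Mecke equation is the constant `n
+ 1`, and adding a point of `S` raises the count from `n` to `n + 1`. This recursion expresses each
level through the empty one. -/
lemma IsMeckeLaw.level_succ {Λ : Measure (Measure Z)} {μ : Measure Z} (hΛ : IsMeckeLaw Λ μ)
    {S : Set Z} (hS : MeasurableSet S) (hfin : μ S < ∞) (n : ℕ) {h : Measure Z → ℝ≥0∞}
    (hh : Measurable h) :
    ((n + 1 : ℕ) : ℝ≥0∞) * ∫⁻ χ, onLevel S (n + 1) h χ ∂Λ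
      = ∫⁻ z in S, ∫⁻ χ, onLevel S n (fun χ => h (χ + Measure.dirac z)) χ ∂Λ ∂μ := by
  rw [← lintegral_const_mul _ (measurable_onLevel hS _ hh)]
  have h1 : ∀ χ : Measure Z, ((n + 1 : ℕ) : ℝ≥0∞) * onLevel S (n + 1) h χ
      = χ S * onLevel S (n + 1) h χ := by
    intro χ
    by_cases hχ : χ S = ((n + 1 : ℕ) : ℝ≥0∞)
    · rw [hχ]
    · simp only [onLevel, if_neg hχ, mul_zero]
  simp_rw [h1]
  rw [hΛ.mecke S hS hfin _ (measurable_onLevel hS _ hh)]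
  refine setLIntegral_congr_fun hS fun z hz => lintegral_congr fun χ => ?_
  have h2 : (χ + Measure.dirac z) S = ((n + 1 : ℕ) : ℝ≥0∞) ↔ χ S = n := by
    simp only [Measure.coe_add, Pi.add_apply, Measure.dirac_apply_of_mem hz]
    push_cast
    exact ENNReal.add_left_inj ENNReal.one_ne_top
  simp only [onLevel, h2]

lemma IsMeckeLaw.tsum_level {Λ : Measure (Measure Z)} {μ : Measure Z} (hΛ : IsMeckeLaw Λ μ)
    {S : Set Z} (hS : MeasurableSet S) (hfin : μ S < ∞) {h : Measure Z → ℝ≥0∞}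
    (hh : Measurable h) :
    ∫⁻ χ, h χ ∂Λ = ∑' n : ℕ, ∫⁻ χ, onLevel S n h χ ∂Λ := by
  rw [← lintegral_tsum fun n => (measurable_onLevel hS n hh).aemeasurable]
  refine lintegral_congr_ae ?_
  filter_upwards [hΛ.natValued S hS hfin] with χ ⟨n, hn⟩
  rw [tsum_eq_single n]
  · simp [onLevel, hn]
  · intro k hk
    simp [onLevel, hn, hk.symm]

lemma measurable_restrict {S : Set Z} (hS : MeasurableSet S) :
    Measurable fun χ : Measure Z => χ.restrict S := by
  refine Measure.measurable_of_measurable_coe _ fun s hs => ?_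
  simp_rw [Measure.restrict_apply hs]
  exact Measure.measurable_coe (hs.inter hS)

/-- Points in `S` are removed one by one from `Λ` with `level_succ`, and rebuilt one by one under
`Q` with the same recursion; the factors `n + 1` cancel. At level zero both sides are the integral
over configurations without points in `S`, times the probability that `Q` has no points, which
explains the extra factor on the left. -/
lemma IsMeckeLaw.level_mul {Λ Q : Measure (Measure Z)} {μ : Measure Z} [SigmaFinite μ]
    (hΛ : IsMeckeLaw Λ μ) {S : Set Z} (hS : MeasurableSet S) (hfin : μ S < ∞)
    (hQ : IsMeckeLaw Q (μ.restrict S)) (n : ℕ) :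
    ∀ {h : Measure Z → ℝ≥0∞}, Measurable h →
    (∫⁻ χ, onLevel S n h χ ∂Λ) * ∫⁻ χ, onLevel Set.univ 0 1 χ ∂Q
      = ∫⁻ χ₂, onLevel S 0 (fun χ₂ => ∫⁻ χ₁, onLevel Set.univ n
          (fun χ₁ => h (χ₁ + χ₂)) χ₁ ∂Q) χ₂ ∂Λ := by
  have := hΛ.prob
  have := hQ.prob
  have huniv : μ.restrict S Set.univ < ∞ := by simpa using hfin
  induction n with
  | zero =>
    intro h hh
    rw [← lintegral_mul_const _ (measurable_onLevel hS _ hh)]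
    refine lintegral_congr fun χ₂ => ?_
    by_cases h2 : χ₂ S = 0
    · have h3 := lintegral_const_mul (μ := Q) (h χ₂) (measurable_onLevel (h := 1)
        (MeasurableSet.univ (α := Z)) 0 measurable_one)
      simp only [onLevel, h2, Nat.cast_zero, if_true] at h3 ⊢
      rw [← h3]
      refine lintegral_congr fun χ₁ => ?_
      by_cases h1 : χ₁ = 0
      · simp [h1]
      · simp [h1]
    · simp [onLevel, h2]
  | succ n ih =>
    intro h hh
    have hadd : Measurable fun p : (Measure Z × Measure Z) => h (p.1 + p.2) :=
      hh.comp measurable_add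
    have hpos : ((n + 1 : ℕ) : ℝ≥0∞) ≠ 0 := by simp
    have hnt : ((n + 1 : ℕ) : ℝ≥0∞) ≠ ∞ := ENNReal.natCast_ne_top _
    have hm3 : Measurable fun p : (Measure Z × Z) × Measure Z =>
        onLevel Set.univ n (fun χ₁ => h (χ₁ + Measure.dirac p.1.2 + p.1.1)) p.2 := by
      refine Measurable.ite ((Measure.measurable_coe MeasurableSet.univ).comp measurable_snd
        (measurableSet_singleton (n : ℝ≥0∞))) ?_ measurable_const
      exact hadd.comp (((measurable_snd.add (Measure.measurable_dirac.comp
          (measurable_snd.comp measurable_fst)))).prodMk (measurable_fst.comp measurable_fst))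
    have hm2 : Measurable fun p : Measure Z × Z => onLevel S 0 (fun χ₂ => ∫⁻ χ₁,
        onLevel Set.univ n (fun χ₁ => h (χ₁ + Measure.dirac p.2 + χ₂)) χ₁ ∂Q) p.1 := by
      refine Measurable.ite ((Measure.measurable_coe hS).comp measurable_fst
        (measurableSet_singleton ((0 : ℕ) : ℝ≥0∞))) ?_ measurable_const
      exact hm3.lintegral_prod_right'
    refine (ENNReal.mul_right_inj hpos hnt).1 ?_
    rw [← mul_assoc, hΛ.level_succ hS hfin n hh]
    have hmL : Measurable fun z => ∫⁻ χ, onLevel S n (fun χ => h (χ + Measure.dirac z)) χ ∂Λ := by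
      refine Measurable.lintegral_prod_right' (f := fun p : Z × Measure Z =>
        onLevel S n (fun χ => h (χ + Measure.dirac p.1)) p.2) ?_
      exact Measurable.ite ((Measure.measurable_coe hS).comp measurable_snd
        (measurableSet_singleton (n : ℝ≥0∞))) (hh.comp measurable_add_dirac) measurable_const
    rw [← lintegral_mul_const _ hmL]
    have hstep : ∀ z, (∫⁻ χ, onLevel S n (fun χ => h (χ + Measure.dirac z)) χ ∂Λ)
        * ∫⁻ χ, onLevel Set.univ 0 1 χ ∂Q
        = ∫⁻ χ₂, onLevel S 0 (fun χ₂ => ∫⁻ χ₁, onLevel Set.univ n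
            (fun χ₁ => h (χ₁ + Measure.dirac z + χ₂)) χ₁ ∂Q) χ₂ ∂Λ := by
      intro z
      have h4 : Measurable fun χ => h (χ + Measure.dirac z) :=
        (hh.comp measurable_add_dirac).comp measurable_prodMk_left
      rw [ih h4]
      simp only [add_right_comm]
    simp_rw [hstep]
    rw [lintegral_lintegral_swap (f := fun z χ => onLevel S 0 (fun χ₂ => ∫⁻ χ₁,
        onLevel Set.univ n (fun χ₁ => h (χ₁ + Measure.dirac z + χ₂)) χ₁ ∂Q) χ)
        (hm2.comp measurable_swap).aemeasurable,
      ← lintegral_const_mul]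
    · refine lintegral_congr fun χ₂ => ?_
      by_cases h2 : χ₂ S = 0
      · simp only [onLevel, h2, Nat.cast_zero, if_true]
        have := hQ.level_succ MeasurableSet.univ huniv n (h := fun χ₁ => h (χ₁ + χ₂))
          (hadd.comp measurable_prodMk_right)
        simp only [onLevel, Measure.restrict_univ] at this
        rw [this]
      · simp [onLevel, h2]
    · refine Measurable.ite (Measure.measurable_coe hS
        (measurableSet_singleton ((0 : ℕ) : ℝ≥0∞))) ?_ measurable_const
      refine Measurable.lintegral_prod_right' (f := fun p : Measure Z × Measure Z =>
        onLevel Set.univ (n + 1) (fun χ₁ => h (χ₁ + p.1)) p.2) ?_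
      exact Measurable.ite ((Measure.measurable_coe MeasurableSet.univ).comp measurable_snd
        (measurableSet_singleton ((n + 1 : ℕ) : ℝ≥0∞))) (hadd.comp measurable_swap)
        measurable_const

/-- If the empty configuration were null, the recursion would make every level null, contradicting
total mass one. -/
lemma IsMeckeLaw.lintegral_level_zero_ne_zero {Q : Measure (Measure Z)} {ν : Measure Z}
    [IsFiniteMeasure ν] (hQ : IsMeckeLaw Q ν) :
    ∫⁻ χ, onLevel Set.univ 0 1 χ ∂Q ≠ 0 := by
  have := hQ.prob
  intro h0
  have huniv : ν Set.univ < ∞ := measure_lt_top _ _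
  have hall : ∀ n : ℕ, ∫⁻ χ, onLevel Set.univ n 1 χ ∂Q = 0 := by
    intro n
    induction n with
    | zero => exact h0
    | succ n ih =>
      have := hQ.level_succ MeasurableSet.univ huniv n (h := 1) measurable_one
      have h1 : (fun z : Z => ∫⁻ χ, onLevel Set.univ n (fun χ =>
          (1 : Measure Z → ℝ≥0∞) (χ + Measure.dirac z)) χ ∂Q) = fun _ => 0 := by
        funext z
        exact ih
      rw [h1] at this
      simpa using this
  have := hQ.tsum_level MeasurableSet.univ huniv (h := 1) measurable_one
  simp [hall] at this

/-- A Mecke law is the superposition of its restrictions to a set of finite intensity and to the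
complement of this set. -/
theorem IsMeckeLaw.lintegral_split {Λ Q : Measure (Measure Z)} {μ : Measure Z} [SigmaFinite μ]
    (hΛ : IsMeckeLaw Λ μ) {S : Set Z} (hS : MeasurableSet S) (hfin : μ S < ∞)
    (hQ : IsMeckeLaw Q (μ.restrict S)) {h : Measure Z → ℝ≥0∞} (hh : Measurable h) :
    ∫⁻ χ, h χ ∂Λ = ∫⁻ χ₂, ∫⁻ χ₁, h (χ₁ + χ₂.restrict Sᶜ) ∂Q ∂Λ := by
  have := hΛ.prob
  have := hQ.prob
  have huniv : μ.restrict S Set.univ < ∞ := by simpa using hfin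
  have : IsFiniteMeasure (μ.restrict S) := ⟨huniv⟩
  have hpos := hQ.lintegral_level_zero_ne_zero
  have hlt : ∫⁻ χ, onLevel Set.univ 0 1 χ ∂Q ≠ ∞ := by
    refine ne_top_of_le_ne_top (b := ∫⁻ _, 1 ∂Q) (by simp) (lintegral_mono fun χ => ?_)
    unfold onLevel; split_ifs <;> simp
  have hadd : ∀ {k : Measure Z → ℝ≥0∞}, Measurable k →
      Measurable fun p : (Measure Z × Measure Z) => k (p.1 + p.2) :=
    fun hk => hk.comp measurable_add
  -- Summing `level_mul` over the number of points: up to the void probability of `Q`, `Λ` is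
  -- determined by `Q` and by its part on configurations that avoid `S`.
  have hlev : ∀ {k : Measure Z → ℝ≥0∞}, Measurable k →
      (∫⁻ χ, k χ ∂Λ) * ∫⁻ χ, onLevel Set.univ 0 1 χ ∂Q
        = ∫⁻ χ₂, onLevel S 0 (fun χ₂ => ∫⁻ χ₁, k (χ₁ + χ₂) ∂Q) χ₂ ∂Λ := by
    intro k hk
    rw [hΛ.tsum_level hS hfin hk, ← ENNReal.tsum_mul_right]
    simp_rw [fun n => hΛ.level_mul hS hfin hQ n hk]
    rw [← lintegral_tsum]
    · refine lintegral_congr fun χ₂ => ?_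
      by_cases h2 : χ₂ S = 0
      · simp only [onLevel, h2, Nat.cast_zero, if_true]
        have := hQ.tsum_level MeasurableSet.univ huniv (h := fun χ₁ => k (χ₁ + χ₂))
          ((hadd hk).comp measurable_prodMk_right)
        simp only [onLevel] at this
        rw [this]
      · simp [onLevel, h2]
    · intro n
      refine (Measurable.ite (Measure.measurable_coe hS
        (measurableSet_singleton ((0 : ℕ) : ℝ≥0∞))) ?_ measurable_const).aemeasurable
      refine Measurable.lintegral_prod_right' (f := fun p : Measure Z × Measure Z =>
        onLevel Set.univ n (fun χ₁ => k (χ₁ + p.1)) p.2) ?_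
      exact Measurable.ite ((Measure.measurable_coe MeasurableSet.univ).comp measurable_snd
        (measurableSet_singleton (n : ℝ≥0∞))) ((hadd hk).comp measurable_swap)
        measurable_const
  -- The intensity of `Q` does not charge the complement of `S`, so by the Mecke equation neither
  -- does almost every configuration.
  have hzero : ∀ᵐ χ₁ ∂Q, χ₁.restrict Sᶜ = 0 := by
    have hms := Measure.measurable_coe (α := Z) hS.compl
    have h1 := hQ.mecke Sᶜ hS.compl (by simp [Measure.restrict_apply hS.compl]) 1 measurable_one
    have h2 : ∫⁻ χ : Measure Z, χ Sᶜ ∂Q = 0 := by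
      simpa [Measure.restrict_restrict hS.compl] using h1
    rw [lintegral_eq_zero_iff hms] at h2
    filter_upwards [h2] with χ hχ
    simpa using hχ
  have hK : Measurable fun χ => ∫⁻ χ₁, h (χ₁ + χ) ∂Q :=
    Measurable.lintegral_prod_right' (f := fun p : Measure Z × Measure Z => h (p.2 + p.1))
      ((hadd hh).comp measurable_swap)
  -- The void probability is neither zero nor infinite and may be multiplied in. Then `hlev` is used
  -- for `h` and for its average over a `Q`-distributed part in `S`; on configurations `χ₂` without
  -- points in `S` the two integrands agree.
  refine (ENNReal.mul_left_inj hpos hlt).1 ?_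
  have h1 := hlev (hK.comp (measurable_restrict hS.compl))
  simp only [Function.comp_def] at h1
  rw [h1, hlev hh]
  refine lintegral_congr fun χ₂ => ?_
  by_cases h2 : χ₂ S = 0
  · simp only [onLevel, h2, Nat.cast_zero, if_true]
    have h3 : χ₂.restrict Sᶜ = χ₂ := by
      refine Measure.restrict_eq_self_of_ae_mem ?_
      rw [ae_iff]; simpa using h2
    have h4 : ∀ᵐ χ₁ ∂Q, ∫⁻ χ', h (χ' + (χ₁ + χ₂).restrict Sᶜ) ∂Q
        = ∫⁻ χ', h (χ' + χ₂) ∂Q := by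
      filter_upwards [hzero] with χ₁ hχ₁
      rw [Measure.restrict_add, hχ₁, h3, zero_add]
    rw [lintegral_congr_ae h4]
    simp
  · simp [onLevel, h2]

end PoissonChaos

namespace PoissonChaos

variable {Z : Type*} [MeasurableSpace Z]

/-! ### The `L^p` Poincaré inequality for `1 ≤ p ≤ 2` -/

/-- For `|u| ≤ 1`, write `|1 + u|^p = (1 + 2u + u²)^(p/2)`, use Bernoulli's inequality for the
exponent `p/2 ≤ 1`, and `u² ≤ |u|^p`. For `|u| > 1`, the left side is at most `4 |u|^p` while `p u ≥
-2 |u|^p`; hence the constant `6 = 4 + 2`. -/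
lemma abs_one_add_rpow_le {p : ℝ} (hp1 : 1 ≤ p) (hp2 : p ≤ 2) (u : ℝ) :
    |1 + u| ^ p ≤ 1 + p * u + 6 * |u| ^ p := by
  have hup : 0 ≤ |u| ^ p := by positivity
  rcases le_or_gt |u| 1 with hu | hu
  · have h1 : |1 + u| ^ p = (1 + (2 * u + u ^ 2)) ^ (p / 2) := by
      have : (1 + (2 * u + u ^ 2)) = |1 + u| ^ (2 : ℝ) := by
        rw [Real.rpow_two, sq_abs]; ring
      rw [this, ← Real.rpow_mul (abs_nonneg _)]
      congr 1; ring
    have h2 := rpow_one_add_le_one_add_mul_self (s := 2 * u + u ^ 2) (by nlinarith [sq_nonneg (u + 1)])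
      (p := p / 2) (by linarith) (by linarith)
    have h3 : u ^ 2 ≤ |u| ^ p := by
      rw [← sq_abs, ← Real.rpow_two]
      rcases eq_or_lt_of_le (abs_nonneg u) with h0 | h0
      · rw [← h0, Real.zero_rpow (by norm_num), Real.zero_rpow (by linarith)]
      · exact Real.rpow_le_rpow_of_exponent_ge h0 hu hp2
    rw [h1]
    nlinarith
  · have h1 : |1 + u| ^ p ≤ 4 * |u| ^ p := by
      have h2 : |1 + u| ≤ 2 * |u| := by
        calc |1 + u| ≤ |1| + |u| := abs_add_le _ _
          _ ≤ 2 * |u| := by rw [abs_one]; linarith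
      calc |1 + u| ^ p ≤ (2 * |u|) ^ p := Real.rpow_le_rpow (abs_nonneg _) h2 (by linarith)
        _ = 2 ^ p * |u| ^ p := Real.mul_rpow (by norm_num) (abs_nonneg _)
        _ ≤ 2 ^ (2 : ℝ) * |u| ^ p := by
          gcongr
          norm_num
        _ = 4 * |u| ^ p := by norm_num
    have h2 : |u| ≤ |u| ^ p := by
      nth_rewrite 1 [← Real.rpow_one |u|]
      exact Real.rpow_le_rpow_of_exponent_le hu.le hp1
    have h3 : -(2 * |u|) ≤ p * u := by
      have : |p * u| ≤ 2 * |u| := by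
        rw [abs_mul, abs_of_nonneg (by linarith : 0 ≤ p)]; gcongr
      linarith [neg_abs_le (p * u)]
    linarith

/-- Scaling of the case `a = 1`. The slope `L` depends on `a` only, so the linear term disappears
when `t` is a centred random variable. -/
lemma exists_abs_add_rpow_le {p : ℝ} (hp1 : 1 ≤ p) (hp2 : p ≤ 2) (a : ℝ) :
    ∃ L : ℝ, ∀ t : ℝ, |a + t| ^ p ≤ |a| ^ p + L * t + 6 * |t| ^ p := by
  rcases eq_or_ne a 0 with rfl | ha
  · refine ⟨0, fun t => ?_⟩
    have : 0 ≤ |t| ^ p := by positivity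
    have h2 : |(0 : ℝ)| ^ p = 0 := by rw [abs_zero, Real.zero_rpow (by linarith)]
    rw [zero_add, h2]
    linarith
  · refine ⟨|a| ^ p * p / a, fun t => ?_⟩
    have h := abs_one_add_rpow_le hp1 hp2 (t / a)
    have hap : 0 ≤ |a| ^ p := by positivity
    have h1 : |a + t| ^ p = |a| ^ p * |1 + t / a| ^ p := by
      rw [← Real.mul_rpow (abs_nonneg _) (abs_nonneg _), ← abs_mul]
      congr 2; field_simp
    have h2 : |t| ^ p = |a| ^ p * |t / a| ^ p := by
      rw [← Real.mul_rpow (abs_nonneg _) (abs_nonneg _), ← abs_mul]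
      congr 2; field_simp
    rw [h1, h2]
    calc |a| ^ p * |1 + t / a| ^ p ≤ |a| ^ p * (1 + p * (t / a) + 6 * |t / a| ^ p) := by gcongr
      _ = _ := by field_simp

lemma enorm_add_rpow_le {p : ℝ} (hp1 : 1 ≤ p) (hp2 : p ≤ 2) (x y : ℝ≥0∞) :
    (x + y) ^ p ≤ 2 * (x ^ p + y ^ p) := by
  refine (ENNReal.rpow_add_le_mul_rpow_add_rpow x y hp1).trans ?_
  gcongr
  calc (2 : ℝ≥0∞) ^ (p - 1) ≤ 2 ^ (1 : ℝ) :=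
        ENNReal.rpow_le_rpow_of_exponent_le (by norm_num) (by linarith)
    _ = 2 := by simp

lemma enorm_integral_rpow_le {α : Type*} [MeasurableSpace α] {Λ : Measure α}
    [IsProbabilityMeasure Λ] {p : ℝ} (hp1 : 1 ≤ p) {f : α → ℝ} (hf : AEStronglyMeasurable f Λ) :
    ‖∫ x, f x ∂Λ‖ₑ ^ p ≤ ∫⁻ x, ‖f x‖ₑ ^ p ∂Λ := by
  have hp0 : 0 < p := by linarith
  have h1 : ‖∫ x, f x ∂Λ‖ₑ ≤ (∫⁻ x, ‖f x‖ₑ ^ p ∂Λ) ^ (1 / p) := by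
    refine (enorm_integral_le_lintegral_enorm f).trans ?_
    have := eLpNorm'_le_eLpNorm'_of_exponent_le (f := f) one_pos hp1 Λ hf
    simpa [eLpNorm'] using this
  calc ‖∫ x, f x ∂Λ‖ₑ ^ p ≤ ((∫⁻ x, ‖f x‖ₑ ^ p ∂Λ) ^ (1 / p)) ^ p :=
        ENNReal.rpow_le_rpow h1 hp0.le
    _ = _ := by rw [← ENNReal.rpow_mul, one_div_mul_cancel hp0.ne', ENNReal.rpow_one]

/-- The energy `∫ E|D⁺_z f|^p μ(dz)`. -/
noncomputable def energy (p : ℝ) (Λ : Measure (Measure Z)) (μ : Measure Z) (f : Measure Z → ℝ) :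
    ℝ≥0∞ :=
  ∫⁻ z, ∫⁻ χ, ‖addOneCost z f χ‖ₑ ^ p ∂Λ ∂μ

/-- The `L^p` Poincaré inequality for bounded functionals. -/
def PoincareIneq (p : ℝ) (C : ℝ≥0∞) (Λ : Measure (Measure Z)) (μ : Measure Z) : Prop :=
  ∀ f : Measure Z → ℝ, Measurable f → (∃ M, ∀ χ, |f χ| ≤ M) →
    ∫⁻ χ, ‖f χ‖ₑ ^ p ∂Λ ≤ ‖∫ χ, f χ ∂Λ‖ₑ ^ p + C * energy p Λ μ f

lemma integrable_of_abs_le {α : Type*} [MeasurableSpace α] {Λ : Measure α} [IsFiniteMeasure Λ]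
    {f : α → ℝ} (hf : Measurable f) {M : ℝ} (hM : ∀ x, |f x| ≤ M) : Integrable f Λ :=
  Integrable.of_bound hf.aestronglyMeasurable M (Filter.Eventually.of_forall hM)

lemma measurable_energy_inner {p : ℝ} {Λ : Measure (Measure Z)} [SFinite Λ] {f : Measure Z → ℝ}
    (hf : Measurable f) : Measurable fun z => ∫⁻ χ, ‖addOneCost z f χ‖ₑ ^ p ∂Λ :=
  Measurable.lintegral_prod_right' (f := fun q : Z × Measure Z => ‖addOneCost q.1 f q.2‖ₑ ^ p)
    ((measurable_addOneCost_uncurry hf).enorm.pow_const p)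

lemma lintegral_enorm_rpow_eq {α : Type*} [MeasurableSpace α] {Λ : Measure α} {p : ℝ} (hp : 0 ≤ p)
    {f : α → ℝ} (hf : Integrable (fun x => |f x| ^ p) Λ) :
    ∫⁻ x, ‖f x‖ₑ ^ p ∂Λ = ENNReal.ofReal (∫ x, |f x| ^ p ∂Λ) := by
  rw [ofReal_integral_eq_lintegral_ofReal hf (Filter.Eventually.of_forall fun x => by positivity)]
  refine lintegral_congr fun x => ?_
  rw [← ENNReal.ofReal_rpow_of_nonneg (abs_nonneg _) hp, ← Real.enorm_eq_ofReal_abs]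

/-- Integrate `exists_abs_add_rpow_le` around the mean; the linear term has mean zero. The triangle
inequality would give the mean a coefficient larger than `1`, which would be multiplied at each
tensorization. -/
lemma lintegral_enorm_rpow_le_of_mean {α : Type*} [MeasurableSpace α] {Λ : Measure α}
    [IsProbabilityMeasure Λ] {p : ℝ} (hp1 : 1 ≤ p) (hp2 : p ≤ 2) {f : α → ℝ} (hf : Measurable f)
    {M : ℝ} (hM : ∀ x, |f x| ≤ M) :
    ∫⁻ x, ‖f x‖ₑ ^ p ∂Λ ≤ ‖∫ x, f x ∂Λ‖ₑ ^ p
      + 6 * ∫⁻ x, ‖f x - ∫ y, f y ∂Λ‖ₑ ^ p ∂Λ := by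
  have hp0 : 0 ≤ p := by linarith
  set a := ∫ x, f x ∂Λ with ha
  obtain ⟨L, hL⟩ := exists_abs_add_rpow_le hp1 hp2 a
  have hint : Integrable f Λ := integrable_of_abs_le hf hM
  have hbd : ∀ c : ℝ, Integrable (fun x => |f x - c| ^ p) Λ := by
    intro c
    refine integrable_of_abs_le (M := (M + |c|) ^ p)
      ((Measurable.abs (hf.sub_const c)).pow_const p) fun x => ?_
    rw [abs_of_nonneg (by positivity)]
    refine Real.rpow_le_rpow (abs_nonneg _) ?_ hp0
    calc |f x - c| ≤ |f x| + |c| := abs_sub _ _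
      _ ≤ M + |c| := by linarith [hM x]
  have h0 : Integrable (fun x => |f x| ^ p) Λ := by simpa using hbd 0
  rw [lintegral_enorm_rpow_eq hp0 h0, lintegral_enorm_rpow_eq hp0 (hbd a)]
  have h6 : (6 : ℝ≥0∞) = ENNReal.ofReal 6 := by simp
  rw [Real.enorm_eq_ofReal_abs, ENNReal.ofReal_rpow_of_nonneg (abs_nonneg _) hp0, h6,
    ← ENNReal.ofReal_mul (by norm_num), ← ENNReal.ofReal_add (by positivity) (by positivity)]
  refine ENNReal.ofReal_le_ofReal ?_
  have hlin : Integrable (fun x => L * (f x - a)) Λ := (hint.sub (integrable_const a)).const_mul L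
  calc ∫ x, |f x| ^ p ∂Λ ≤ ∫ x, (|a| ^ p + L * (f x - a) + 6 * |f x - a| ^ p) ∂Λ := by
        refine integral_mono h0 (((integrable_const _).add hlin).add ((hbd a).const_mul 6)) ?_
        intro x
        have := hL (f x - a)
        simpa using this
    _ = |a| ^ p + 6 * ∫ x, |f x - a| ^ p ∂Λ := by
        have h7 : Integrable (fun x => |a| ^ p + L * (f x - a)) Λ := (integrable_const _).add hlin
        rw [integral_add h7 ((hbd a).const_mul 6),
          integral_add (integrable_const _) hlin, integral_const_mul, integral_const_mul,
          integral_sub hint (integrable_const a)]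
        simp [← ha]

/-- By Jensen's inequality for `f - b`, the distance from the mean to any constant `b` is controlled
by the distance from `f` to `b`. This permits centring at the value of `f` on the empty
configuration. -/
lemma lintegral_enorm_sub_mean_le {α : Type*} [MeasurableSpace α] {Λ : Measure α}
    [IsProbabilityMeasure Λ] {p : ℝ} (hp1 : 1 ≤ p) (hp2 : p ≤ 2) {f : α → ℝ} (hf : Integrable f Λ)
    (hfm : Measurable f) (b : ℝ) :
    ∫⁻ x, ‖f x - ∫ y, f y ∂Λ‖ₑ ^ p ∂Λ ≤ 4 * ∫⁻ x, ‖f x - b‖ₑ ^ p ∂Λ := by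
  have hp0 : 0 ≤ p := by linarith
  set a := ∫ x, f x ∂Λ with ha
  have h1 : ‖b - a‖ₑ ^ p ≤ ∫⁻ x, ‖f x - b‖ₑ ^ p ∂Λ := by
    have := enorm_integral_rpow_le (Λ := Λ) hp1 (f := fun x => f x - b)
      (hf.sub (integrable_const b)).aestronglyMeasurable
    rw [integral_sub hf (integrable_const b)] at this
    simp only [integral_const, probReal_univ, one_smul, ← ha] at this
    rwa [← enorm_neg, neg_sub] at this
  calc ∫⁻ x, ‖f x - a‖ₑ ^ p ∂Λ
      ≤ ∫⁻ x, 2 * (‖f x - b‖ₑ ^ p + ‖b - a‖ₑ ^ p) ∂Λ := by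
        refine lintegral_mono fun x => ?_
        refine le_trans ?_ (enorm_add_rpow_le hp1 hp2 _ _)
        refine ENNReal.rpow_le_rpow ?_ hp0
        calc ‖f x - a‖ₑ = ‖(f x - b) + (b - a)‖ₑ := by congr 1; ring
          _ ≤ _ := enorm_add_le _ _
    _ = 2 * (∫⁻ x, ‖f x - b‖ₑ ^ p ∂Λ + ‖b - a‖ₑ ^ p) := by
        rw [lintegral_const_mul _ (((hfm.sub_const b).enorm.pow_const p).add_const _),
          lintegral_add_right _ measurable_const]
        simp
    _ ≤ 2 * (∫⁻ x, ‖f x - b‖ₑ ^ p ∂Λ + ∫⁻ x, ‖f x - b‖ₑ ^ p ∂Λ) := by gcongr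
    _ = 4 * ∫⁻ x, ‖f x - b‖ₑ ^ p ∂Λ := by ring

/-- The Poincaré inequality for small intensities. -/
lemma IsMeckeLaw.poincareIneq_of_small {Λ : Measure (Measure Z)} {ν : Measure Z}
    (hΛ : IsMeckeLaw Λ ν) (hν : ν Set.univ ≤ 1 / 4) {p : ℝ} (hp1 : 1 ≤ p) (hp2 : p ≤ 2) :
    PoincareIneq p 96 Λ ν := by
  have := hΛ.prob
  have hp0 : 0 < p := by linarith
  rintro f hf ⟨M, hM⟩
  have hfin : ν Set.univ < ∞ := lt_of_le_of_lt hν (by norm_num)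
  have hνf : IsFiniteMeasure ν := ⟨hfin⟩
  set b := f 0 with hb
  set g : Measure Z → ℝ≥0∞ := fun χ => ‖f χ - b‖ₑ ^ p with hg
  have hgm : Measurable g := (hf.sub_const b).enorm.pow_const p
  have hum : Measurable fun χ : Measure Z => χ Set.univ := Measure.measurable_coe MeasurableSet.univ
  have hutop : ∫⁻ χ, g χ ∂Λ ≠ ∞ := by
    have hle : ∀ χ, g χ ≤ ENNReal.ofReal (M + |b|) ^ p := by
      intro χ
      refine ENNReal.rpow_le_rpow ?_ hp0.le
      rw [Real.enorm_eq_ofReal_abs]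
      refine ENNReal.ofReal_le_ofReal ?_
      calc |f χ - b| ≤ |f χ| + |b| := abs_sub _ _
        _ ≤ M + |b| := by linarith [hM χ]
    refine ne_top_of_le_ne_top ?_ (lintegral_mono hle)
    simp [ENNReal.rpow_eq_top_iff, hp0, not_lt.2 hp0.le]
  have hdivm : Measurable fun χ => g χ / χ Set.univ := hgm.div hum
  -- Since `g` vanishes at the empty configuration, it equals the total count times `g / count`
  -- almost everywhere, and the Mecke equation replaces `χ` by `χ + δ_z`. The count is then at least
  -- one and can be dropped, and `g (χ + δ_z) ≤ 2 (|D_z f|^p + g χ)`. The mass bound `1/4` makes the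
  -- last term half of the left side.
  have hu : ∫⁻ χ, g χ ∂Λ ≤ 2 * energy p Λ ν f + (∫⁻ χ, g χ ∂Λ) / 2 := by
    calc ∫⁻ χ, g χ ∂Λ = ∫⁻ χ, χ Set.univ * (g χ / χ Set.univ) ∂Λ := by
          refine lintegral_congr_ae ?_
          filter_upwards [hΛ.natValued _ MeasurableSet.univ hfin] with χ ⟨n, hn⟩
          rcases Nat.eq_zero_or_pos n with h0 | h0
          · have : χ = 0 := by
              rw [← Measure.measure_univ_eq_zero, hn, h0]; simp
            simp [this, hg, hb, hp0]
          · rw [hn, ENNReal.mul_div_cancel (by simpa using h0.ne') (ENNReal.natCast_ne_top n)]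
      _ = ∫⁻ z, ∫⁻ χ, g (χ + Measure.dirac z) / (χ + Measure.dirac z) Set.univ ∂Λ ∂ν := by
          rw [hΛ.mecke _ MeasurableSet.univ hfin _ hdivm, Measure.restrict_univ]
      _ ≤ ∫⁻ z, ∫⁻ χ, 2 * (‖addOneCost z f χ‖ₑ ^ p + g χ) ∂Λ ∂ν := by
          refine lintegral_mono fun z => lintegral_mono fun χ => ?_
          refine (ENNReal.div_le_of_le_mul ?_)
          have h1 : (1 : ℝ≥0∞) ≤ (χ + Measure.dirac z) Set.univ := by simp
          refine le_trans ?_ (le_mul_of_one_le_right' h1)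
          refine le_trans ?_ (enorm_add_rpow_le hp1 hp2 _ _)
          refine ENNReal.rpow_le_rpow ?_ hp0.le
          calc ‖f (χ + Measure.dirac z) - b‖ₑ = ‖addOneCost z f χ + (f χ - b)‖ₑ := by
                congr 1; simp [addOneCost]
            _ ≤ _ := enorm_add_le _ _
      _ = 2 * energy p Λ ν f + 2 * (ν Set.univ * ∫⁻ χ, g χ ∂Λ) := by
          have h1 : ∀ z, ∫⁻ χ, 2 * (‖addOneCost z f χ‖ₑ ^ p + g χ) ∂Λ
              = 2 * (∫⁻ χ, ‖addOneCost z f χ‖ₑ ^ p ∂Λ + ∫⁻ χ, g χ ∂Λ) := by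
            intro z
            rw [lintegral_const_mul _
              (Measurable.fun_add ((measurable_addOneCost hf z).enorm.pow_const p) hgm),
              lintegral_add_right _ hgm]
          simp_rw [h1]
          rw [lintegral_const_mul _ ((measurable_energy_inner hf).add_const _),
            lintegral_add_right _ measurable_const, lintegral_const, mul_add, energy,
            mul_comm (∫⁻ χ, g χ ∂Λ)]
      _ ≤ 2 * energy p Λ ν f + 2 * (1 / 4 * ∫⁻ χ, g χ ∂Λ) := by gcongr
      _ = 2 * energy p Λ ν f + (∫⁻ χ, g χ ∂Λ) / 2 := by
          congr 1
          have h24 : (2 : ℝ≥0∞) * (1 / 4) = 2⁻¹ := by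
            rw [← ENNReal.toReal_eq_toReal_iff' (by finiteness) (by simp)]
            simp; norm_num
          rw [← mul_assoc, h24, ENNReal.div_eq_inv_mul]
  -- Absorbing the half is legitimate because the integral of `g` is finite, `f` being bounded.
  have hu4 : ∫⁻ χ, g χ ∂Λ ≤ 4 * energy p Λ ν f := by
    have h2 : (∫⁻ χ, g χ ∂Λ) / 2 + (∫⁻ χ, g χ ∂Λ) / 2 ≤ 2 * energy p Λ ν f + (∫⁻ χ, g χ ∂Λ) / 2 := by
      rwa [ENNReal.add_halves]
    have h3 : (∫⁻ χ, g χ ∂Λ) / 2 ≠ ∞ := ENNReal.div_ne_top hutop (by norm_num)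
    have h4 := (ENNReal.add_le_add_iff_right h3).1 h2
    calc ∫⁻ χ, g χ ∂Λ = 2 * ((∫⁻ χ, g χ ∂Λ) / 2) :=
          (ENNReal.mul_div_cancel (by norm_num) (by norm_num)).symm
      _ ≤ 2 * (2 * energy p Λ ν f) := by gcongr
      _ = 4 * energy p Λ ν f := by ring
  -- The constant is `96 = 6 · 4 · 4`: expansion around the mean, replacement of the mean by `f 0`,
  -- and the bound just obtained.
  calc ∫⁻ χ, ‖f χ‖ₑ ^ p ∂Λ
      ≤ ‖∫ χ, f χ ∂Λ‖ₑ ^ p + 6 * ∫⁻ χ, ‖f χ - ∫ y, f y ∂Λ‖ₑ ^ p ∂Λ :=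
        lintegral_enorm_rpow_le_of_mean hp1 hp2 hf hM
    _ ≤ ‖∫ χ, f χ ∂Λ‖ₑ ^ p + 6 * (4 * (4 * energy p Λ ν f)) := by
        gcongr
        refine (lintegral_enorm_sub_mean_le hp1 hp2 (integrable_of_abs_le hf hM) hf b).trans ?_
        gcongr
    _ = ‖∫ χ, f χ ∂Λ‖ₑ ^ p + 96 * energy p Λ ν f := by ring

lemma measurable_add_left (x : Measure Z) : Measurable fun y : Measure Z => x + y :=
  measurable_const.add measurable_id

lemma measurable_integral_add {Q : Measure (Measure Z)} [SFinite Q] {f : Measure Z → ℝ}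
    (hf : Measurable f) : Measurable fun x => ∫ y, f (x + y) ∂Q :=
  ((hf.comp measurable_add).stronglyMeasurable.integral_prod_right'
    (f := fun p : Measure Z × Measure Z => f (p.1 + p.2))).measurable

lemma abs_integral_add_le {Q : Measure (Measure Z)} [IsProbabilityMeasure Q] {f : Measure Z → ℝ}
    {M : ℝ} (hM : ∀ x, |f x| ≤ M) (x : Measure Z) : |∫ y, f (x + y) ∂Q| ≤ M := by
  have := norm_integral_le_of_norm_le_const (μ := Q) (f := fun y => f (x + y)) (C := M)
    (Filter.Eventually.of_forall fun y => hM _)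
  simpa using this

lemma addOneCost_integral_add {Q : Measure (Measure Z)} [IsProbabilityMeasure Q]
    {f : Measure Z → ℝ} (hf : Measurable f) {M : ℝ} (hM : ∀ x, |f x| ≤ M) (z : Z)
    (x : Measure Z) :
    addOneCost z (fun x => ∫ y, f (x + y) ∂Q) x = ∫ y, addOneCost z f (x + y) ∂Q := by
  have h : ∀ x, Integrable (fun y => f (x + y)) Q := fun x =>
    integrable_of_abs_le (hf.comp (measurable_add_left x)) fun y => hM _
  simp only [addOneCost]
  rw [← integral_sub (h _) (h _)]
  refine integral_congr_ae (Filter.Eventually.of_forall fun y => ?_)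
  simp only [add_right_comm]

lemma integral_conv_of_bounded {Λ₁ Λ₂ : Measure (Measure Z)} [IsProbabilityMeasure Λ₁]
    [IsProbabilityMeasure Λ₂] {f : Measure Z → ℝ} (hf : Measurable f) {M : ℝ}
    (hM : ∀ x, |f x| ≤ M) :
    ∫ χ, f χ ∂(Λ₁.conv Λ₂) = ∫ x, ∫ y, f (x + y) ∂Λ₂ ∂Λ₁ := by
  rw [Measure.conv, integral_map measurable_add.aemeasurable hf.aestronglyMeasurable]
  exact integral_prod (fun p : Measure Z × Measure Z => f (p.1 + p.2))
    (integrable_of_abs_le (hf.comp measurable_add) fun y => hM _)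

/-- Averaging over the second process commutes with the add-one cost, so Jensen's inequality shows
that it does not increase the energy. -/
lemma lintegral_energy_integral_add_le {Λ₁ Λ₂ : Measure (Measure Z)} [IsProbabilityMeasure Λ₁]
    [IsProbabilityMeasure Λ₂] {p : ℝ} (hp1 : 1 ≤ p) (μ : Measure Z)
    {f : Measure Z → ℝ} (hf : Measurable f) {M : ℝ} (hM : ∀ x, |f x| ≤ M) :
    energy p Λ₁ μ (fun x => ∫ y, f (x + y) ∂Λ₂) ≤ energy p (Λ₁.conv Λ₂) μ f := by
  refine lintegral_mono fun z => ?_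
  rw [Measure.lintegral_conv ((measurable_addOneCost hf z).enorm.pow_const p)]
  refine lintegral_mono fun x => ?_
  rw [addOneCost_integral_add hf hM]
  exact enorm_integral_rpow_le hp1
    (((measurable_addOneCost hf z).comp (measurable_add_left x)).aestronglyMeasurable)

/-- The Poincaré inequality tensorizes. -/
lemma PoincareIneq.conv {Λ₁ Λ₂ : Measure (Measure Z)} [IsProbabilityMeasure Λ₁]
    [IsProbabilityMeasure Λ₂] {μ₁ μ₂ : Measure Z} [SFinite μ₁] [SFinite μ₂] {p : ℝ}
    (hp1 : 1 ≤ p) {C : ℝ≥0∞} (h₁ : PoincareIneq p C Λ₁ μ₁) (h₂ : PoincareIneq p C Λ₂ μ₂) :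
    PoincareIneq p C (Λ₁.conv Λ₂) (μ₁ + μ₂) := by
  rintro f hf ⟨M, hM⟩
  have hG : Measurable fun x => ‖∫ y, f (x + y) ∂Λ₂‖ₑ ^ p :=
    (measurable_integral_add hf).enorm.pow_const p
  have hsum : Measurable fun r : (Measure Z × Z) × Measure Z => r.1.1 + r.2 :=
    (measurable_fst.comp measurable_fst).add measurable_snd
  have hpair : Measurable fun r : (Measure Z × Z) × Measure Z => (r.1.2, r.1.1 + r.2) :=
    (measurable_snd.comp measurable_fst).prodMk hsum
  have h3' : Measurable fun r : (Measure Z × Z) × Measure Z =>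
      ‖addOneCost r.1.2 f (r.1.1 + r.2)‖ₑ ^ p := by
    have h : Measurable fun r : (Measure Z × Z) × Measure Z => addOneCost r.1.2 f (r.1.1 + r.2) :=
      (measurable_addOneCost_uncurry hf).comp hpair
    exact h.enorm.pow_const p
  have h3 : Measurable fun q : Measure Z × Z => ∫⁻ y, ‖addOneCost q.2 f (q.1 + y)‖ₑ ^ p ∂Λ₂ :=
    h3'.lintegral_prod_right'
  -- The inequality for `Λ₂` is used with `x` frozen; its mean term is then estimated by the
  -- inequality for `Λ₁` applied to the partial average of `f`. As the mean terms carry coefficient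
  -- `1`, the energies over `μ₁` and `μ₂` add up with the same `C`.
  have step1 : ∀ x, ∫⁻ y, ‖f (x + y)‖ₑ ^ p ∂Λ₂ ≤ ‖∫ y, f (x + y) ∂Λ₂‖ₑ ^ p
      + C * ∫⁻ z, ∫⁻ y, ‖addOneCost z f (x + y)‖ₑ ^ p ∂Λ₂ ∂μ₂ := by
    intro x
    refine (h₂ (fun y => f (x + y)) (hf.comp (measurable_add_left x)) ⟨M, fun y => hM _⟩).trans_eq ?_
    simp only [energy, addOneCost, add_assoc]
  have step2 : energy p (Λ₁.conv Λ₂) μ₂ f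
      = ∫⁻ x, ∫⁻ z, ∫⁻ y, ‖addOneCost z f (x + y)‖ₑ ^ p ∂Λ₂ ∂μ₂ ∂Λ₁ := by
    rw [lintegral_lintegral_swap h3.aemeasurable]
    refine lintegral_congr fun z => ?_
    rw [Measure.lintegral_conv ((measurable_addOneCost hf z).enorm.pow_const p)]
  have step3 : energy p (Λ₁.conv Λ₂) (μ₁ + μ₂) f
      = energy p (Λ₁.conv Λ₂) μ₁ f + energy p (Λ₁.conv Λ₂) μ₂ f := lintegral_add_measure _ _ _
  have step4 := (h₁ _ (measurable_integral_add (Q := Λ₂) hf) ⟨M, abs_integral_add_le hM⟩).trans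
    (add_le_add_right (mul_le_mul_right (lintegral_energy_integral_add_le hp1 μ₁ hf hM) C) _)
  rw [← integral_conv_of_bounded hf hM] at step4
  have h5 : Measurable fun x => ∫⁻ z, ∫⁻ y, ‖addOneCost z f (x + y)‖ₑ ^ p ∂Λ₂ ∂μ₂ :=
    h3.lintegral_prod_right'
  rw [Measure.lintegral_conv (hf.enorm.pow_const p), step3, mul_add, ← add_assoc]
  refine (lintegral_mono step1).trans ?_
  rw [lintegral_add_left hG, lintegral_const_mul _ h5, ← step2]
  exact add_le_add_left step4 _

lemma exists_isMeckeLaw_poincareIneq_nsmul (ν : Measure Z) (hν : ν Set.univ ≤ 1 / 4) {p : ℝ}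
    (hp1 : 1 ≤ p) (hp2 : p ≤ 2) (n : ℕ) :
    ∃ Λ : Measure (Measure Z), IsMeckeLaw Λ (n • ν) ∧ PoincareIneq p 96 Λ (n • ν) := by
  have : IsFiniteMeasure ν := ⟨lt_of_le_of_lt hν (by norm_num)⟩
  induction n with
  | zero =>
    refine ⟨Measure.dirac 0, by simpa using isMeckeLaw_dirac_zero, ?_⟩
    rintro f hf -
    rw [lintegral_dirac' _ (hf.enorm.pow_const p), integral_dirac' _ _ hf.stronglyMeasurable]
    exact le_self_add
  | succ n ih =>
    obtain ⟨Λ, h1, h2⟩ := ih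
    have h3 := isMeckeLaw_poissonLaw ν
    have := h1.prob
    have := h3.prob
    have : IsFiniteMeasure (n • ν) := by
      rw [← Nat.cast_smul_eq_nsmul ℝ≥0∞]
      exact Measure.smul_finite _ (ENNReal.natCast_ne_top n)
    refine ⟨Λ.conv (poissonLaw ν), ?_, ?_⟩
    · rw [succ_nsmul]; exact h1.conv h3
    · rw [succ_nsmul]; exact h2.conv hp1 (h3.poincareIneq_of_small hν hp1 hp2)

/-- Every finite measure is the intensity of a Poisson law that satisfies the Poincaré inequality
with a universal constant. -/
lemma exists_isMeckeLaw_poincareIneq (ν : Measure Z) [IsFiniteMeasure ν] {p : ℝ}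
    (hp1 : 1 ≤ p) (hp2 : p ≤ 2) :
    ∃ Λ : Measure (Measure Z), IsMeckeLaw Λ ν ∧ PoincareIneq p 96 Λ ν := by
  -- With `n > 4 ν(Z)`, the measure `ν / n` has mass at most `1/4`, and `ν` is its `n`-fold sum.
  obtain ⟨n, hn⟩ := ENNReal.exists_nat_gt (ENNReal.mul_ne_top (by norm_num : (4 : ℝ≥0∞) ≠ ∞)
    (measure_ne_top ν Set.univ))
  have hn0 : (n : ℝ≥0∞) ≠ 0 := (lt_of_le_of_lt zero_le hn).ne'
  have hnt : (n : ℝ≥0∞) ≠ ∞ := ENNReal.natCast_ne_top n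
  have h1 : ((n : ℝ≥0∞)⁻¹ • ν) Set.univ ≤ 1 / 4 := by
    rw [Measure.smul_apply, smul_eq_mul, mul_comm, ← div_eq_mul_inv]
    refine ENNReal.div_le_of_le_mul ?_
    rw [one_div, mul_comm, ← div_eq_mul_inv, ENNReal.le_div_iff_mul_le (by norm_num) (by norm_num),
      mul_comm]
    exact hn.le
  obtain ⟨Λ, h2, h3⟩ := exists_isMeckeLaw_poincareIneq_nsmul _ h1 hp1 hp2 n
  have h4 : n • ((n : ℝ≥0∞)⁻¹ • ν) = ν := by
    rw [← Nat.cast_smul_eq_nsmul ℝ≥0∞, smul_smul, ENNReal.mul_inv_cancel hn0 hnt, one_smul]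
  rw [h4] at h2 h3
  exact ⟨Λ, h2, h3⟩

end PoissonChaos

namespace PoissonChaos

variable {Z : Type*} [MeasurableSpace Z]

/-! ### Independence of the restrictions of a Mecke law to a set of finite intensity and to its
complement. -/

section Split

variable {Λ Q : Measure (Measure Z)} {μ : Measure Z} [SigmaFinite μ] {S : Set Z}

lemma IsMeckeLaw.eq_conv (hΛ : IsMeckeLaw Λ μ) (hS : MeasurableSet S) (hfin : μ S < ∞)
    (hQ : IsMeckeLaw Q (μ.restrict S)) : Λ = Q.conv (Λ.map fun χ => χ.restrict Sᶜ) := by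
  have := hΛ.prob
  have := hQ.prob
  have := Measure.isProbabilityMeasure_map (μ := Λ) (measurable_restrict hS.compl).aemeasurable
  refine Measure.ext_of_lintegral _ fun h hh => ?_
  have hadd : Measurable fun q : Measure Z × Measure Z => h (q.1 + q.2) := hh.comp measurable_add
  have hin : Measurable fun y => ∫⁻ x, h (x + y) ∂Q :=
    Measurable.lintegral_prod_right' (f := fun q : Measure Z × Measure Z => h (q.2 + q.1))
      (hadd.comp measurable_swap)
  rw [Measure.lintegral_conv hh, lintegral_lintegral_swap hadd.aemeasurable,
    lintegral_map hin (measurable_restrict hS.compl)]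
  exact hΛ.lintegral_split hS hfin hQ hh

lemma IsMeckeLaw.ae_eq_zero (hΛ : IsMeckeLaw Λ μ) (hS : MeasurableSet S) (h0 : μ S = 0) :
    ∀ᵐ χ ∂Λ, χ S = 0 := by
  have h1 := hΛ.mecke S hS (by simp [h0]) 1 measurable_one
  have h2 : ∫⁻ χ : Measure Z, χ S ∂Λ = 0 := by
    simpa [Measure.restrict_eq_zero.2 h0] using h1
  exact (lintegral_eq_zero_iff (Measure.measurable_coe hS)).1 h2

lemma restrict_eq_self_of_compl {χ : Measure Z} (h : χ Sᶜ = 0) : χ.restrict S = χ := by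
  refine Measure.restrict_eq_self_of_ae_mem ?_
  rw [ae_iff]; exact h

lemma ae_map_restrict_compl (hS : MeasurableSet S) :
    ∀ᵐ y ∂(Λ.map fun χ => χ.restrict Sᶜ), y.restrict S = 0 := by
  have hms : MeasurableSet {y : Measure Z | y.restrict S = 0} := by
    simp_rw [Measure.restrict_eq_zero]
    exact Measure.measurable_coe hS (measurableSet_singleton 0)
  rw [ae_map_iff (measurable_restrict hS.compl).aemeasurable hms]
  refine Filter.Eventually.of_forall fun χ => ?_
  rw [Measure.restrict_restrict hS]
  simp

lemma IsMeckeLaw.ae_restrict_eq_self (hS : MeasurableSet S)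
    (hQ : IsMeckeLaw Q (μ.restrict S)) : ∀ᵐ x ∂Q, x.restrict S = x := by
  filter_upwards [hQ.ae_eq_zero hS.compl (by simp [Measure.restrict_apply hS.compl])] with x hx
  exact restrict_eq_self_of_compl hx

/-- In the decomposition `eq_conv`, the first summand is carried by `S` and the second by its
complement, so restricting to `S` recovers the first. As `Q` is any Mecke law of intensity
`μ.restrict S`, this identifies it uniquely; the law constructed by convolution is thus the law of
the restriction. -/
lemma IsMeckeLaw.map_restrict_eq (hΛ : IsMeckeLaw Λ μ) (hS : MeasurableSet S) (hfin : μ S < ∞)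
    (hQ : IsMeckeLaw Q (μ.restrict S)) : Λ.map (fun χ => χ.restrict S) = Q := by
  have := hΛ.prob
  have := hQ.prob
  have := Measure.isProbabilityMeasure_map (μ := Λ) (measurable_restrict hS.compl).aemeasurable
  refine Measure.ext_of_lintegral _ fun h hh => ?_
  have hhr : Measurable fun χ : Measure Z => h (χ.restrict S) := hh.comp (measurable_restrict hS)
  rw [lintegral_map hh (measurable_restrict hS), hΛ.eq_conv hS hfin hQ,
    Measure.lintegral_conv hhr]
  refine lintegral_congr_ae ?_
  filter_upwards [IsMeckeLaw.ae_restrict_eq_self hS hQ] with x hx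
  have h1 : ∀ᵐ y ∂(Λ.map fun χ => χ.restrict Sᶜ), h ((x + y).restrict S) = h x := by
    filter_upwards [ae_map_restrict_compl (Λ := Λ) hS] with y hy
    rw [Measure.restrict_add, hx, hy, add_zero]
  rw [lintegral_congr_ae h1]
  simp

/-- The restrictions to `S` and to its complement are independent, so conditioning on the first
amounts to freezing it and integrating out the second. -/
lemma IsMeckeLaw.condExp_restrict (hΛ : IsMeckeLaw Λ μ) (hS : MeasurableSet S) (hfin : μ S < ∞)
    (hQ : IsMeckeLaw Q (μ.restrict S)) {f : Measure Z → ℝ} (hf : Measurable f) {M : ℝ}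
    (hM : ∀ χ, |f χ| ≤ M) :
    (fun χ => ∫ y, f (χ.restrict S + y) ∂(Λ.map fun χ => χ.restrict Sᶜ))
      =ᵐ[Λ] Λ[f | MeasurableSpace.comap (fun χ : Measure Z => χ.restrict S) inferInstance] := by
  have := hΛ.prob
  have := hQ.prob
  have := Measure.isProbabilityMeasure_map (μ := Λ) (measurable_restrict hS.compl).aemeasurable
  have hr := measurable_restrict hS
  set ρ := Λ.map fun χ => χ.restrict Sᶜ with hρ
  have hg : Measurable fun x => ∫ y, f (x + y) ∂ρ := measurable_integral_add hf
  have hgM : ∀ x, |∫ y, f (x + y) ∂ρ| ≤ M := abs_integral_add_le hM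
  refine ae_eq_condExp_of_forall_setIntegral_eq hr.comap_le (integrable_of_abs_le hf hM)
    (fun s _ _ => (integrable_of_abs_le (hg.comp hr) fun χ => hgM _).integrableOn) ?_ ?_
  · rintro s ⟨A, hA, rfl⟩ -
    have hI : Measurable (A.indicator fun _ => (1 : ℝ)) := measurable_const.indicator hA
    have hIr : Measurable fun χ : Measure Z => A.indicator (fun _ => (1 : ℝ)) (χ.restrict S) :=
      hI.comp hr
    have hIle : ∀ χ, |A.indicator (fun _ => (1 : ℝ)) χ| ≤ 1 := by
      intro χ; by_cases h : χ ∈ A <;> simp [h]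
    have hprod : ∀ (u : Measure Z → ℝ),
        ∫ χ in (fun χ : Measure Z => χ.restrict S) ⁻¹' A, u χ ∂Λ
          = ∫ χ, A.indicator (fun _ => (1 : ℝ)) (χ.restrict S) * u χ ∂Λ := by
      intro u
      rw [← integral_indicator (hr hA)]
      refine integral_congr_ae (Filter.Eventually.of_forall fun χ => ?_)
      by_cases h : χ.restrict S ∈ A <;> simp [h]
    rw [hprod, hprod]
    have h1 : ∫ χ, A.indicator (fun _ => (1 : ℝ)) (χ.restrict S) * f χ ∂Λ
        = ∫ x, A.indicator (fun _ => (1 : ℝ)) x * ∫ y, f (x + y) ∂ρ ∂Q := by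
      have hk : Measurable fun χ : Measure Z =>
          A.indicator (fun _ => (1 : ℝ)) (χ.restrict S) * f χ := Measurable.fun_mul hIr hf
      nth_rewrite 1 [hΛ.eq_conv hS hfin hQ]
      rw [integral_conv_of_bounded hk (M := 1 * M)]
      · refine integral_congr_ae ?_
        filter_upwards [IsMeckeLaw.ae_restrict_eq_self hS hQ] with x hx
        rw [← integral_const_mul]
        refine integral_congr_ae ?_
        filter_upwards [ae_map_restrict_compl (Λ := Λ) hS] with y hy
        rw [Measure.restrict_add, hx, hy, add_zero]
      · intro χ
        rw [abs_mul]
        exact mul_le_mul (hIle _) (hM _) (abs_nonneg _) zero_le_one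
    rw [h1, ← hΛ.map_restrict_eq hS hfin hQ, integral_map hr.aemeasurable
      (Measurable.fun_mul hI hg).aestronglyMeasurable]
  · exact (hg.comp (comap_measurable _)).stronglyMeasurable.aestronglyMeasurable

end Split

/-! ### Exhaustion by sets of finite intensity and passage to the limit. -/

lemma iSup_restrict_apply {S : ℕ → Set Z} (hmono : Monotone S)
    (hU : ⋃ n, S n = Set.univ) (χ : Measure Z) {B : Set Z} (hB : MeasurableSet B) :
    χ B = ⨆ n, χ.restrict (S n) B := by
  simp_rw [Measure.restrict_apply hB]
  rw [← Monotone.measure_iUnion (fun m n h => Set.inter_subset_inter_right _ (hmono h)),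
    ← Set.inter_iUnion, hU, Set.inter_univ]

/-- The filtration generated by the restrictions of a measure to increasing sets. -/
noncomputable def restrictFiltration {S : ℕ → Set Z} (hmono : Monotone S) (hS : ∀ n, MeasurableSet (S n)) :
    Filtration ℕ (inferInstance : MeasurableSpace (Measure Z)) where
  seq n := MeasurableSpace.comap (fun χ : Measure Z => χ.restrict (S n)) inferInstance
  mono' m n hmn := by
    have h : (fun χ : Measure Z => χ.restrict (S m))
        = (fun χ : Measure Z => χ.restrict (S m)) ∘ fun χ : Measure Z => χ.restrict (S n) := by
      funext χ
      simp only [Function.comp_apply]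
      rw [Measure.restrict_restrict (hS m), Set.inter_eq_self_of_subset_left (hmono hmn)]
    change MeasurableSpace.comap (fun χ : Measure Z => χ.restrict (S m)) _ ≤ _
    rw [h, ← MeasurableSpace.comap_comp]
    exact MeasurableSpace.comap_mono (measurable_restrict (hS m)).comap_le
  le' n := (measurable_restrict (hS n)).comap_le

lemma le_iSup_restrictFiltration {S : ℕ → Set Z} (hmono : Monotone S)
    (hS : ∀ n, MeasurableSet (S n)) (hU : ⋃ n, S n = Set.univ) :
    (inferInstance : MeasurableSpace (Measure Z)) ≤ ⨆ n, restrictFiltration hmono hS n := by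
  refine iSup₂_le fun B hB => ?_
  rw [← measurable_iff_comap_le]
  have h1 : (fun χ : Measure Z => χ B) = fun χ => ⨆ n, χ.restrict (S n) B :=
    funext fun χ => iSup_restrict_apply hmono hU χ hB
  rw [h1]
  have hn : ∀ n, Measurable[⨆ n, restrictFiltration hmono hS n]
      fun χ : Measure Z => χ.restrict (S n) B := by
    intro n
    have h2 : Measurable[restrictFiltration hmono hS n]
        fun χ : Measure Z => χ.restrict (S n) :=
      comap_measurable fun χ : Measure Z => χ.restrict (S n)
    have h3 : Measurable[restrictFiltration hmono hS n]
        fun χ : Measure Z => χ.restrict (S n) B := (Measure.measurable_coe hB).comp h2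
    exact h3.mono (le_iSup _ n) le_rfl
  exact Measurable.iSup hn

lemma energy_mono_measure {p : ℝ} {Λ : Measure (Measure Z)} {μ ν : Measure Z} (h : μ ≤ ν)
    (f : Measure Z → ℝ) : energy p Λ μ f ≤ energy p Λ ν f :=
  lintegral_mono' h le_rfl

/-- The Poincaré inequality for Poisson laws. -/
theorem IsMeckeLaw.poincareIneq {Λ : Measure (Measure Z)} {μ : Measure Z} [SigmaFinite μ]
    (hΛ : IsMeckeLaw Λ μ) {p : ℝ} (hp1 : 1 ≤ p) (hp2 : p ≤ 2) : PoincareIneq p 96 Λ μ := by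
  have := hΛ.prob
  have hp0 : 0 < p := by linarith
  rintro f hf ⟨M, hM⟩
  let S := spanningSets μ
  have hSm : ∀ n, MeasurableSet (S n) := measurableSet_spanningSets μ
  have hmono : Monotone S := monotone_spanningSets μ
  have hSfin : ∀ n, μ (S n) < ∞ := measure_spanningSets_lt_top μ
  have hfin : ∀ n, IsFiniteMeasure (μ.restrict (S n)) := fun n => ⟨by simpa using hSfin n⟩
  let ℱ := restrictFiltration hmono hSm
  have hlim : ∀ᵐ χ ∂Λ, Filter.Tendsto (fun n => (Λ[f | ℱ n]) χ) Filter.atTop (nhds (f χ)) := by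
    refine (integrable_of_abs_le hf hM).tendsto_ae_condExp ?_
    exact (hf.stronglyMeasurable).mono
      (le_iSup_restrictFiltration hmono hSm (iUnion_spanningSets μ))
  -- The conditional expectation is a functional of the restriction to `S n`, whose law has finite
  -- intensity and satisfies the inequality. Its mean is that of `f`, and its energy is at most that
  -- of `f`. Lévy's theorem and Fatou's lemma then give the bound for `f`.
  have hbound : ∀ n, ∫⁻ χ, ‖(Λ[f | ℱ n]) χ‖ₑ ^ p ∂Λ
      ≤ ‖∫ χ, f χ ∂Λ‖ₑ ^ p + 96 * energy p Λ μ f := by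
    intro n
    obtain ⟨Q, hQ, hP⟩ := exists_isMeckeLaw_poincareIneq (μ.restrict (S n)) hp1 hp2
    have := hQ.prob
    have := Measure.isProbabilityMeasure_map (μ := Λ)
      (measurable_restrict (hSm n).compl).aemeasurable
    set ρ := Λ.map fun χ => χ.restrict (S n)ᶜ with hρ
    have hconv : Λ = Q.conv ρ := hΛ.eq_conv (hSm n) (hSfin n) hQ
    have hg : Measurable fun x => ∫ y, f (x + y) ∂ρ := measurable_integral_add hf
    have h1 : ∫⁻ χ, ‖(Λ[f | ℱ n]) χ‖ₑ ^ p ∂Λ = ∫⁻ x, ‖∫ y, f (x + y) ∂ρ‖ₑ ^ p ∂Q := by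
      rw [← hΛ.map_restrict_eq (hSm n) (hSfin n) hQ,
        lintegral_map (hg.enorm.pow_const p) (measurable_restrict (hSm n))]
      refine lintegral_congr_ae ?_
      filter_upwards [hΛ.condExp_restrict (hSm n) (hSfin n) hQ hf hM] with χ hχ
      rw [hχ]
      rfl
    rw [h1]
    refine (hP _ hg ⟨M, abs_integral_add_le hM⟩).trans ?_
    rw [← integral_conv_of_bounded hf hM, ← hconv]
    gcongr
    refine (lintegral_energy_integral_add_le hp1 _ hf hM).trans ?_
    rw [← hconv]
    exact energy_mono_measure Measure.restrict_le_self f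
  calc ∫⁻ χ, ‖f χ‖ₑ ^ p ∂Λ
      = ∫⁻ χ, Filter.liminf (fun n => ‖(Λ[f | ℱ n]) χ‖ₑ ^ p) Filter.atTop ∂Λ := by
        refine lintegral_congr_ae ?_
        filter_upwards [hlim] with χ hχ
        exact ((ENNReal.continuous_rpow_const.tendsto _).comp
          (continuous_enorm.tendsto _ |>.comp hχ)).liminf_eq.symm
    _ ≤ Filter.liminf (fun n => ∫⁻ χ, ‖(Λ[f | ℱ n]) χ‖ₑ ^ p ∂Λ) Filter.atTop :=
        lintegral_liminf_le' fun n =>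
          (integrable_condExp.aestronglyMeasurable.enorm.pow_const p)
    _ ≤ _ := Filter.liminf_le_of_frequently_le' (Filter.Frequently.of_forall hbound)

/-! ### The Poincaré inequality for unbounded functionals -/

/-- Truncation of a real number at level `n`. -/
noncomputable def truncate (n : ℕ) (x : ℝ) : ℝ := max (min x n) (-n)

lemma measurable_truncate (n : ℕ) : Measurable (truncate n) := by
  unfold truncate; fun_prop

lemma abs_truncate_le (n : ℕ) (x : ℝ) : |truncate n x| ≤ n := by
  have hn : (0 : ℝ) ≤ n := Nat.cast_nonneg n
  rw [truncate, abs_le]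
  exact ⟨le_max_right _ _, max_le (min_le_right _ _) (by linarith)⟩

lemma abs_truncate_le_abs (n : ℕ) (x : ℝ) : |truncate n x| ≤ |x| := by
  have hn : (0 : ℝ) ≤ n := Nat.cast_nonneg n
  rw [truncate, abs_le]
  constructor
  · refine le_max_of_le_left (le_min (neg_abs_le x) ?_)
    linarith [abs_nonneg x]
  · refine max_le ((min_le_left _ _).trans (le_abs_self x)) ?_
    linarith [abs_nonneg x]

lemma abs_truncate_sub_le (n : ℕ) (x y : ℝ) : |truncate n x - truncate n y| ≤ |x - y| := by
  refine (abs_max_sub_max_le_abs _ _ _).trans ?_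
  refine (abs_min_sub_min_le_max _ _ _ _).trans ?_
  simp

lemma tendsto_truncate (x : ℝ) :
    Filter.Tendsto (fun n => truncate n x) Filter.atTop (nhds x) := by
  refine tendsto_const_nhds.congr' ?_
  obtain ⟨N, hN⟩ := exists_nat_ge |x|
  filter_upwards [Filter.eventually_ge_atTop N] with n hn
  have h : |x| ≤ n := hN.trans (by exact_mod_cast hn)
  rw [abs_le] at h
  rw [truncate, min_eq_left h.2, max_eq_left h.1]

section Unbounded

variable {Λ : Measure (Measure Z)} {μ : Measure Z} [SigmaFinite μ]

/-- Truncation is 1-Lipschitz and cannot increase the energy; centring removes the mean term, so the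
bound does not depend on the level. -/
lemma IsMeckeLaw.lintegral_truncate_le (hΛ : IsMeckeLaw Λ μ) {p : ℝ} (hp1 : 1 ≤ p) (hp2 : p ≤ 2)
    {f : Measure Z → ℝ} (hf : Measurable f) (n : ℕ) :
    ∫⁻ χ, ‖truncate n (f χ) - ∫ y, truncate n (f y) ∂Λ‖ₑ ^ p ∂Λ ≤ 96 * energy p Λ μ f := by
  have := hΛ.prob
  have hp0 : 0 < p := by linarith
  set a := ∫ y, truncate n (f y) ∂Λ with ha
  have hm : Measurable fun χ => truncate n (f χ) := (measurable_truncate n).comp hf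
  have hint : Integrable (fun χ => truncate n (f χ)) Λ :=
    integrable_of_abs_le hm fun χ => abs_truncate_le n _
  have h := hΛ.poincareIneq hp1 hp2 (fun χ => truncate n (f χ) - a) (hm.sub_const a)
    ⟨n + |a|, fun χ => (abs_sub _ _).trans (by linarith [abs_truncate_le n (f χ)])⟩
  rw [integral_sub hint (integrable_const a)] at h
  simp only [integral_const, probReal_univ, one_smul, ← ha, sub_self, enorm_zero,
    ENNReal.zero_rpow_of_pos hp0, zero_add] at h
  refine h.trans ?_
  gcongr
  refine lintegral_mono fun z => lintegral_mono fun χ => ENNReal.rpow_le_rpow ?_ hp0.le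
  rw [Real.enorm_eq_ofReal_abs, Real.enorm_eq_ofReal_abs]
  refine ENNReal.ofReal_le_ofReal ?_
  simp only [addOneCost, sub_sub_sub_cancel_right]
  exact abs_truncate_sub_le n _ _

/-- A functional with finite energy has a moment of order `p`. -/
theorem IsMeckeLaw.lintegral_lt_top_of_energy (hΛ : IsMeckeLaw Λ μ) {p : ℝ} (hp1 : 1 ≤ p)
    (hp2 : p ≤ 2) {f : Measure Z → ℝ} (hf : Measurable f) (hA : energy p Λ μ f < ∞) :
    ∫⁻ χ, ‖f χ‖ₑ ^ p ∂Λ < ∞ := by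
  have := hΛ.prob
  have hp0 : 0 < p := by linarith
  set A := energy p Λ μ f with hAdef
  have hpow : Continuous fun x : ℝ => ‖x‖ₑ ^ p :=
    ENNReal.continuous_rpow_const.comp continuous_enorm
  have hmd : ∀ n : ℕ, Measurable fun q : Measure Z × Measure Z =>
      ‖truncate n (f q.1) - truncate n (f q.2)‖ₑ ^ p := by
    intro n
    have h1 : Measurable fun q : Measure Z × Measure Z =>
        truncate n (f q.1) - truncate n (f q.2) :=
      ((measurable_truncate n).comp (hf.comp measurable_fst)).sub
        ((measurable_truncate n).comp (hf.comp measurable_snd))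
    exact h1.enorm.pow_const p
  -- Since `f` is not known to be integrable, the means of its truncations might diverge. The
  -- difference of two independent copies needs no centring, and its bound survives the limit in
  -- `n`.
  have hbound : ∀ n : ℕ, ∫⁻ q, ‖truncate n (f q.1) - truncate n (f q.2)‖ₑ ^ p ∂(Λ.prod Λ)
      ≤ 4 * (96 * A) := by
    intro n
    set a := ∫ y, truncate n (f y) ∂Λ with ha
    have hu : Measurable fun χ => ‖truncate n (f χ) - a‖ₑ ^ p :=
      (((measurable_truncate n).comp hf).sub_const a).enorm.pow_const p
    rw [lintegral_prod _ (hmd n).aemeasurable]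
    calc ∫⁻ x, ∫⁻ y, ‖truncate n (f x) - truncate n (f y)‖ₑ ^ p ∂Λ ∂Λ
        ≤ ∫⁻ x, ∫⁻ y, 2 * (‖truncate n (f x) - a‖ₑ ^ p + ‖truncate n (f y) - a‖ₑ ^ p) ∂Λ ∂Λ := by
          refine lintegral_mono fun x => lintegral_mono fun y => ?_
          refine le_trans ?_ (enorm_add_rpow_le hp1 hp2 _ _)
          refine ENNReal.rpow_le_rpow ?_ hp0.le
          calc ‖truncate n (f x) - truncate n (f y)‖ₑ
              = ‖(truncate n (f x) - a) - (truncate n (f y) - a)‖ₑ := by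
                rw [sub_sub_sub_cancel_right]
            _ ≤ _ := enorm_sub_le
      _ = 2 * (∫⁻ x, ‖truncate n (f x) - a‖ₑ ^ p ∂Λ + ∫⁻ x, ‖truncate n (f x) - a‖ₑ ^ p ∂Λ) := by
          have h1 : ∀ x, ∫⁻ y, 2 * (‖truncate n (f x) - a‖ₑ ^ p + ‖truncate n (f y) - a‖ₑ ^ p) ∂Λ
              = 2 * (‖truncate n (f x) - a‖ₑ ^ p + ∫⁻ y, ‖truncate n (f y) - a‖ₑ ^ p ∂Λ) := by
            intro x
            rw [lintegral_const_mul _ (hu.const_add _), lintegral_add_left measurable_const]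
            simp
          simp_rw [h1]
          rw [lintegral_const_mul _ (hu.add_const _), lintegral_add_right _ measurable_const]
          simp
      _ ≤ 2 * (96 * A + 96 * A) := by
          gcongr <;> exact hΛ.lintegral_truncate_le hp1 hp2 hf n
      _ = 4 * (96 * A) := by ring
  have hlim : ∫⁻ q, ‖f q.1 - f q.2‖ₑ ^ p ∂(Λ.prod Λ) ≤ 4 * (96 * A) := by
    calc ∫⁻ q, ‖f q.1 - f q.2‖ₑ ^ p ∂(Λ.prod Λ)
        = ∫⁻ q, Filter.liminf (fun n : ℕ => ‖truncate n (f q.1) - truncate n (f q.2)‖ₑ ^ p)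
            Filter.atTop ∂(Λ.prod Λ) := by
          refine lintegral_congr fun q => ?_
          exact ((hpow.tendsto _).comp
            ((tendsto_truncate (f q.1)).sub (tendsto_truncate (f q.2)))).liminf_eq.symm
      _ ≤ _ := lintegral_liminf_le hmd
      _ ≤ 4 * (96 * A) := Filter.liminf_le_of_frequently_le' (Filter.Frequently.of_forall hbound)
  have hfm : Measurable fun q : Measure Z × Measure Z => ‖f q.1 - f q.2‖ₑ ^ p :=
    ((hf.comp measurable_fst).sub (hf.comp measurable_snd)).enorm.pow_const p
  rw [lintegral_prod_symm _ hfm.aemeasurable] at hlim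
  have hne : ∫⁻ y, ∫⁻ x, ‖f x - f y‖ₑ ^ p ∂Λ ∂Λ ≠ ∞ :=
    ne_top_of_le_ne_top (by finiteness) hlim
  -- For some fixed `y` the `p`-th moment of `f - f y` is finite, and `f y` is a real constant.
  obtain ⟨y, hy⟩ := (ae_lt_top hfm.lintegral_prod_left' hne).exists
  have hfy : Measurable fun x => ‖f x - f y‖ₑ ^ p := (hf.sub_const _).enorm.pow_const p
  calc ∫⁻ x, ‖f x‖ₑ ^ p ∂Λ ≤ ∫⁻ x, 2 * (‖f x - f y‖ₑ ^ p + ‖f y‖ₑ ^ p) ∂Λ := by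
        refine lintegral_mono fun x => ?_
        refine le_trans ?_ (enorm_add_rpow_le hp1 hp2 _ _)
        refine ENNReal.rpow_le_rpow ?_ hp0.le
        calc ‖f x‖ₑ = ‖(f x - f y) + f y‖ₑ := by congr 1; ring
          _ ≤ _ := enorm_add_le _ _
    _ = 2 * (∫⁻ x, ‖f x - f y‖ₑ ^ p ∂Λ + ‖f y‖ₑ ^ p) := by
        rw [lintegral_const_mul _ (hfy.add_const _), lintegral_add_right _ measurable_const]
        simp
    _ < ∞ := by
        refine ENNReal.mul_lt_top (by norm_num) (ENNReal.add_lt_top.2 ⟨hy, ?_⟩)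
        exact ENNReal.rpow_lt_top_of_nonneg hp0.le enorm_ne_top

/-- The Poincaré inequality for integrable functionals. -/
theorem IsMeckeLaw.lintegral_le_of_integrable (hΛ : IsMeckeLaw Λ μ) {p : ℝ} (hp1 : 1 ≤ p)
    (hp2 : p ≤ 2) {f : Measure Z → ℝ} (hf : Measurable f) (hint : Integrable f Λ) :
    ∫⁻ χ, ‖f χ‖ₑ ^ p ∂Λ ≤ 2 * ‖∫ χ, f χ ∂Λ‖ₑ ^ p + 192 * energy p Λ μ f := by
  have := hΛ.prob
  have hp0 : 0 < p := by linarith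
  set a := ∫ χ, f χ ∂Λ with ha
  have hpow : Continuous fun x : ℝ => ‖x‖ₑ ^ p :=
    ENNReal.continuous_rpow_const.comp continuous_enorm
  have hmean : Filter.Tendsto (fun n : ℕ => ∫ χ, truncate n (f χ) ∂Λ) Filter.atTop (nhds a) := by
    refine tendsto_integral_of_dominated_convergence (fun χ => |f χ|)
      (fun n => ((measurable_truncate n).comp hf).aestronglyMeasurable) hint.abs ?_ ?_
    · exact fun n => Filter.Eventually.of_forall fun χ => abs_truncate_le_abs n _
    · exact Filter.Eventually.of_forall fun χ => tendsto_truncate (f χ)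
  have hlim : ∫⁻ χ, ‖f χ - a‖ₑ ^ p ∂Λ ≤ 96 * energy p Λ μ f := by
    calc ∫⁻ χ, ‖f χ - a‖ₑ ^ p ∂Λ
        = ∫⁻ χ, Filter.liminf (fun n : ℕ => ‖truncate n (f χ) - ∫ y, truncate n (f y) ∂Λ‖ₑ ^ p)
            Filter.atTop ∂Λ := by
          refine lintegral_congr fun χ => ?_
          exact ((hpow.tendsto _).comp ((tendsto_truncate (f χ)).sub hmean)).liminf_eq.symm
      _ ≤ _ := lintegral_liminf_le fun n =>
          (((measurable_truncate n).comp hf).sub_const _).enorm.pow_const p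
      _ ≤ _ := Filter.liminf_le_of_frequently_le' (Filter.Frequently.of_forall fun n =>
          hΛ.lintegral_truncate_le hp1 hp2 hf n)
  have hfa : Measurable fun x => ‖f x - a‖ₑ ^ p := (hf.sub_const _).enorm.pow_const p
  -- No tensorization follows, so the coefficient of the mean may be `2`; correspondingly `192 = 2 ·
  -- 96`.
  calc ∫⁻ x, ‖f x‖ₑ ^ p ∂Λ ≤ ∫⁻ x, 2 * (‖a‖ₑ ^ p + ‖f x - a‖ₑ ^ p) ∂Λ := by
        refine lintegral_mono fun x => ?_
        refine le_trans ?_ (enorm_add_rpow_le hp1 hp2 _ _)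
        refine ENNReal.rpow_le_rpow ?_ hp0.le
        calc ‖f x‖ₑ = ‖a + (f x - a)‖ₑ := by congr 1; ring
          _ ≤ _ := enorm_add_le _ _
    _ = 2 * (‖a‖ₑ ^ p + ∫⁻ x, ‖f x - a‖ₑ ^ p ∂Λ) := by
        rw [lintegral_const_mul _ (hfa.const_add _), lintegral_add_left measurable_const]
        simp
    _ ≤ 2 * (‖a‖ₑ ^ p + 96 * energy p Λ μ f) := by gcongr
    _ = _ := by ring

end Unbounded

end PoissonChaos

namespace PoissonChaos

variable {Z : Type*} [MeasurableSpace Z] {Λ : Measure (Measure Z)} {μ : Measure Z}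

/-! ### Functionals with vanishing iterated add-one costs -/

/-- The Mecke equation for the indicator of a measurable null set containing the exceptional set.
This makes add-one costs independent, almost everywhere, of the chosen representative of a
functional. -/
lemma IsMeckeLaw.ae_add_dirac (hΛ : IsMeckeLaw Λ μ) [SigmaFinite μ] {p : Measure Z → Prop}
    (hp : ∀ᵐ χ ∂Λ, p χ) : ∀ᵐ z ∂μ, ∀ᵐ χ ∂Λ, p (χ + Measure.dirac z) := by
  have := hΛ.prob
  refine ae_of_forall_measure_lt_top_ae_restrict _ fun B hB hfin => ?_
  set N := toMeasurable Λ {χ | ¬ p χ} with hN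
  have hNm : MeasurableSet N := measurableSet_toMeasurable _ _
  have hN0 : Λ N = 0 := by rw [hN, measure_toMeasurable]; exact hp
  have h1 := hΛ.mecke B hB hfin (N.indicator 1) (measurable_one.indicator hNm)
  have h2 : ∫⁻ χ, χ B * N.indicator 1 χ ∂Λ = 0 := by
    have : ∀ᵐ χ ∂Λ, χ B * N.indicator 1 χ = 0 := by
      have : ∀ᵐ χ ∂Λ, χ ∉ N := measure_eq_zero_iff_ae_notMem.1 hN0
      filter_upwards [this] with χ hχ
      simp [hχ]
    rw [lintegral_congr_ae this]; simp
  rw [h2] at h1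
  have hm : Measurable fun q : Z × Measure Z => N.indicator (1 : Measure Z → ℝ≥0∞)
      (q.2 + Measure.dirac q.1) := (measurable_one.indicator hNm).comp measurable_add_dirac
  have h3 := (lintegral_eq_zero_iff hm.lintegral_prod_right').1 h1.symm
  filter_upwards [h3] with z hz
  have h4 := (lintegral_eq_zero_iff (hm.comp measurable_prodMk_left)).1 hz
  filter_upwards [h4] with χ hχ
  by_contra hcon
  have : χ + Measure.dirac z ∈ N := subset_toMeasurable _ _ hcon
  simp [this] at hχ

/-- The `n`-fold iterated add-one costs of `f` vanish almost everywhere. -/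
def VanishAfter (Λ : Measure (Measure Z)) (μ : Measure Z) : ℕ → (Measure Z → ℝ) → Prop
  | 0, f => ∀ᵐ χ ∂Λ, f χ = 0
  | n + 1, f => ∀ᵐ z ∂μ, VanishAfter Λ μ n (addOneCost z f)

section Vanish

variable [SigmaFinite μ]

lemma IsMeckeLaw.addOneCost_congr (hΛ : IsMeckeLaw Λ μ) {f g : Measure Z → ℝ} (h : f =ᵐ[Λ] g) :
    ∀ᵐ z ∂μ, addOneCost z f =ᵐ[Λ] addOneCost z g := by
  filter_upwards [hΛ.ae_add_dirac h] with z hz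
  filter_upwards [h, hz] with χ h1 h2
  simp only [addOneCost, h1, h2]

lemma VanishAfter.congr (hΛ : IsMeckeLaw Λ μ) {n : ℕ} : ∀ {f g : Measure Z → ℝ},
    f =ᵐ[Λ] g → VanishAfter Λ μ n f → VanishAfter Λ μ n g := by
  induction n with
  | zero =>
    intro f g h hf
    filter_upwards [h, hf] with χ h1 h2
    rw [← h1, h2]
  | succ n ih =>
    intro f g h hf
    filter_upwards [hΛ.addOneCost_congr h, hf] with z h1 h2
    exact ih h1 h2

lemma VanishAfter.succ (hΛ : IsMeckeLaw Λ μ) {n : ℕ} : ∀ {f : Measure Z → ℝ},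
    VanishAfter Λ μ n f → VanishAfter Λ μ (n + 1) f := by
  induction n with
  | zero =>
    intro f hf
    filter_upwards [hΛ.ae_add_dirac hf] with z hz
    filter_upwards [hf, hz] with χ h1 h2
    simp [addOneCost, h1, h2]
  | succ n ih =>
    intro f hf
    filter_upwards [hf] with z hz
    exact ih hz

lemma VanishAfter.mono (hΛ : IsMeckeLaw Λ μ) {n k : ℕ} (h : n ≤ k) {f : Measure Z → ℝ}
    (hf : VanishAfter Λ μ n f) : VanishAfter Λ μ k f := by
  induction k, h using Nat.le_induction with
  | base => exact hf
  | succ k _ ih => exact ih.succ hΛ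

lemma VanishAfter.add {n : ℕ} : ∀ {f g : Measure Z → ℝ},
    VanishAfter Λ μ n f → VanishAfter Λ μ n g → VanishAfter Λ μ n (f + g) := by
  induction n with
  | zero =>
    intro f g hf hg
    filter_upwards [hf, hg] with χ h1 h2
    simp [h1, h2]
  | succ n ih =>
    intro f g hf hg
    filter_upwards [hf, hg] with z h1 h2
    rw [addOneCost_add]
    exact ih h1 h2

lemma VanishAfter.smul {n : ℕ} (c : ℝ) : ∀ {f : Measure Z → ℝ},
    VanishAfter Λ μ n f → VanishAfter Λ μ n (c • f) := by
  induction n with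
  | zero =>
    intro f hf
    filter_upwards [hf] with χ h1
    simp [h1]
  | succ n ih =>
    intro f hf
    filter_upwards [hf] with z h1
    rw [addOneCost_smul]
    exact ih h1

lemma VanishAfter.sum {ι : Type*} (hΛ : IsMeckeLaw Λ μ) {n : ℕ} (s : Finset ι)
    {f : ι → Measure Z → ℝ} (hf : ∀ i ∈ s, VanishAfter Λ μ n (f i)) :
    VanishAfter Λ μ n (∑ i ∈ s, f i) := by
  classical
  induction s using Finset.induction_on with
  | empty =>
    refine VanishAfter.mono hΛ (Nat.zero_le n) ?_
    exact Filter.Eventually.of_forall fun χ => by simp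
  | insert i s hi ih =>
    rw [Finset.sum_insert hi]
    exact (hf i (Finset.mem_insert_self _ _)).add
      (ih fun j hj => hf j (Finset.mem_insert_of_mem hj))

lemma addOneCost_mul (z : Z) (f g : Measure Z → ℝ) :
    addOneCost z (f * g)
      = addOneCost z f * g + f * addOneCost z g + addOneCost z f * addOneCost z g := by
  funext χ
  simp only [addOneCost, Pi.mul_apply, Pi.add_apply]
  ring

/-- Vanishing after order `k` is like being a polynomial of degree less than `k`, and degrees add.
In the product rule each of the three terms lowers `k` or `l` by at least one; the induction ends
when one factor is itself zero. -/
lemma VanishAfter.mul (hΛ : IsMeckeLaw Λ μ) {n : ℕ} : ∀ {k l : ℕ} {f g : Measure Z → ℝ},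
    k + l ≤ n + 1 → VanishAfter Λ μ k f → VanishAfter Λ μ l g → VanishAfter Λ μ n (f * g) := by
  have h0 : ∀ {n : ℕ} {f g : Measure Z → ℝ}, VanishAfter Λ μ 0 f → VanishAfter Λ μ n (f * g) := by
    intro n f g hf
    refine VanishAfter.mono hΛ (Nat.zero_le n) ?_
    filter_upwards [hf] with χ hχ
    simp [hχ]
  have h0' : ∀ {n : ℕ} {f g : Measure Z → ℝ}, VanishAfter Λ μ 0 g → VanishAfter Λ μ n (f * g) := by
    intro n f g hg
    rw [mul_comm]
    exact h0 hg
  induction n with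
  | zero =>
    intro k l f g hkl hf hg
    rcases Nat.eq_zero_or_pos k with rfl | hk
    · exact h0 hf
    · obtain rfl : l = 0 := by omega
      exact h0' hg
  | succ n ih =>
    intro k l f g hkl hf hg
    rcases k with _ | k
    · exact h0 hf
    rcases l with _ | l
    · exact h0' hg
    filter_upwards [hf, hg] with z h1 h2
    rw [addOneCost_mul]
    exact ((ih (by omega) h1 hg).add (ih (by omega) hf h2)).add (ih (by omega) h1 h2)

lemma VanishAfter.prod (hΛ : IsMeckeLaw Λ μ) {ι : Type*} (s : Finset ι) {k : ι → ℕ}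
    {f : ι → Measure Z → ℝ} (hf : ∀ i ∈ s, VanishAfter Λ μ (k i + 1) (f i)) :
    VanishAfter Λ μ (∑ i ∈ s, k i + 1) (∏ i ∈ s, f i) := by
  classical
  induction s using Finset.induction_on with
  | empty =>
    refine Filter.Eventually.of_forall fun z => Filter.Eventually.of_forall fun χ => ?_
    simp [addOneCost]
  | insert i s hi ih =>
    rw [Finset.sum_insert hi, Finset.prod_insert hi]
    exact VanishAfter.mul hΛ (by omega) (hf i (Finset.mem_insert_self _ _))
      (ih fun j hj => hf j (Finset.mem_insert_of_mem hj))

lemma measurableSet_ae_iterDiff_eq_zero [SFinite Λ] {f : Measure Z → ℝ} (hf : Measurable f)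
    (n : ℕ) : MeasurableSet {z : Fin n → Z | ∀ᵐ χ ∂Λ, iterDiff n z f χ = 0} := by
  have h1 : {z : Fin n → Z | ∀ᵐ χ ∂Λ, iterDiff n z f χ = 0}
      = {z | ∫⁻ χ, ‖iterDiff n z f χ‖ₑ ∂Λ = 0} := by
    ext z
    simp only [Set.mem_ofPred_eq]
    rw [lintegral_eq_zero_iff (measurable_iterDiff hf n z).enorm]
    refine Filter.eventually_congr (Filter.Eventually.of_forall fun χ => ?_)
    simp
  rw [h1]
  exact (Measurable.lintegral_prod_right' (f := fun q : (Fin n → Z) × Measure Z =>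
    ‖iterDiff n q.1 f q.2‖ₑ) (measurable_iterDiff_uncurry hf n).enorm) (measurableSet_singleton 0)

/-- The recursive form suits the product rule and the form on the power space suits integration.
They agree by Fubini, the measurability of the exceptional set being what permits exchanging the
two. -/
lemma vanishAfter_iff [SFinite Λ] (n : ℕ) : ∀ {f : Measure Z → ℝ}, Measurable f →
    (VanishAfter Λ μ n f ↔ ∀ᵐ z ∂(powMeasure μ n), ∀ᵐ χ ∂Λ, iterDiff n z f χ = 0) := by
  induction n with
  | zero =>
    intro f hf
    rw [powMeasure, Measure.pi_of_empty]
    simp [VanishAfter, iterDiff_zero]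
  | succ n ih =>
    intro f hf
    rw [ae_powMeasure_succ μ n (measurableSet_ae_iterDiff_eq_zero hf (n + 1))]
    refine Filter.eventually_congr (Filter.Eventually.of_forall fun w => ?_)
    rw [ih (measurable_addOneCost hf w)]
    simp only [iterDiff_addOneCost, iterDiff_cons]

/-! ### Moments of iterated add-one costs -/

/-- The `L^p`-norm (to the power `p`) of the `q`-fold iterated add-one costs. -/
noncomputable def iterEnergy (p : ℝ) (Λ : Measure (Measure Z)) (μ : Measure Z) [SigmaFinite μ]
    (q : ℕ) (f : Measure Z → ℝ) : ℝ≥0∞ :=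
  ∫⁻ z, ∫⁻ χ, ‖iterDiff q z f χ‖ₑ ^ p ∂Λ ∂(powMeasure μ q)

/-- The expectation of the iterated add-one cost. -/
noncomputable def meanDiff (Λ : Measure (Measure Z)) (q : ℕ) (f : Measure Z → ℝ)
    (z : Fin q → Z) : ℝ := ∫ χ, iterDiff q z f χ ∂Λ

lemma measurable_meanDiff [SFinite Λ] (q : ℕ) {f : Measure Z → ℝ} (hf : Measurable f) :
    Measurable (meanDiff Λ q f) :=
  ((measurable_iterDiff_uncurry hf q).stronglyMeasurable.integral_prod_right'
    (f := fun r : (Fin q → Z) × Measure Z => iterDiff q r.1 f r.2)).measurable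

lemma iterEnergy_zero (p : ℝ) (f : Measure Z → ℝ) :
    iterEnergy p Λ μ 0 f = ∫⁻ χ, ‖f χ‖ₑ ^ p ∂Λ := by
  simp [iterEnergy]

lemma iterEnergy_succ [SFinite Λ] (p : ℝ) (q : ℕ) {f : Measure Z → ℝ} (hf : Measurable f) :
    iterEnergy p Λ μ (q + 1) f = ∫⁻ z, energy p Λ μ (iterDiff q z f) ∂(powMeasure μ q) := by
  have hm : Measurable fun z : Fin (q + 1) → Z => ∫⁻ χ, ‖iterDiff (q + 1) z f χ‖ₑ ^ p ∂Λ :=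
    Measurable.lintegral_prod_right' (f := fun r : (Fin (q + 1) → Z) × Measure Z =>
      ‖iterDiff (q + 1) r.1 f r.2‖ₑ ^ p)
      ((measurable_iterDiff_uncurry hf (q + 1)).enorm.pow_const p)
  rw [iterEnergy, lintegral_powMeasure_succ μ q hm,
    lintegral_lintegral_swap (f := fun w z => ∫⁻ χ, ‖iterDiff (q + 1) (Fin.cons w z) f χ‖ₑ ^ p ∂Λ)
      (hm.comp (measurable_cons q)).aemeasurable]
  simp only [iterDiff_cons, energy]

lemma iterEnergy_one [SFinite Λ] (p : ℝ) {f : Measure Z → ℝ} (hf : Measurable f) :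
    iterEnergy p Λ μ 1 f = energy p Λ μ f := by
  rw [iterEnergy_succ p 0 hf]
  simp

lemma iterEnergy_eq_zero [SFinite Λ] {p : ℝ} (hp : 0 < p) {q : ℕ} {f : Measure Z → ℝ}
    (hf : Measurable f) (h : VanishAfter Λ μ q f) : iterEnergy p Λ μ q f = 0 := by
  rw [vanishAfter_iff q hf] at h
  have h1 : ∀ᵐ z ∂(powMeasure μ q), ∫⁻ χ, ‖iterDiff q z f χ‖ₑ ^ p ∂Λ = 0 := by
    filter_upwards [h] with z hz
    have : ∀ᵐ χ ∂Λ, ‖iterDiff q z f χ‖ₑ ^ p = 0 := by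
      filter_upwards [hz] with χ hχ
      simp [hχ, hp]
    rw [lintegral_congr_ae this]; simp
  rw [iterEnergy, lintegral_congr_ae h1]; simp

/-- The Poincaré inequality for the functional `iterDiff q z f` with `z` fixed, integrated over `z`.
Only here does integrability of the differences enter. -/
lemma IsMeckeLaw.iterEnergy_le (hΛ : IsMeckeLaw Λ μ) {p : ℝ} (hp1 : 1 ≤ p) (hp2 : p ≤ 2) (q : ℕ)
    {f : Measure Z → ℝ} (hf : Measurable f)
    (hint : ∀ᵐ z ∂(powMeasure μ q), Integrable (iterDiff q z f) Λ) :
    iterEnergy p Λ μ q f ≤ 2 * ∫⁻ z, ‖meanDiff Λ q f z‖ₑ ^ p ∂(powMeasure μ q)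
      + 192 * iterEnergy p Λ μ (q + 1) f := by
  have := hΛ.prob
  have hm : Measurable fun z => ‖meanDiff Λ q f z‖ₑ ^ p :=
    (measurable_meanDiff q hf).enorm.pow_const p
  have hE : Measurable fun z => energy p Λ μ (iterDiff q z f) := by
    have h1 : Measurable fun z : Fin (q + 1) → Z => ∫⁻ χ, ‖iterDiff (q + 1) z f χ‖ₑ ^ p ∂Λ :=
      Measurable.lintegral_prod_right' (f := fun r : (Fin (q + 1) → Z) × Measure Z =>
        ‖iterDiff (q + 1) r.1 f r.2‖ₑ ^ p)
        ((measurable_iterDiff_uncurry hf (q + 1)).enorm.pow_const p)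
    have h2 := (h1.comp (measurable_cons q)).lintegral_prod_left' (μ := μ)
    simpa only [Function.comp_apply, iterDiff_cons, energy] using h2
  rw [iterEnergy_succ p q hf, iterEnergy, ← lintegral_const_mul _ hm, ← lintegral_const_mul _ hE,
    ← lintegral_add_left (hm.const_mul 2)]
  refine lintegral_mono_ae ?_
  filter_upwards [hint] with z hz
  exact hΛ.lintegral_le_of_integrable hp1 hp2 (measurable_iterDiff hf q z) hz

/-- The `L^p`-criterion: a functional whose iterated add-one costs vanish from order `K + 1` on
is `p`-integrable if the expectations of its iterated add-one costs are. -/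
theorem IsMeckeLaw.lintegral_lt_top_of_meanDiff (hΛ : IsMeckeLaw Λ μ) {p : ℝ} (hp1 : 1 ≤ p)
    (hp2 : p ≤ 2) (K : ℕ) {f : Measure Z → ℝ} (hf : Measurable f)
    (hK : VanishAfter Λ μ (K + 1) f)
    (hint : ∀ q, 1 ≤ q → q ≤ K → ∀ᵐ z ∂(powMeasure μ q), Integrable (iterDiff q z f) Λ)
    (hfin : ∀ q, 1 ≤ q → q ≤ K → ∫⁻ z, ‖meanDiff Λ q f z‖ₑ ^ p ∂(powMeasure μ q) < ∞) :
    ∫⁻ χ, ‖f χ‖ₑ ^ p ∂Λ < ∞ := by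
  have := hΛ.prob
  -- Descent on the order `K + 1 - j`, from `K + 1`, where the energy is zero, down to `1`.
  have hlt : ∀ j, j ≤ K → iterEnergy p Λ μ (K + 1 - j) f < ∞ := by
    intro j
    induction j with
    | zero =>
      intro _
      rw [Nat.sub_zero, iterEnergy_eq_zero (by linarith) hf hK]
      exact ENNReal.zero_lt_top
    | succ j ih =>
      intro hj
      have h1 := ih (by omega)
      have h2 : K + 1 - j = (K + 1 - (j + 1)) + 1 := by omega
      rw [h2] at h1
      refine lt_of_le_of_lt (hΛ.iterEnergy_le hp1 hp2 (K + 1 - (j + 1)) hf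
        (hint _ (by omega) (by omega))) ?_
      exact ENNReal.add_lt_top.2 ⟨ENNReal.mul_lt_top (by norm_num) (hfin _ (by omega) (by omega)),
        ENNReal.mul_lt_top (by norm_num) h1⟩
  -- The last step, from order `1` to order `0`, cannot use the mean of `f`, whose existence is part
  -- of the claim.
  refine hΛ.lintegral_lt_top_of_energy hp1 hp2 hf ?_
  rw [← iterEnergy_one p hf]
  simpa using hlt K le_rfl

/-- The moments of a functional whose iterated add-one costs vanish from order `n` on are bounded
by the norms of the expectations of its iterated add-one costs. -/
theorem IsMeckeLaw.lintegral_le_sum_meanDiff (hΛ : IsMeckeLaw Λ μ) {p : ℝ} (hp1 : 1 ≤ p)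
    (hp2 : p ≤ 2) (n : ℕ) {f : Measure Z → ℝ} (hf : Measurable f)
    (hn : VanishAfter Λ μ n f)
    (hint : ∀ q, q < n → ∀ᵐ z ∂(powMeasure μ q), Integrable (iterDiff q z f) Λ) :
    ∫⁻ χ, ‖f χ‖ₑ ^ p ∂Λ ≤ ∑ q ∈ Finset.range n,
      192 ^ q * (2 * ∫⁻ z, ‖meanDiff Λ q f z‖ₑ ^ p ∂(powMeasure μ q)) := by
  have := hΛ.prob
  have key : ∀ j, j ≤ n → ∫⁻ χ, ‖f χ‖ₑ ^ p ∂Λ ≤ ∑ q ∈ Finset.range j,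
      192 ^ q * (2 * ∫⁻ z, ‖meanDiff Λ q f z‖ₑ ^ p ∂(powMeasure μ q))
      + 192 ^ j * iterEnergy p Λ μ j f := by
    intro j
    induction j with
    | zero => intro _; simp [iterEnergy_zero]
    | succ j ih =>
      intro hj
      refine (ih (by omega)).trans ?_
      rw [Finset.sum_range_succ, add_assoc]
      gcongr
      calc (192 : ℝ≥0∞) ^ j * iterEnergy p Λ μ j f
          ≤ 192 ^ j * (2 * ∫⁻ z, ‖meanDiff Λ j f z‖ₑ ^ p ∂(powMeasure μ j)
            + 192 * iterEnergy p Λ μ (j + 1) f) := by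
            gcongr
            exact hΛ.iterEnergy_le hp1 hp2 j hf (hint j (by omega))
        _ = _ := by ring
  have h := key n le_rfl
  rwa [iterEnergy_eq_zero (by linarith) hf hn, mul_zero, add_zero] at h

end Vanish

/-! ### Local integrability of iterated add-one costs -/

/-- The weighted moment `E[|φ(η)| (1 + η(S))^k]`. -/
noncomputable def weightedMoment (Λ : Measure (Measure Z)) (S : Set Z) (k : ℕ)
    (φ : Measure Z → ℝ) : ℝ≥0∞ := ∫⁻ χ, ‖φ χ‖ₑ * (1 + χ S) ^ k ∂Λ

section Weighted

variable {S : Set Z}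

lemma measurable_weight (hS : MeasurableSet S) (k : ℕ) :
    Measurable fun χ : Measure Z => (1 + χ S) ^ k :=
  ((Measure.measurable_coe hS).const_add 1).pow_const k

/-- The Mecke equation trades the integral over the added point for a factor `χ S`, that is, for one
more power of the weight. Controlling all powers therefore controls all iterated differences over
`S`. -/
lemma IsMeckeLaw.lintegral_weightedMoment_shift_le (hΛ : IsMeckeLaw Λ μ) (hS : MeasurableSet S)
    (hfin : μ S < ∞) (k : ℕ) {φ : Measure Z → ℝ} (hφ : Measurable φ) :
    ∫⁻ z in S, weightedMoment Λ S k (fun χ => φ (χ + Measure.dirac z)) ∂μ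
      ≤ weightedMoment Λ S (k + 1) φ := by
  have hm : Measurable fun χ : Measure Z => ‖φ χ‖ₑ * (1 + χ S) ^ k :=
    Measurable.fun_mul hφ.enorm (measurable_weight hS k)
  calc ∫⁻ z in S, weightedMoment Λ S k (fun χ => φ (χ + Measure.dirac z)) ∂μ
      ≤ ∫⁻ z in S, ∫⁻ χ, ‖φ (χ + Measure.dirac z)‖ₑ * (1 + (χ + Measure.dirac z) S) ^ k ∂Λ ∂μ := by
        refine lintegral_mono fun z => lintegral_mono fun χ => ?_
        gcongr
        exact Measure.le_add_right le_rfl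
    _ = ∫⁻ χ, χ S * (‖φ χ‖ₑ * (1 + χ S) ^ k) ∂Λ := (hΛ.mecke S hS hfin _ hm).symm
    _ ≤ weightedMoment Λ S (k + 1) φ := by
        refine lintegral_mono fun χ => ?_
        calc χ S * (‖φ χ‖ₑ * (1 + χ S) ^ k) ≤ (1 + χ S) * (‖φ χ‖ₑ * (1 + χ S) ^ k) := by
              gcongr
              exact le_add_self
          _ = _ := by ring

lemma measurable_weightedMoment_shift [SFinite Λ] (hS : MeasurableSet S) (k : ℕ)
    {φ : Measure Z → ℝ} (hφ : Measurable φ) :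
    Measurable fun z => weightedMoment Λ S k (fun χ => φ (χ + Measure.dirac z)) := by
  have h1 : Measurable fun q : Z × Measure Z => φ (q.2 + Measure.dirac q.1) :=
    hφ.comp measurable_add_dirac
  exact Measurable.lintegral_prod_right' (f := fun q : Z × Measure Z =>
    ‖φ (q.2 + Measure.dirac q.1)‖ₑ * (1 + q.2 S) ^ k)
    (Measurable.fun_mul h1.enorm ((measurable_weight hS k).comp measurable_snd))

lemma weightedMoment_mono (k : ℕ) (φ : Measure Z → ℝ) :
    weightedMoment Λ S k φ ≤ weightedMoment Λ S (k + 1) φ := by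
  refine lintegral_mono fun χ => ?_
  rw [pow_succ]
  gcongr
  exact le_mul_of_one_le_right' le_self_add

lemma weightedMoment_addOneCost_le (hS : MeasurableSet S) (k : ℕ) {φ : Measure Z → ℝ}
    (hφ : Measurable φ) (z : Z) :
    weightedMoment Λ S k (addOneCost z φ)
      ≤ weightedMoment Λ S k (fun χ => φ (χ + Measure.dirac z)) + weightedMoment Λ S k φ := by
  have hm : Measurable fun χ : Measure Z => ‖φ χ‖ₑ * (1 + χ S) ^ k :=
    Measurable.fun_mul hφ.enorm (measurable_weight hS k)
  unfold weightedMoment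
  rw [← lintegral_add_right _ hm]
  refine lintegral_mono fun χ => ?_
  rw [← add_mul]
  gcongr
  exact enorm_sub_le

lemma IsMeckeLaw.lintegral_weightedMoment_addOneCost_le (hΛ : IsMeckeLaw Λ μ)
    (hS : MeasurableSet S) (hfin : μ S < ∞) (k : ℕ) {φ : Measure Z → ℝ} (hφ : Measurable φ) :
    ∫⁻ z in S, weightedMoment Λ S k (addOneCost z φ) ∂μ
      ≤ (1 + μ S) * weightedMoment Λ S (k + 1) φ := by
  calc ∫⁻ z in S, weightedMoment Λ S k (addOneCost z φ) ∂μ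
      ≤ ∫⁻ z in S, (weightedMoment Λ S k (fun χ => φ (χ + Measure.dirac z))
          + weightedMoment Λ S k φ) ∂μ :=
        lintegral_mono fun z => weightedMoment_addOneCost_le hS k hφ z
    _ = ∫⁻ z in S, weightedMoment Λ S k (fun χ => φ (χ + Measure.dirac z)) ∂μ
          + μ S * weightedMoment Λ S k φ := by
        rw [lintegral_add_right _ measurable_const]
        simp [mul_comm]
    _ ≤ weightedMoment Λ S (k + 1) φ + μ S * weightedMoment Λ S (k + 1) φ := by
        gcongr
        · exact hΛ.lintegral_weightedMoment_shift_le hS hfin k hφ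
        · exact weightedMoment_mono k φ
    _ = _ := by ring

lemma measurable_weightedMoment_iterDiff [SFinite Λ] (hS : MeasurableSet S) (k r : ℕ)
    {φ : Measure Z → ℝ} (hφ : Measurable φ) :
    Measurable fun z : Fin r → Z => weightedMoment Λ S k (iterDiff r z φ) :=
  Measurable.lintegral_prod_right' (f := fun q : (Fin r → Z) × Measure Z =>
    ‖iterDiff r q.1 φ q.2‖ₑ * (1 + q.2 S) ^ k)
    (Measurable.fun_mul (measurable_iterDiff_uncurry hφ r).enorm
      ((measurable_weight hS k).comp measurable_snd))

lemma IsMeckeLaw.lintegral_weightedMoment_iterDiff_le [SigmaFinite μ] (hΛ : IsMeckeLaw Λ μ)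
    (hS : MeasurableSet S) (hfin : μ S < ∞) (r : ℕ) :
    ∀ (k : ℕ) {φ : Measure Z → ℝ}, Measurable φ →
    ∫⁻ z, weightedMoment Λ S k (iterDiff r z φ) ∂(powMeasure (μ.restrict S) r)
      ≤ (1 + μ S) ^ r * weightedMoment Λ S (k + r) φ := by
  have := hΛ.prob
  induction r with
  | zero => intro k φ hφ; simp
  | succ r ih =>
    intro k φ hφ
    have hm := measurable_weightedMoment_iterDiff (Λ := Λ) hS k (r + 1) hφ
    rw [lintegral_powMeasure_succ _ r hm]
    simp only [iterDiff_cons, ← iterDiff_addOneCost]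
    calc ∫⁻ w in S, ∫⁻ z, weightedMoment Λ S k (iterDiff r z (addOneCost w φ))
          ∂(powMeasure (μ.restrict S) r) ∂μ
        ≤ ∫⁻ w in S, (1 + μ S) ^ r * weightedMoment Λ S (k + r) (addOneCost w φ) ∂μ :=
          lintegral_mono fun w => ih k (measurable_addOneCost hφ w)
      _ = (1 + μ S) ^ r * ∫⁻ w in S, weightedMoment Λ S (k + r) (addOneCost w φ) ∂μ :=
          lintegral_const_mul' _ _ (by finiteness)
      _ ≤ (1 + μ S) ^ r * ((1 + μ S) * weightedMoment Λ S (k + r + 1) φ) := by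
          gcongr
          exact hΛ.lintegral_weightedMoment_addOneCost_le hS hfin (k + r) hφ
      _ = _ := by rw [← mul_assoc, ← pow_succ]; rfl

/-- Counts on sets of finite intensity have all moments: one factor `χ S` is removed by the Mecke
equation, and adding a point at most doubles `1 + χ S`. -/
lemma IsMeckeLaw.lintegral_weight_lt_top (hΛ : IsMeckeLaw Λ μ) (hS : MeasurableSet S)
    (hfin : μ S < ∞) (k : ℕ) : ∫⁻ χ : Measure Z, (1 + χ S) ^ k ∂Λ < ∞ := by
  have := hΛ.prob
  induction k with
  | zero => simp
  | succ k ih =>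
    have hw := measurable_weight hS k
    have h1 : ∫⁻ χ : Measure Z, (1 + χ S) ^ (k + 1) ∂Λ
        = ∫⁻ χ : Measure Z, (1 + χ S) ^ k ∂Λ + ∫⁻ χ : Measure Z, χ S * (1 + χ S) ^ k ∂Λ := by
      rw [← lintegral_add_left hw]
      refine lintegral_congr fun χ => ?_
      ring
    rw [h1, hΛ.mecke S hS hfin _ hw]
    refine ENNReal.add_lt_top.2 ⟨ih, ?_⟩
    calc ∫⁻ z in S, ∫⁻ χ : Measure Z, (1 + (χ + Measure.dirac z) S) ^ k ∂Λ ∂μ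
        ≤ ∫⁻ z in S, ∫⁻ χ : Measure Z, 2 ^ k * (1 + χ S) ^ k ∂Λ ∂μ := by
          refine lintegral_mono fun z => lintegral_mono fun χ => ?_
          rw [← mul_pow]
          gcongr
          simp only [Measure.coe_add, Pi.add_apply]
          have h2 : Measure.dirac z S ≤ 1 := prob_le_one
          calc 1 + (χ S + Measure.dirac z S) ≤ 1 + (χ S + 1) := by gcongr
            _ ≤ 1 + (χ S + 1) + χ S := le_self_add
            _ = 2 * (1 + χ S) := by ring
      _ = (2 ^ k * ∫⁻ χ : Measure Z, (1 + χ S) ^ k ∂Λ) * μ S := by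
          rw [lintegral_const_mul _ hw, lintegral_const, Measure.restrict_apply_univ]
      _ < ∞ := ENNReal.mul_lt_top (ENNReal.mul_lt_top (by finiteness) ih) hfin

/-- The constant that bounds weighted moments by the `L²`-norm. -/
noncomputable def weightNorm (Λ : Measure (Measure Z)) (S : Set Z) (k : ℕ) : ℝ≥0∞ :=
  (∫⁻ χ : Measure Z, (1 + χ S) ^ (2 * k) ∂Λ) ^ (1 / 2 : ℝ)

lemma IsMeckeLaw.weightNorm_ne_top (hΛ : IsMeckeLaw Λ μ) (hS : MeasurableSet S)
    (hfin : μ S < ∞) (k : ℕ) : weightNorm Λ S k ≠ ∞ :=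
  (ENNReal.rpow_lt_top_of_nonneg (by norm_num)
    (hΛ.lintegral_weight_lt_top hS hfin (2 * k)).ne).ne

/-- The Cauchy-Schwarz inequality. Square-integrability thus yields weighted moments of every order,
and with them locally integrable differences of every order. -/
lemma weightedMoment_le (hS : MeasurableSet S) (k : ℕ) {φ : Measure Z → ℝ} (hφ : Measurable φ) :
    weightedMoment Λ S k φ ≤ eLpNorm φ 2 Λ * weightNorm Λ S k := by
  have h := ENNReal.lintegral_mul_le_Lp_mul_Lq Λ Real.HolderConjugate.two_two
    hφ.enorm.aemeasurable (measurable_weight hS k).aemeasurable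
  refine h.trans_eq ?_
  rw [eLpNorm_eq_lintegral_rpow_enorm_toReal (by norm_num) (by norm_num), weightNorm]
  simp only [ENNReal.toReal_ofNat]
  congr 2
  refine lintegral_congr fun χ => ?_
  rw [ENNReal.rpow_two, ← pow_mul, mul_comm]

/-- The functional `φ` has weighted moments of all orders. -/
def HasWeightedMoments (Λ : Measure (Measure Z)) (S : Set Z) (φ : Measure Z → ℝ) : Prop :=
  ∀ k, weightedMoment Λ S k φ < ∞

lemma IsMeckeLaw.hasWeightedMoments (hΛ : IsMeckeLaw Λ μ) (hS : MeasurableSet S)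
    (hfin : μ S < ∞) {φ : Measure Z → ℝ} (hφ : Measurable φ) (h2 : MemLp φ 2 Λ) :
    HasWeightedMoments Λ S φ := fun k =>
  lt_of_le_of_lt (weightedMoment_le hS k hφ)
    (ENNReal.mul_lt_top h2.2 (hΛ.weightNorm_ne_top hS hfin k).lt_top)

lemma HasWeightedMoments.integrable {φ : Measure Z → ℝ} (hφ : Measurable φ)
    (h : HasWeightedMoments Λ S φ) : Integrable φ Λ := by
  refine ⟨hφ.aestronglyMeasurable, ?_⟩
  simpa [weightedMoment, HasFiniteIntegral] using h 0

lemma IsMeckeLaw.hasWeightedMoments_shift (hΛ : IsMeckeLaw Λ μ) (hS : MeasurableSet S)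
    (hfin : μ S < ∞) {φ : Measure Z → ℝ} (hφ : Measurable φ) (h : HasWeightedMoments Λ S φ) :
    ∀ᵐ z ∂(μ.restrict S), HasWeightedMoments Λ S (fun χ => φ (χ + Measure.dirac z)) := by
  have := hΛ.prob
  refine ae_all_iff.2 fun k => ae_lt_top (measurable_weightedMoment_shift hS k hφ) ?_
  exact (lt_of_le_of_lt (hΛ.lintegral_weightedMoment_shift_le hS hfin k hφ) (h (k + 1))).ne

lemma IsMeckeLaw.hasWeightedMoments_addOneCost (hΛ : IsMeckeLaw Λ μ) (hS : MeasurableSet S)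
    (hfin : μ S < ∞) {φ : Measure Z → ℝ} (hφ : Measurable φ) (h : HasWeightedMoments Λ S φ) :
    ∀ᵐ z ∂(μ.restrict S), HasWeightedMoments Λ S (addOneCost z φ) := by
  filter_upwards [hΛ.hasWeightedMoments_shift hS hfin hφ h] with z hz k
  exact lt_of_le_of_lt (weightedMoment_addOneCost_le hS k hφ z)
    (ENNReal.add_lt_top.2 ⟨hz k, h k⟩)

lemma ae_powMeasure_of_restrict [SigmaFinite μ] (r : ℕ) {p : (Fin r → Z) → Prop}
    (h : ∀ n, ∀ᵐ z ∂(powMeasure (μ.restrict (spanningSets μ n)) r), p z) :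
    ∀ᵐ z ∂(powMeasure μ r), p z := by
  have hU : ⋃ n, Set.univ.pi (fun _ : Fin r => spanningSets μ n) = Set.univ := by
    rw [Set.iUnion_univ_pi_of_monotone fun _ => monotone_spanningSets μ]
    simp [iUnion_spanningSets]
  rw [← Measure.restrict_univ (μ := powMeasure μ r), ← hU, ae_restrict_iUnion_iff]
  intro n
  rw [Measure.restrict_pi_pi]
  exact h n

lemma IsMeckeLaw.ae_integrable_iterDiff [SigmaFinite μ] (hΛ : IsMeckeLaw Λ μ)
    {φ : Measure Z → ℝ} (hφ : Measurable φ) (h2 : MemLp φ 2 Λ) (r : ℕ) :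
    ∀ᵐ z ∂(powMeasure μ r), Integrable (iterDiff r z φ) Λ := by
  have := hΛ.prob
  refine ae_powMeasure_of_restrict r fun n => ?_
  have hS := measurableSet_spanningSets μ n
  have hfin := measure_spanningSets_lt_top μ n
  have hne := lt_of_le_of_lt (hΛ.lintegral_weightedMoment_iterDiff_le hS hfin r 0 hφ)
    (ENNReal.mul_lt_top (by finiteness) (hΛ.hasWeightedMoments hS hfin hφ h2 _))
  filter_upwards [ae_lt_top (measurable_weightedMoment_iterDiff hS 0 r hφ) hne.ne] with z hz
  refine ⟨(measurable_iterDiff hφ r z).aestronglyMeasurable, ?_⟩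
  simpa [weightedMoment, HasFiniteIntegral] using hz

/-- The local `L¹`-norm of the iterated add-one costs is controlled by the `L²`-norm. -/
lemma IsMeckeLaw.lintegral_iterDiff_le [SigmaFinite μ] (hΛ : IsMeckeLaw Λ μ)
    (hS : MeasurableSet S) (hfin : μ S < ∞) {φ : Measure Z → ℝ} (hφ : Measurable φ) (r : ℕ) :
    ∫⁻ z, ∫⁻ χ, ‖iterDiff r z φ χ‖ₑ ∂Λ ∂(powMeasure (μ.restrict S) r)
      ≤ (1 + μ S) ^ r * (eLpNorm φ 2 Λ * weightNorm Λ S r) := by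
  refine le_trans ?_ ((hΛ.lintegral_weightedMoment_iterDiff_le hS hfin r 0 hφ).trans ?_)
  · simp [weightedMoment]
  · gcongr
    rw [zero_add]
    exact weightedMoment_le hS r hφ

end Weighted

end PoissonChaos

namespace PoissonChaos

variable {Z : Type*} [MeasurableSpace Z] {Λ : Measure (Measure Z)} {μ : Measure Z}

/-! ### Factorial measures of rectangles -/

section Factorial

variable {q : ℕ}

/-- The factorial measure of the rectangle with sides `B j`, `j ∈ J`. -/
noncomputable def factorialOn (χ : Measure Z) (B : Fin q → Set Z) (J : Finset (Fin q)) : ℝ :=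
  factorialRect χ J.card (fun i => B (J.orderEmbOfFin rfl i))

lemma factorialOn_eq (χ : Measure Z) (B : Fin q → Set Z) (J : Finset (Fin q)) {n : ℕ}
    (hn : J.card = n) (e : Fin n → Fin q) (he : StrictMono e) (hJ : ∀ i, e i ∈ J) :
    factorialOn χ B J = factorialRect χ n (fun i => B (e i)) := by
  subst hn
  unfold factorialOn
  rw [← Finset.orderEmbOfFin_unique rfl hJ he]

@[simp] lemma factorialOn_empty (χ : Measure Z) (B : Fin q → Set Z) : factorialOn χ B ∅ = 1 := rfl

lemma factorialOn_congr (χ : Measure Z) {B B' : Fin q → Set Z} {J : Finset (Fin q)}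
    (h : ∀ j ∈ J, B j = B' j) : factorialOn χ B J = factorialOn χ B' J := by
  unfold factorialOn
  congr 1
  funext i
  exact h _ (Finset.orderEmbOfFin_mem J rfl i)

lemma factorialOn_update_of_notMem (χ : Measure Z) (B : Fin q → Set Z) {J : Finset (Fin q)}
    {j : Fin q} (hj : j ∉ J) (A : Set Z) :
    factorialOn χ (Function.update B j A) J = factorialOn χ B J :=
  factorialOn_congr χ fun i hi => Function.update_of_ne (by rintro rfl; exact hj hi) _ _

/-- The recursion of `factorialRect` for index sets. It removes the last side, and sides are listed
in increasing order, so the new index has to exceed those of `J`. -/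
lemma factorialOn_insert_max (χ : Measure Z) (B : Fin q → Set Z) {J : Finset (Fin q)} {l : Fin q}
    (hl : ∀ j ∈ J, j < l) :
    factorialOn χ B (insert l J) = factorialOn χ B J * χ.real (B l)
      - ∑ j ∈ J, factorialOn χ (Function.update B j (B j ∩ B l)) J := by
  have hlJ : l ∉ J := fun h => lt_irrefl _ (hl l h)
  set e : Fin J.card → Fin q := ⇑(J.orderEmbOfFin rfl) with he
  have hmem : ∀ i, e i ∈ J := fun i => Finset.orderEmbOfFin_mem J rfl i
  have hinj : Function.Injective e := (J.orderEmbOfFin rfl).injective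
  have hmono : StrictMono (Fin.snoc e l : Fin (J.card + 1) → Fin q) := by
    intro a b hab
    induction b using Fin.lastCases with
    | last =>
      induction a using Fin.lastCases with
      | last => exact absurd hab (lt_irrefl _)
      | cast a => simpa using hl _ (hmem a)
    | cast b =>
      induction a using Fin.lastCases with
      | last => exact absurd hab (not_lt.2 (Fin.le_last _))
      | cast a =>
        simp only [Fin.snoc_castSucc]
        exact (J.orderEmbOfFin rfl).strictMono (by simpa using hab)
  rw [factorialOn_eq χ B (insert l J) (Finset.card_insert_of_notMem hlJ) (Fin.snoc e l) hmono
    (fun i => by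
      induction i using Fin.lastCases with
      | last => simp
      | cast a => simp [hmem a])]
  rw [factorialRect]
  have hinit : (Fin.init fun i => B ((Fin.snoc e l : Fin (J.card + 1) → Fin q) i))
      = fun i => B (e i) := by
    funext i
    simp [Fin.init]
  rw [hinit]
  simp only [Fin.snoc_last, Fin.snoc_castSucc]
  congr 1
  have himg : J = Finset.univ.image e := by rw [he, Finset.image_orderEmbOfFin_univ]
  conv_rhs => rw [show ∑ j ∈ J, factorialOn χ (Function.update B j (B j ∩ B l)) J
    = ∑ j ∈ Finset.univ.image e, factorialOn χ (Function.update B j (B j ∩ B l)) J by rw [← himg]]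
  rw [Finset.sum_image fun a _ b _ h => hinj h]
  refine Finset.sum_congr rfl fun j _ => ?_
  unfold factorialOn
  congr 1
  exact (Function.update_comp_eq_of_injective B hinj j (B (e j) ∩ B l)).symm

lemma real_add_dirac {χ : Measure Z} {A : Set Z} (hA : MeasurableSet A) (hχ : χ A ≠ ∞) (z : Z) :
    (χ + Measure.dirac z).real A = χ.real A + A.indicator 1 z := by
  rw [measureReal_add_apply hχ (by finiteness)]
  congr 1
  rw [measureReal_def, Measure.dirac_apply' z hA]
  by_cases h : z ∈ A <;> simp [h]

/-- Entries of a tuple are distinct points, so the additional point fills at most one coordinate.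
Inductively, the terms in which it would fill both `j` and the new index `l` arise twice, from the
product with the count on `B l` and from the subtracted diagonals, and cancel. Finiteness of the
values makes `χ.real` additive. -/
lemma factorialOn_add_dirac {χ : Measure Z} (z : Z) (J : Finset (Fin q)) :
    ∀ {B : Fin q → Set Z}, (∀ i, MeasurableSet (B i)) → (∀ i, χ (B i) ≠ ∞) →
    factorialOn (χ + Measure.dirac z) B J = factorialOn χ B J
      + ∑ i ∈ J, (B i).indicator 1 z * factorialOn χ B (J.erase i) := by
  induction J using Finset.induction_on_max with
  | empty => intro B _ _; simp
  | insert l J hl ih =>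
    intro B hB hχ
    have hlJ : l ∉ J := fun h => lt_irrefl _ (hl l h)
    have hup : ∀ j ∈ J, factorialOn (χ + Measure.dirac z) (Function.update B j (B j ∩ B l)) J
        = factorialOn χ (Function.update B j (B j ∩ B l)) J
          + ((B j).indicator 1 z * (B l).indicator 1 z * factorialOn χ B (J.erase j)
            + ∑ i ∈ J.erase j, (B i).indicator 1 z
              * factorialOn χ (Function.update B j (B j ∩ B l)) (J.erase i)) := by
      intro j hj
      rw [ih (B := Function.update B j (B j ∩ B l)) (fun i => by
          rcases eq_or_ne i j with rfl | h
          · simpa using (hB i).inter (hB l)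
          · simpa [h] using hB i) (fun i => by
          rcases eq_or_ne i j with rfl | h
          · simpa using ne_top_of_le_ne_top (hχ i) (measure_mono Set.inter_subset_left)
          · simpa [h] using hχ i), ← Finset.add_sum_erase J _ hj]
      congr 2
      · rw [Function.update_self, factorialOn_update_of_notMem χ B (Finset.notMem_erase j J),
          Set.inter_indicator_one, Pi.mul_apply]
      · refine Finset.sum_congr rfl fun i hi => ?_
        rw [Function.update_of_ne (Finset.ne_of_mem_erase hi)]
    have hsplit : ∑ i ∈ J, (B i).indicator (1 : Z → ℝ) z * factorialOn χ B ((insert l J).erase i)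
        = ∑ i ∈ J, (B i).indicator (1 : Z → ℝ) z * (factorialOn χ B (J.erase i) * χ.real (B l)
          - ∑ j ∈ J.erase i, factorialOn χ (Function.update B j (B j ∩ B l)) (J.erase i)) := by
      refine Finset.sum_congr rfl fun i hi => ?_
      rw [Finset.erase_insert_of_ne (hl i hi).ne',
        factorialOn_insert_max χ B fun j hj => hl j (Finset.mem_of_mem_erase hj)]
    have hswap : ∑ j ∈ J, ∑ i ∈ J.erase j, (B i).indicator (1 : Z → ℝ) z
          * factorialOn χ (Function.update B j (B j ∩ B l)) (J.erase i)
        = ∑ i ∈ J, ∑ j ∈ J.erase i, (B i).indicator (1 : Z → ℝ) z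
          * factorialOn χ (Function.update B j (B j ∩ B l)) (J.erase i) :=
      Finset.sum_comm' fun a b => by
        simp only [Finset.mem_erase]
        tauto
    rw [factorialOn_insert_max _ B hl, factorialOn_insert_max _ B hl, Finset.sum_congr rfl hup,
      Finset.sum_insert hlJ, Finset.erase_insert hlJ,
      hsplit, ih hB hχ, real_add_dirac (hB l) (hχ l)]
    simp only [Finset.sum_add_distrib, hswap, mul_sub, Finset.sum_sub_distrib, Finset.mul_sum,
      add_mul, mul_add, Finset.sum_mul]
    have h1 : ∑ i ∈ J, (B i).indicator (1 : Z → ℝ) z * factorialOn χ B (J.erase i)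
        * (B l).indicator 1 z
        = ∑ i ∈ J, (B i).indicator (1 : Z → ℝ) z * (B l).indicator 1 z
          * factorialOn χ B (J.erase i) :=
      Finset.sum_congr rfl fun i _ => by ring
    have h2 : ∑ i ∈ J, (B i).indicator (1 : Z → ℝ) z * factorialOn χ B (J.erase i) * χ.real (B l)
        = ∑ i ∈ J, (B i).indicator (1 : Z → ℝ) z * (factorialOn χ B (J.erase i) * χ.real (B l)) :=
      Finset.sum_congr rfl fun i _ => by ring
    rw [h1, h2]
    ring

/-- The compensated version of `factorialOn`. -/
noncomputable def compensatedOn (μ χ : Measure Z) (B : Fin q → Set Z) (I : Finset (Fin q)) : ℝ :=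
  ∑ J ∈ I.powerset, (-1 : ℝ) ^ (I.card - J.card) * factorialOn χ B J * ∏ j ∈ I \ J, μ.real (B j)

lemma compensatedOn_univ (χ : Measure Z) (B : Fin q → Set Z) :
    compensatedOn μ χ B Finset.univ = rectIntegral μ χ q B := by
  rw [compensatedOn, rectIntegral, Finset.powerset_univ]
  refine Finset.sum_congr rfl fun J _ => ?_
  rw [Finset.card_univ, Fintype.card_fin, factorialOn, Finset.compl_eq_univ_sdiff]

@[simp] lemma compensatedOn_empty (χ : Measure Z) (B : Fin q → Set Z) :
    compensatedOn μ χ B ∅ = 1 := by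
  simp [compensatedOn]

lemma compensatedOn_insert (χ : Measure Z) (B : Fin q → Set Z) {I : Finset (Fin q)} {l : Fin q}
    (hl : l ∉ I) : compensatedOn μ χ B (insert l I)
      = ∑ J ∈ I.powerset, (-1 : ℝ) ^ (I.card - J.card) * (∏ j ∈ I \ J, μ.real (B j))
        * (factorialOn χ B (insert l J) - μ.real (B l) * factorialOn χ B J) := by
  rw [compensatedOn, Finset.sum_powerset_insert hl, ← Finset.sum_add_distrib]
  refine Finset.sum_congr rfl fun J hJ => ?_
  have hJI := Finset.mem_powerset.1 hJ
  have hlJ : l ∉ J := fun h => hl (hJI h)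
  have hc := Finset.card_le_card hJI
  rw [Finset.card_insert_of_notMem hl, Finset.card_insert_of_notMem hlJ,
    Finset.insert_sdiff_of_notMem I hlJ, Finset.prod_insert (by simp [hl]),
    Finset.insert_sdiff_insert, Finset.sdiff_insert_of_notMem hl, Nat.add_sub_add_right,
    Nat.sub_add_comm hc, pow_succ]
  ring

/-- The add-one cost acts as a derivation on a product indexed by `I`. The pairs `i ∈ J ⊆ I` are
reindexed by `J.erase i ⊆ I.erase i`, which changes neither `I \ J` nor the sign. -/
lemma compensatedOn_add_dirac {χ : Measure Z} (z : Z) (I : Finset (Fin q)) {B : Fin q → Set Z}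
    (hB : ∀ i, MeasurableSet (B i)) (hχ : ∀ i, χ (B i) ≠ ∞) :
    compensatedOn μ (χ + Measure.dirac z) B I = compensatedOn μ χ B I
      + ∑ i ∈ I, (B i).indicator 1 z * compensatedOn μ χ B (I.erase i) := by
  simp only [compensatedOn, factorialOn_add_dirac z _ hB hχ, mul_add, add_mul,
    Finset.sum_add_distrib]
  congr 1
  simp only [Finset.mul_sum, Finset.sum_mul]
  rw [Finset.sum_comm' (t' := I) (s' := fun i => I.powerset.filter (i ∈ ·)) (fun J i => by
    simp only [Finset.mem_powerset, Finset.mem_filter]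
    exact ⟨fun h => ⟨⟨h.1, h.2⟩, h.1 h.2⟩, fun h => h.1⟩)]
  refine Finset.sum_congr rfl fun i hi => ?_
  refine Finset.sum_bij' (fun J _ => J.erase i) (fun J _ => insert i J) ?_ ?_ ?_ ?_ ?_
  · intro J hJ
    simp only [Finset.mem_powerset, Finset.mem_filter] at hJ ⊢
    exact Finset.erase_subset_erase i hJ.1
  · intro J hJ
    simp only [Finset.mem_powerset, Finset.mem_filter] at hJ ⊢
    exact ⟨Finset.insert_subset hi (hJ.trans (Finset.erase_subset _ _)), Finset.mem_insert_self _ _⟩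
  · intro J hJ
    simp only [Finset.mem_powerset, Finset.mem_filter] at hJ
    exact Finset.insert_erase hJ.2
  · intro J hJ
    simp only [Finset.mem_powerset] at hJ
    exact Finset.erase_insert fun h => Finset.notMem_erase i I (hJ h)
  · intro J hJ
    simp only [Finset.mem_powerset, Finset.mem_filter] at hJ
    have h1 : I.card - J.card = (I.erase i).card - (J.erase i).card := by
      rw [Finset.card_erase_of_mem hi, Finset.card_erase_of_mem hJ.2]
      have := Finset.card_pos.2 ⟨i, hJ.2⟩
      omega
    have h2 : I \ J = I.erase i \ J.erase i := by
      ext j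
      simp only [Finset.mem_sdiff, Finset.mem_erase]
      rcases eq_or_ne j i with rfl | hji
      · simp [hJ.2]
      · simp [hji]
    rw [h1, h2]
    ring

lemma sum_fun_succ {r : ℕ} (g : (Fin (r + 1) → Fin q) → ℝ) :
    ∑ ε, g ε = ∑ ε : Fin r → Fin q, ∑ i, g (Fin.cons i ε) := by
  rw [← (Fin.consEquiv fun _ => Fin q).sum_comp, Fintype.sum_prod_type, Finset.sum_comm]
  rfl

lemma injective_cons_and_mem_iff {r : ℕ} (I : Finset (Fin q)) (i : Fin q) (ε : Fin r → Fin q) :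
    (Function.Injective (Fin.cons i ε : Fin (r + 1) → Fin q) ∧
        ∀ j, (Fin.cons i ε : Fin (r + 1) → Fin q) j ∈ I)
      ↔ i ∈ I \ Finset.univ.image ε ∧ Function.Injective ε ∧ ∀ j, ε j ∈ I := by
  rw [Fin.cons_injective_iff, Fin.forall_fin_succ]
  simp only [Fin.cons_zero, Fin.cons_succ, Set.mem_range, Finset.mem_sdiff, Finset.mem_image,
    Finset.mem_univ, true_and]
  tauto

/-- The iterated add-one costs of compensated integrals of rectangles. -/
lemma iterDiff_compensatedOn (I : Finset (Fin q)) {B : Fin q → Set Z}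
    (hB : ∀ i, MeasurableSet (B i)) (r : ℕ) : ∀ (z : Fin r → Z) {χ : Measure Z},
    (∀ i, χ (B i) ≠ ∞) →
    iterDiff r z (fun χ => compensatedOn μ χ B I) χ
      = ∑ ε : Fin r → Fin q, if Function.Injective ε ∧ ∀ i, ε i ∈ I then
          (∏ i, (B (ε i)).indicator 1 (z i)) * compensatedOn μ χ B (I \ Finset.univ.image ε)
        else 0 := by
  induction r with
  | zero =>
    intro z χ hχ
    simp [Function.injective_of_subsingleton]
  | succ r ih =>
    intro z χ hχ
    have hχ' : ∀ i, (χ + Measure.dirac (z 0)) (B i) ≠ ∞ := fun i => by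
      rw [Measure.coe_add, Pi.add_apply]
      exact ENNReal.add_ne_top.2 ⟨hχ i, by finiteness⟩
    rw [iterDiff_succ, addOneCost, ih _ hχ', ih _ hχ, ← Finset.sum_sub_distrib, sum_fun_succ]
    refine Finset.sum_congr rfl fun ε _ => ?_
    simp only [injective_cons_and_mem_iff]
    by_cases hε : Function.Injective ε ∧ ∀ i, ε i ∈ I
    · rw [if_pos hε, if_pos hε, ← mul_sub, compensatedOn_add_dirac (z 0) _ hB hχ,
        add_sub_cancel_left, Finset.mul_sum]
      simp only [hε, implies_true, and_true]
      rw [Finset.sum_ite_mem, Finset.univ_inter]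
      refine Finset.sum_congr rfl fun i _ => ?_
      have h : I \ Finset.univ.image (Fin.cons i ε : Fin (r + 1) → Fin q)
          = (I \ Finset.univ.image ε).erase i := by
        ext j
        simp only [Finset.mem_sdiff, Finset.mem_image, Finset.mem_univ, true_and, not_exists,
          Finset.mem_erase, Fin.forall_fin_succ, Fin.cons_zero, Fin.cons_succ, ne_eq]
        tauto
      rw [h, Fin.prod_univ_succ]
      simp only [Fin.tail, Fin.cons_zero, Fin.cons_succ]
      ring
    · simp [hε]

end Factorial

end PoissonChaos

namespace PoissonChaos

variable {Z : Type*} [MeasurableSpace Z] {Λ : Measure (Measure Z)} {μ : Measure Z}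

/-! ### Functionals of polynomial growth -/

/-- `g(χ)` is bounded by a multiple of a power of `1 + χ(S)`. -/
structure PolyBounded (S : Set Z) (g : Measure Z → ℝ) : Prop where
  measurable : Measurable g
  bound : ∃ C : ℝ≥0∞, C ≠ ∞ ∧ ∃ n : ℕ, ∀ χ, ‖g χ‖ₑ ≤ C * (1 + χ S) ^ n

section PolyBounded

variable {S : Set Z}

lemma PolyBounded.const (c : ℝ) : PolyBounded S fun _ => c :=
  ⟨measurable_const, ‖c‖ₑ, by finiteness, 0, fun χ => by simp⟩

lemma PolyBounded.mul {g h : Measure Z → ℝ} (hg : PolyBounded S g) (hh : PolyBounded S h) :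
    PolyBounded S fun χ => g χ * h χ := by
  obtain ⟨C, hC, n, hn⟩ := hg.bound
  obtain ⟨D, hD, k, hk⟩ := hh.bound
  refine ⟨hg.measurable.mul hh.measurable, C * D, ENNReal.mul_ne_top hC hD, n + k, fun χ => ?_⟩
  calc ‖g χ * h χ‖ₑ = ‖g χ‖ₑ * ‖h χ‖ₑ := enorm_mul _ _
    _ ≤ (C * (1 + χ S) ^ n) * (D * (1 + χ S) ^ k) := mul_le_mul' (hn χ) (hk χ)
    _ = _ := by ring

lemma PolyBounded.add {g h : Measure Z → ℝ} (hg : PolyBounded S g) (hh : PolyBounded S h) :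
    PolyBounded S fun χ => g χ + h χ := by
  obtain ⟨C, hC, n, hn⟩ := hg.bound
  obtain ⟨D, hD, k, hk⟩ := hh.bound
  refine ⟨hg.measurable.add hh.measurable, C + D, ENNReal.add_ne_top.2 ⟨hC, hD⟩, n + k,
    fun χ => ?_⟩
  calc ‖g χ + h χ‖ₑ ≤ ‖g χ‖ₑ + ‖h χ‖ₑ := enorm_add_le _ _
    _ ≤ C * (1 + χ S) ^ (n + k) + D * (1 + χ S) ^ (n + k) := by
      refine add_le_add ((hn χ).trans ?_) ((hk χ).trans ?_)
      · gcongr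
        · exact le_self_add
        · omega
      · gcongr
        · exact le_self_add
        · omega
    _ = _ := by ring

lemma PolyBounded.sub {g h : Measure Z → ℝ} (hg : PolyBounded S g) (hh : PolyBounded S h) :
    PolyBounded S fun χ => g χ - h χ := by
  have := hg.add ((PolyBounded.const (-1)).mul hh)
  simpa [sub_eq_add_neg] using this

lemma PolyBounded.sum {ι : Type*} (s : Finset ι) {g : ι → Measure Z → ℝ}
    (hg : ∀ i ∈ s, PolyBounded S (g i)) : PolyBounded S fun χ => ∑ i ∈ s, g i χ := by
  classical
  induction s using Finset.induction_on with
  | empty => simpa using PolyBounded.const 0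
  | insert i s hi ih =>
    simp only [Finset.sum_insert hi]
    exact (hg i (Finset.mem_insert_self _ _)).add (ih fun j hj => hg j (Finset.mem_insert_of_mem hj))

lemma PolyBounded.real {B : Set Z} (hB : MeasurableSet B) (hBS : B ⊆ S) :
    PolyBounded S fun χ => χ.real B := by
  refine ⟨(Measure.measurable_coe hB).ennreal_toReal, 1, by simp, 1, fun χ => ?_⟩
  rw [measureReal_def, one_mul, pow_one, Real.enorm_eq_ofReal ENNReal.toReal_nonneg]
  calc ENNReal.ofReal (χ B).toReal ≤ χ B := ENNReal.ofReal_toReal_le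
    _ ≤ χ S := measure_mono hBS
    _ ≤ 1 + χ S := le_add_self

lemma PolyBounded.factorialRect (n : ℕ) : ∀ {B : Fin n → Set Z}, (∀ i, MeasurableSet (B i)) →
    (∀ i, B i ⊆ S) → PolyBounded S fun χ => factorialRect χ n B := by
  induction n with
  | zero => intro B _ _; exact PolyBounded.const 1
  | succ n ih =>
    intro B hB hBS
    refine PolyBounded.sub ((ih (fun i => hB _) fun i => hBS _).mul
      (PolyBounded.real (hB _) (hBS _))) (PolyBounded.sum _ fun j _ => ih (fun i => ?_) fun i => ?_)
    · rcases eq_or_ne i j with rfl | h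
      · simpa using (hB _).inter (hB _)
      · rw [Function.update_of_ne h]
        exact hB _
    · rcases eq_or_ne i j with rfl | h
      · simpa using Set.inter_subset_left.trans (hBS _)
      · rw [Function.update_of_ne h]
        exact hBS _

lemma PolyBounded.factorialOn {q : ℕ} {B : Fin q → Set Z} (hB : ∀ i, MeasurableSet (B i))
    (hBS : ∀ i, B i ⊆ S) (J : Finset (Fin q)) : PolyBounded S fun χ => factorialOn χ B J :=
  PolyBounded.factorialRect _ (fun _ => hB _) fun _ => hBS _

lemma PolyBounded.compensatedOn {q : ℕ} {B : Fin q → Set Z} (hB : ∀ i, MeasurableSet (B i))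
    (hBS : ∀ i, B i ⊆ S) (I : Finset (Fin q)) : PolyBounded S fun χ => compensatedOn μ χ B I :=
  PolyBounded.sum _ fun J _ =>
    ((PolyBounded.const _).mul (PolyBounded.factorialOn hB hBS J)).mul (PolyBounded.const _)

lemma HasWeightedMoments.mul {ψ g : Measure Z → ℝ} (hψ : HasWeightedMoments Λ S ψ)
    (hg : PolyBounded S g) : HasWeightedMoments Λ S fun χ => ψ χ * g χ := by
  obtain ⟨C, hC, n, hn⟩ := hg.bound
  intro k
  refine lt_of_le_of_lt ?_ (ENNReal.mul_lt_top hC.lt_top (hψ (n + k)))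
  rw [weightedMoment, weightedMoment, ← lintegral_const_mul' _ _ hC]
  refine lintegral_mono fun χ => ?_
  calc ‖ψ χ * g χ‖ₑ * (1 + χ S) ^ k ≤ (‖ψ χ‖ₑ * (C * (1 + χ S) ^ n)) * (1 + χ S) ^ k := by
        rw [enorm_mul]
        gcongr
        exact hn χ
    _ = _ := by ring

lemma IsMeckeLaw.hasWeightedMoments_const (hΛ : IsMeckeLaw Λ μ) (hS : MeasurableSet S)
    (hfin : μ S < ∞) (c : ℝ) : HasWeightedMoments Λ S fun _ => c :=
  hΛ.hasWeightedMoments hS hfin measurable_const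
    (have := hΛ.prob; memLp_const c)

lemma IsMeckeLaw.integrable_shift_mul (hΛ : IsMeckeLaw Λ μ) (hS : MeasurableSet S)
    (hfin : μ S < ∞) {ψ g : Measure Z → ℝ} (hψm : Measurable ψ) (hψ : HasWeightedMoments Λ S ψ)
    (hg : PolyBounded S g) :
    Integrable (fun p : Z × Measure Z => ψ (p.2 + Measure.dirac p.1) * g p.2)
      ((μ.restrict S).prod Λ) := by
  have := hΛ.prob
  have hm1 : Measurable fun p : Z × Measure Z => ψ (p.2 + Measure.dirac p.1) :=
    hψm.comp measurable_add_dirac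
  have hm : Measurable fun p : Z × Measure Z => ψ (p.2 + Measure.dirac p.1) * g p.2 :=
    hm1.mul (hg.measurable.comp measurable_snd)
  refine ⟨hm.aestronglyMeasurable, ?_⟩
  obtain ⟨C, hC, n, hn⟩ := hg.bound
  rw [HasFiniteIntegral, lintegral_prod _ hm.enorm.aemeasurable]
  refine lt_of_le_of_lt ?_ (ENNReal.mul_lt_top hC.lt_top
    (lt_of_le_of_lt (hΛ.lintegral_weightedMoment_shift_le hS hfin n hψm) (hψ (n + 1))))
  rw [← lintegral_const_mul' _ _ hC]
  refine lintegral_mono fun z => ?_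
  rw [weightedMoment, ← lintegral_const_mul' _ _ hC]
  refine lintegral_mono fun χ => ?_
  calc ‖ψ (χ + Measure.dirac z) * g χ‖ₑ ≤ ‖ψ (χ + Measure.dirac z)‖ₑ * (C * (1 + χ S) ^ n) := by
        rw [enorm_mul]
        gcongr
        exact hn χ
    _ = _ := by ring

lemma IsMeckeLaw.integrable_shift (hΛ : IsMeckeLaw Λ μ) (hS : MeasurableSet S)
    (hfin : μ S < ∞) {ψ g : Measure Z → ℝ} (hψm : Measurable ψ) (hψ : HasWeightedMoments Λ S ψ)
    (hg : PolyBounded S g) {A : Set Z} (hA : MeasurableSet A) :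
    Integrable (fun p : Z × Measure Z =>
      A.indicator 1 p.1 * (ψ (p.2 + Measure.dirac p.1) * g p.2)) ((μ.restrict S).prod Λ) := by
  refine ((hΛ.integrable_shift_mul hS hfin hψm hψ hg).indicator
    (measurable_fst hA)).congr (Filter.Eventually.of_forall fun p => ?_)
  by_cases h : p.1 ∈ A <;> simp [h]

/-- Mecke's formula for signed functionals. -/
lemma IsMeckeLaw.integral_mul_real (hΛ : IsMeckeLaw Λ μ)
    (hfin : μ S < ∞) {ψ : Measure Z → ℝ} (hψm : Measurable ψ) {A : Set Z} (hA : MeasurableSet A)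
    (hAS : A ⊆ S) :
    ∫ χ, ψ χ * χ.real A ∂Λ = ∫ p : Z × Measure Z,
      A.indicator 1 p.1 * ψ (p.2 + Measure.dirac p.1) ∂((μ.restrict S).prod Λ) := by
  have := hΛ.prob
  have hAfin : μ A < ∞ := (measure_mono hAS).trans_lt hfin
  have : IsFiniteMeasure (μ.restrict S) := ⟨by simpa using hfin⟩
  have hmeas : Λ.withDensity (fun χ => χ A)
      = ((μ.restrict A).prod Λ).map fun p => p.2 + Measure.dirac p.1 := by
    ext E hE
    have hm : Measurable fun p : Z × Measure Z => E.indicator (1 : Measure Z → ℝ≥0∞)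
        (p.2 + Measure.dirac p.1) := (measurable_one.indicator hE).comp measurable_add_dirac
    rw [withDensity_apply _ hE, ← lintegral_indicator_one hE,
      lintegral_map (measurable_one.indicator hE) measurable_add_dirac,
      lintegral_prod _ hm.aemeasurable, ← hΛ.mecke A hA hAfin _ (measurable_one.indicator hE),
      ← lintegral_indicator hE]
    refine lintegral_congr fun χ => ?_
    by_cases h : χ ∈ E <;> simp [h]
  have h1 : ∫ χ, ψ χ * χ.real A ∂Λ = ∫ χ, ψ χ ∂(Λ.withDensity fun χ => χ A) := by
    rw [integral_withDensity_eq_integral_toReal_smul (Measure.measurable_coe hA)]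
    · exact integral_congr_ae (Filter.Eventually.of_forall fun χ => by
        simp [measureReal_def, mul_comm])
    · filter_upwards [hΛ.natValued A hA hAfin] with χ ⟨n, hn⟩
      rw [hn]
      exact ENNReal.natCast_lt_top n
  have h2 : (μ.restrict A).prod Λ = ((μ.restrict S).prod Λ).restrict (A ×ˢ Set.univ) := by
    rw [← Measure.prod_restrict, Measure.restrict_univ, Measure.restrict_restrict hA,
      Set.inter_eq_left.2 hAS]
  rw [h1, hmeas, integral_map measurable_add_dirac.aemeasurable hψm.aestronglyMeasurable, h2,
    ← integral_indicator (hA.prod MeasurableSet.univ)]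
  refine integral_congr_ae (Filter.Eventually.of_forall fun p => ?_)
  by_cases h : p.1 ∈ A <;> simp [h]

lemma IsMeckeLaw.ae_ne_top (hΛ : IsMeckeLaw Λ μ) (hfin : μ S < ∞) {q : ℕ} {B : Fin q → Set Z}
    (hB : ∀ i, MeasurableSet (B i)) (hBS : ∀ i, B i ⊆ S) : ∀ᵐ χ ∂Λ, ∀ i, χ (B i) ≠ ∞ := by
  refine ae_all_iff.2 fun i => ?_
  filter_upwards [hΛ.natValued (B i) (hB i) ((measure_mono (hBS i)).trans_lt hfin)] with χ ⟨n, hn⟩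
  rw [hn]
  exact ENNReal.natCast_ne_top n

/-- The multivariate Mecke formula, one point at a time. -/
lemma IsMeckeLaw.integral_mul_factorialOn (hΛ : IsMeckeLaw Λ μ) (hS : MeasurableSet S)
    (hfin : μ S < ∞) {q : ℕ} (J : Finset (Fin q)) : ∀ {B : Fin q → Set Z},
    (∀ i, MeasurableSet (B i)) → (∀ i, B i ⊆ S) → ∀ {ψ : Measure Z → ℝ}, Measurable ψ →
    HasWeightedMoments Λ S ψ → ∀ l ∈ J,
    ∫ χ, ψ χ * factorialOn χ B J ∂Λ = ∫ p : Z × Measure Z, (B l).indicator 1 p.1 *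
      (ψ (p.2 + Measure.dirac p.1) * factorialOn p.2 B (J.erase l)) ∂((μ.restrict S).prod Λ) := by
  have := hΛ.prob
  induction J using Finset.induction_on_max with
  | empty => intro B _ _ ψ _ _ l hl; simp at hl
  | insert m J hm ih =>
    intro B hB hBS ψ hψm hψ l hl
    have hmJ : m ∉ J := fun h => lt_irrefl _ (hm m h)
    set U : Fin q → Fin q → Set Z := fun j => Function.update B j (B j ∩ B m) with hU
    have hUm : ∀ j i, MeasurableSet (U j i) := fun j i => by
      rcases eq_or_ne i j with rfl | h
      · simpa [hU] using (hB _).inter (hB _)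
      · simpa [hU, h] using hB _
    have hUS : ∀ j i, U j i ⊆ S := fun j i => by
      rcases eq_or_ne i j with rfl | h
      · simpa [hU] using Set.inter_subset_left.trans (hBS _)
      · simpa [hU, h] using hBS _
    have hFm : ∀ {C : Fin q → Set Z} {K : Finset (Fin q)}, (∀ i, MeasurableSet (C i)) →
        (∀ i, C i ⊆ S) → PolyBounded S fun χ => factorialOn χ C K :=
      fun h1 h2 => PolyBounded.factorialOn h1 h2 _
    have hreal := PolyBounded.real (hB m) (hBS m)
    have hint : ∀ {g : Measure Z → ℝ}, PolyBounded S g → Integrable (fun χ => ψ χ * g χ) Λ :=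
      fun hg => (hψ.mul hg).integrable (hψm.mul hg.measurable)
    have hL : ∫ χ, ψ χ * factorialOn χ B (insert m J) ∂Λ
        = ∫ χ, ψ χ * (factorialOn χ B J * χ.real (B m)) ∂Λ
          - ∑ j ∈ J, ∫ χ, ψ χ * factorialOn χ (U j) J ∂Λ := by
      rw [← integral_finsetSum _ fun j _ => hint (hFm (hUm j) (hUS j)), ← integral_sub
        (hint ((hFm hB hBS).mul hreal)) (integrable_finsetSum _ fun j _ =>
          hint (hFm (hUm j) (hUS j)))]
      refine integral_congr_ae (Filter.Eventually.of_forall fun χ => ?_)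
      simp only [factorialOn_insert_max χ B hm, mul_sub, Finset.mul_sum, hU]
    rw [hL]
    -- For the last index, the Mecke formula is applied to the count on `B l`; expanding the
    -- factorial measure of `χ + δ_z` produces exactly the diagonal terms to be subtracted. For an
    -- earlier index, the induction hypothesis is applied with `ψ` multiplied by the count on `B m`;
    -- the added point changes that count by an indicator, which accounts for the diagonal term `j =
    -- l`.
    rcases Finset.mem_insert.1 hl with rfl | hlJ
    · rw [Finset.erase_insert hmJ]
      have h1 : ∫ χ, ψ χ * (factorialOn χ B J * χ.real (B l)) ∂Λ
          = ∫ p : Z × Measure Z, (B l).indicator 1 p.1 * (ψ (p.2 + Measure.dirac p.1)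
            * factorialOn (p.2 + Measure.dirac p.1) B J) ∂((μ.restrict S).prod Λ) := by
        rw [← hΛ.integral_mul_real hfin (ψ := fun χ => ψ χ * factorialOn χ B J)
          (hψm.mul (hFm hB hBS).measurable) (hB l) (hBS l)]
        simp only [mul_assoc]
      have h2 : ∀ j ∈ J, ∫ χ, ψ χ * factorialOn χ (U j) J ∂Λ
          = ∫ p : Z × Measure Z, (B l ∩ B j).indicator 1 p.1 * (ψ (p.2 + Measure.dirac p.1)
            * factorialOn p.2 B (J.erase j)) ∂((μ.restrict S).prod Λ) := by
        intro j hj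
        rw [ih (hUm j) (hUS j) hψm hψ j hj]
        simp only [hU, Function.update_self, Set.inter_comm (B l),
          factorialOn_update_of_notMem _ B (Finset.notMem_erase j J)]
      have h3 : ∫ p : Z × Measure Z, (B l).indicator 1 p.1 * (ψ (p.2 + Measure.dirac p.1)
            * factorialOn (p.2 + Measure.dirac p.1) B J) ∂((μ.restrict S).prod Λ)
          = ∫ p : Z × Measure Z, ((B l).indicator 1 p.1 * (ψ (p.2 + Measure.dirac p.1)
            * factorialOn p.2 B J)
            + ∑ j ∈ J, (B l ∩ B j).indicator 1 p.1 * (ψ (p.2 + Measure.dirac p.1)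
              * factorialOn p.2 B (J.erase j))) ∂((μ.restrict S).prod Λ) := by
        refine integral_congr_ae ?_
        have hae : ∀ᵐ p : Z × Measure Z ∂((μ.restrict S).prod Λ), ∀ i, p.2 (B i) ≠ ∞ :=
          Measure.quasiMeasurePreserving_snd.ae (hΛ.ae_ne_top hfin hB hBS)
        filter_upwards [hae] with p hp
        simp only [factorialOn_add_dirac p.1 J hB hp, Set.inter_indicator_one, Pi.mul_apply,
          mul_add, Finset.mul_sum]
        congr 1
        exact Finset.sum_congr rfl fun j _ => by ring
      rw [h1, h3, Finset.sum_congr rfl h2, integral_add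
        (hΛ.integrable_shift hS hfin hψm hψ (hFm hB hBS) (hB l))
        (integrable_finsetSum _ fun j _ => hΛ.integrable_shift hS hfin hψm hψ (hFm hB hBS)
          ((hB l).inter (hB j))), integral_finsetSum _ fun j _ =>
          hΛ.integrable_shift hS hfin hψm hψ (hFm hB hBS) ((hB l).inter (hB j))]
      ring
    · have h1 : ∫ χ, ψ χ * (factorialOn χ B J * χ.real (B m)) ∂Λ
          = ∫ p : Z × Measure Z, (B l).indicator 1 p.1 * (ψ (p.2 + Measure.dirac p.1)
            * ((p.2 + Measure.dirac p.1).real (B m) * factorialOn p.2 B (J.erase l)))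
            ∂((μ.restrict S).prod Λ) := by
        have h := ih hB hBS (ψ := fun χ => ψ χ * χ.real (B m)) (hψm.mul hreal.measurable)
          (hψ.mul hreal) l hlJ
        simp only [mul_assoc] at h
        rw [← h]
        exact integral_congr_ae (Filter.Eventually.of_forall fun χ => by
          simp only [mul_comm (χ.real (B m))])
      have h3 : ∫ p : Z × Measure Z, (B l).indicator 1 p.1 * (ψ (p.2 + Measure.dirac p.1)
            * ((p.2 + Measure.dirac p.1).real (B m) * factorialOn p.2 B (J.erase l)))
            ∂((μ.restrict S).prod Λ)
          = ∫ p : Z × Measure Z, ((B l).indicator 1 p.1 * (ψ (p.2 + Measure.dirac p.1)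
            * factorialOn p.2 B ((insert m J).erase l))
            + ∑ j ∈ J, (U j l).indicator 1 p.1 * (ψ (p.2 + Measure.dirac p.1)
              * factorialOn p.2 (U j) (J.erase l))) ∂((μ.restrict S).prod Λ) := by
        refine integral_congr_ae ?_
        have hae : ∀ᵐ p : Z × Measure Z ∂((μ.restrict S).prod Λ), ∀ i, p.2 (B i) ≠ ∞ :=
          Measure.quasiMeasurePreserving_snd.ae (hΛ.ae_ne_top hfin hB hBS)
        filter_upwards [hae] with p hp
        rw [Finset.erase_insert_of_ne (hm l hlJ).ne',
          factorialOn_insert_max p.2 B fun j hj => hm j (Finset.mem_of_mem_erase hj),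
          ← Finset.add_sum_erase J _ hlJ, real_add_dirac (hB m) (hp m)]
        have h5 : ∑ j ∈ J.erase l, (U j l).indicator 1 p.1 * (ψ (p.2 + Measure.dirac p.1)
              * factorialOn p.2 (U j) (J.erase l))
            = ∑ j ∈ J.erase l, (B l).indicator 1 p.1 * (ψ (p.2 + Measure.dirac p.1)
              * factorialOn p.2 (U j) (J.erase l)) := by
          refine Finset.sum_congr rfl fun j hj => ?_
          simp only [hU, Function.update_of_ne (Finset.ne_of_mem_erase hj).symm]
        rw [h5, ← Finset.mul_sum, ← Finset.mul_sum]
        simp only [hU, Function.update_self, Set.inter_indicator_one, Pi.mul_apply,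
          factorialOn_update_of_notMem _ B (Finset.notMem_erase l J)]
        ring
      rw [h1, h3, Finset.sum_congr rfl fun j _ => ih (hUm j) (hUS j) hψm hψ l hlJ, integral_add
        (hΛ.integrable_shift hS hfin hψm hψ (hFm hB hBS) (hB l))
        (integrable_finsetSum _ fun j _ => hΛ.integrable_shift hS hfin hψm hψ
          (hFm (hUm j) (hUS j)) (hUm j l)), integral_finsetSum _ fun j _ =>
          hΛ.integrable_shift hS hfin hψm hψ (hFm (hUm j) (hUS j)) (hUm j l)]
      ring

/-- Integration by parts for compensated integrals of rectangles, one point at a time. -/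
lemma IsMeckeLaw.integral_mul_compensatedOn_insert (hΛ : IsMeckeLaw Λ μ) (hS : MeasurableSet S)
    (hfin : μ S < ∞) {q : ℕ} {B : Fin q → Set Z} (hB : ∀ i, MeasurableSet (B i))
    (hBS : ∀ i, B i ⊆ S) {φ : Measure Z → ℝ} (hφm : Measurable φ) (hφ : HasWeightedMoments Λ S φ)
    {I : Finset (Fin q)} {l : Fin q} (hl : l ∉ I) :
    ∫ χ, φ χ * compensatedOn μ χ B (insert l I) ∂Λ
      = ∫ p : Z × Measure Z, (B l).indicator 1 p.1 *
        (addOneCost p.1 φ p.2 * compensatedOn μ p.2 B I) ∂((μ.restrict S).prod Λ) := by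
  have := hΛ.prob
  have hfinI : IsFiniteMeasure (μ.restrict S) := ⟨by simpa using hfin⟩
  have hF : ∀ K : Finset (Fin q), PolyBounded S fun χ => factorialOn χ B K :=
    fun K => PolyBounded.factorialOn hB hBS K
  have hint : ∀ {g : Measure Z → ℝ}, PolyBounded S g → Integrable (fun χ => φ χ * g χ) Λ :=
    fun hg => (hφ.mul hg).integrable (hφm.mul hg.measurable)
  have hind : Integrable ((B l).indicator (1 : Z → ℝ)) (μ.restrict S) :=
    (integrable_const (1 : ℝ)).indicator (hB l)
  have hfix : ∀ J, Integrable (fun p : Z × Measure Z => (B l).indicator (1 : Z → ℝ) p.1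
      * (φ p.2 * factorialOn p.2 B J)) ((μ.restrict S).prod Λ) :=
    fun J => hind.mul_prod (hint (hF J))
  -- The compensator `μ.real (B l)` yields the same integral over the added point, but with `φ`
  -- evaluated without it; the difference is the add-one cost of `φ`.
  have hterm : ∀ J ∈ I.powerset, ∫ χ, φ χ * (factorialOn χ B (insert l J)
        - μ.real (B l) * factorialOn χ B J) ∂Λ
      = ∫ p : Z × Measure Z, (B l).indicator 1 p.1 *
        (addOneCost p.1 φ p.2 * factorialOn p.2 B J) ∂((μ.restrict S).prod Λ) := by
    intro J hJ
    have hlJ : l ∉ J := fun h => hl (Finset.mem_powerset.1 hJ h)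
    have h1 := hΛ.integral_mul_factorialOn hS hfin (insert l J) hB hBS hφm hφ l
      (Finset.mem_insert_self _ _)
    rw [Finset.erase_insert hlJ] at h1
    have h2 : μ.real (B l) * ∫ χ, φ χ * factorialOn χ B J ∂Λ
        = ∫ p : Z × Measure Z, (B l).indicator 1 p.1 * (φ p.2 * factorialOn p.2 B J)
          ∂((μ.restrict S).prod Λ) := by
      rw [integral_prod_mul (f := (B l).indicator (1 : Z → ℝ))
        (g := fun χ => φ χ * factorialOn χ B J), integral_indicator_one (hB l),
        measureReal_restrict_apply (hB l), Set.inter_eq_left.2 (hBS l)]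
    have h3 : ∫ χ, φ χ * (factorialOn χ B (insert l J) - μ.real (B l) * factorialOn χ B J) ∂Λ
        = ∫ χ, φ χ * factorialOn χ B (insert l J) ∂Λ
          - μ.real (B l) * ∫ χ, φ χ * factorialOn χ B J ∂Λ := by
      rw [← integral_const_mul, ← integral_sub (hint (hF _)) ((hint (hF J)).const_mul _)]
      exact integral_congr_ae (Filter.Eventually.of_forall fun χ => by
        simp only; ring)
    rw [h3, h2, h1, ← integral_sub (hΛ.integrable_shift hS hfin hφm hφ (hF J) (hB l)) (hfix J)]
    exact integral_congr_ae (Filter.Eventually.of_forall fun p => by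
      simp only [addOneCost]; ring)
  have hJint : ∀ J, Integrable (fun p : Z × Measure Z => (B l).indicator (1 : Z → ℝ) p.1
      * (addOneCost p.1 φ p.2 * factorialOn p.2 B J)) ((μ.restrict S).prod Λ) := fun J =>
    ((hΛ.integrable_shift hS hfin hφm hφ (hF J) (hB l)).sub (hfix J)).congr
      (Filter.Eventually.of_forall fun p => by simp only [addOneCost, Pi.sub_apply]; ring)
  have hl1 : ∫ χ, φ χ * compensatedOn μ χ B (insert l I) ∂Λ
      = ∑ J ∈ I.powerset, (-1 : ℝ) ^ (I.card - J.card) * (∏ j ∈ I \ J, μ.real (B j))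
        * ∫ χ, φ χ * (factorialOn χ B (insert l J) - μ.real (B l) * factorialOn χ B J) ∂Λ := by
    simp only [← integral_const_mul]
    rw [← integral_finsetSum]
    · refine integral_congr_ae (Filter.Eventually.of_forall fun χ => ?_)
      simp only [compensatedOn_insert χ B hl, Finset.mul_sum]
      exact Finset.sum_congr rfl fun J _ => by ring
    · intro J _
      exact (hint ((hF _).sub ((PolyBounded.const _).mul (hF J)))).const_mul _
  rw [hl1, Finset.sum_congr rfl fun J hJ => by rw [hterm J hJ]]
  simp only [← integral_const_mul]
  rw [← integral_finsetSum _ fun J _ => (hJint J).const_mul _]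
  refine integral_congr_ae (Filter.Eventually.of_forall fun p => ?_)
  simp only [compensatedOn, Finset.mul_sum]
  exact Finset.sum_congr rfl fun J _ => by ring

end PolyBounded

end PoissonChaos

namespace PoissonChaos

variable {Z : Type*} [MeasurableSpace Z] {Λ : Measure (Measure Z)} {μ : Measure Z}

/-! ### Multiple integrals of rectangles -/

section Rectangle

variable {S : Set Z} {q : ℕ} {B : Fin q → Set Z}

lemma enorm_meanDiff_le (r : ℕ) (φ : Measure Z → ℝ) (z : Fin r → Z) :
    ‖meanDiff Λ r φ z‖ₑ ≤ ∫⁻ χ, ‖iterDiff r z φ χ‖ₑ ∂Λ :=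
  enorm_integral_le_lintegral_enorm _

lemma meanDiff_cons (r : ℕ) (φ : Measure Z → ℝ) (w : Z) (z : Fin r → Z) :
    meanDiff Λ (r + 1) φ (Fin.cons w z) = meanDiff Λ r (addOneCost w φ) z := by
  simp only [meanDiff, iterDiff_cons, iterDiff_addOneCost]

lemma meanDiff_perm (r : ℕ) (φ : Measure Z → ℝ) (z : Fin r → Z) (s : Equiv.Perm (Fin r)) :
    meanDiff Λ r φ (fun i => z (s i)) = meanDiff Λ r φ z := by
  simp only [meanDiff, iterDiff_perm]

lemma IsMeckeLaw.integrable_meanDiff [SigmaFinite μ] (hΛ : IsMeckeLaw Λ μ) (hS : MeasurableSet S)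
    (hfin : μ S < ∞) {φ : Measure Z → ℝ} (hφm : Measurable φ) (hφ : HasWeightedMoments Λ S φ)
    (r : ℕ) : Integrable (meanDiff Λ r φ) (powMeasure (μ.restrict S) r) := by
  have := hΛ.prob
  refine ⟨(measurable_meanDiff r hφm).aestronglyMeasurable, ?_⟩
  refine lt_of_le_of_lt ?_ (lt_of_le_of_lt (hΛ.lintegral_weightedMoment_iterDiff_le hS hfin r 0 hφm)
    (ENNReal.mul_lt_top (by finiteness) (hφ _)))
  refine lintegral_mono fun z => (enorm_meanDiff_le r φ z).trans_eq ?_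
  simp [weightedMoment]

lemma IsMeckeLaw.integrableOn_meanDiff [SigmaFinite μ] (hΛ : IsMeckeLaw Λ μ)
    (hS : MeasurableSet S) (hfin : μ S < ∞) {φ : Measure Z → ℝ} (hφm : Measurable φ)
    (hφ : HasWeightedMoments Λ S φ) {r : ℕ} {C : Fin r → Set Z} (hCS : ∀ i, C i ⊆ S) :
    IntegrableOn (meanDiff Λ r φ) (Set.univ.pi C) (powMeasure μ r) := by
  have h := hΛ.integrable_meanDiff hS hfin hφm hφ r
  rw [powMeasure, ← Measure.restrict_pi_pi] at h
  exact IntegrableOn.mono_set h (Set.pi_mono fun i _ => hCS i)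

/-- Iteration of the one-point formula along the enumeration `e` of the sides. The induction runs
over all functionals with weighted moments, a class that almost every add-one cost preserves. -/
lemma IsMeckeLaw.integral_mul_compensatedOn [SigmaFinite μ] (hΛ : IsMeckeLaw Λ μ)
    (hS : MeasurableSet S) (hfin : μ S < ∞) (hB : ∀ i, MeasurableSet (B i)) (hBS : ∀ i, B i ⊆ S)
    (r : ℕ) : ∀ {e : Fin r → Fin q}, Function.Injective e → ∀ {φ : Measure Z → ℝ}, Measurable φ →
    HasWeightedMoments Λ S φ →
    ∫ χ, φ χ * compensatedOn μ χ B (Finset.univ.image e) ∂Λ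
      = ∫ z in Set.univ.pi (fun i => B (e i)), meanDiff Λ r φ z ∂(powMeasure μ r) := by
  have := hΛ.prob
  have hfinI : IsFiniteMeasure (μ.restrict S) := ⟨by simpa using hfin⟩
  induction r with
  | zero =>
    intro e _ φ _ _
    have h1 : Set.univ.pi (fun i : Fin 0 => B (e i)) = Set.univ :=
      Set.eq_univ_of_forall fun z i => i.elim0
    rw [h1, Measure.restrict_univ, powMeasure, Measure.pi_of_empty, integral_dirac]
    simp [meanDiff]
  | succ r ih =>
    intro e he φ hφm hφ
    have hetail : Function.Injective (Fin.tail e) := fun a b h => Fin.succ_injective _ (he h)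
    have himg : Finset.univ.image e = insert (e 0) (Finset.univ.image (Fin.tail e)) := by
      ext j
      simp only [Finset.mem_image, Finset.mem_univ, true_and, Finset.mem_insert, Fin.exists_fin_succ,
        Fin.tail, eq_comm]
    have hnot : e 0 ∉ Finset.univ.image (Fin.tail e) := by
      simp only [Finset.mem_image, Finset.mem_univ, true_and, not_exists, Fin.tail]
      exact fun i h => Fin.succ_ne_zero i (he h)
    have hX : PolyBounded S fun χ => compensatedOn μ χ B (Finset.univ.image (Fin.tail e)) :=
      PolyBounded.compensatedOn hB hBS _
    have hint : Integrable (fun p : Z × Measure Z => (B (e 0)).indicator (1 : Z → ℝ) p.1 *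
        (addOneCost p.1 φ p.2 * compensatedOn μ p.2 B (Finset.univ.image (Fin.tail e))))
        ((μ.restrict S).prod Λ) := by
      have h1 := hΛ.integrable_shift hS hfin hφm hφ hX (hB (e 0))
      have h2 : Integrable (fun p : Z × Measure Z => (B (e 0)).indicator (1 : Z → ℝ) p.1
          * (φ p.2 * compensatedOn μ p.2 B (Finset.univ.image (Fin.tail e))))
          ((μ.restrict S).prod Λ) :=
        Integrable.mul_prod (f := (B (e 0)).indicator (1 : Z → ℝ))
          (g := fun χ => φ χ * compensatedOn μ χ B (Finset.univ.image (Fin.tail e)))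
          ((integrable_const (1 : ℝ)).indicator (hB _))
          ((hφ.mul hX).integrable (hφm.mul hX.measurable))
      exact (h1.sub h2).congr
        (Filter.Eventually.of_forall fun p => by simp only [addOneCost, Pi.sub_apply]; ring)
    have hpre : (fun p : Z × (Fin r → Z) => (Fin.cons p.1 p.2 : Fin (r + 1) → Z)) ⁻¹'
        (Set.univ.pi fun i => B (e i)) = B (e 0) ×ˢ Set.univ.pi fun i => B (Fin.tail e i) := by
      ext p
      simp only [Set.mem_preimage, Set.mem_pi, Set.mem_univ, true_implies, Fin.forall_fin_succ,
        Fin.cons_zero, Fin.cons_succ, Set.mem_prod, Fin.tail]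
    have hmp := measurePreserving_cons μ r
    have hR : ∫ z in Set.univ.pi (fun i => B (e i)), meanDiff Λ (r + 1) φ z ∂(powMeasure μ (r + 1))
        = ∫ w in B (e 0), ∫ z in Set.univ.pi (fun i => B (Fin.tail e i)),
          meanDiff Λ r (addOneCost w φ) z ∂(powMeasure μ r) ∂μ := by
      have hI := hΛ.integrableOn_meanDiff hS hfin hφm hφ (r := r + 1) (C := fun i => B (e i))
        fun i => hBS _
      rw [← hmp.map_eq] at hI ⊢
      have hmeas := MeasurableSet.univ_pi fun i => hB (e i)
      rw [IntegrableOn, Measure.restrict_map hmp.measurable hmeas] at hI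
      have hI' := hI.comp_measurable hmp.measurable
      rw [hpre] at hI'
      rw [setIntegral_map hmeas (measurable_meanDiff _ hφm).aestronglyMeasurable
        hmp.measurable.aemeasurable, hpre]
      refine (setIntegral_prod _ hI').trans ?_
      simp only [Function.comp_apply, meanDiff_cons]
    rw [himg, hΛ.integral_mul_compensatedOn_insert hS hfin hB hBS hφm hφ hnot, hR,
      integral_prod _ hint]
    have h5 : ∀ᵐ z ∂(μ.restrict S), ∫ χ, (B (e 0)).indicator (1 : Z → ℝ) z *
        (addOneCost z φ χ * compensatedOn μ χ B (Finset.univ.image (Fin.tail e))) ∂Λ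
        = (B (e 0)).indicator (fun w => ∫ z in Set.univ.pi (fun i => B (Fin.tail e i)),
          meanDiff Λ r (addOneCost w φ) z ∂(powMeasure μ r)) z := by
      filter_upwards [hΛ.hasWeightedMoments_addOneCost hS hfin hφm hφ] with z hz
      rw [integral_const_mul, ih hetail (measurable_addOneCost hφm z) hz]
      by_cases h : z ∈ B (e 0) <;> simp [h]
    rw [integral_congr_ae h5, integral_indicator (hB _), Measure.restrict_restrict (hB _),
      Set.inter_eq_left.2 (hBS _)]

/-- Integration by parts against the constant `1`, whose add-one cost is zero. -/
lemma IsMeckeLaw.integral_compensatedOn (hΛ : IsMeckeLaw Λ μ) (hS : MeasurableSet S)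
    (hfin : μ S < ∞) (hB : ∀ i, MeasurableSet (B i)) (hBS : ∀ i, B i ⊆ S) {I : Finset (Fin q)}
    (hI : I.Nonempty) : ∫ χ, compensatedOn μ χ B I ∂Λ = 0 := by
  obtain ⟨l, hl⟩ := hI
  have h := hΛ.integral_mul_compensatedOn_insert hS hfin hB hBS (φ := fun _ => 1) measurable_const
    (hΛ.hasWeightedMoments_const hS hfin 1) (Finset.notMem_erase l I)
  rw [Finset.insert_erase hl] at h
  simpa [addOneCost] using h

lemma measurableSet_iUnion_sides (hB : ∀ i, MeasurableSet (B i)) : MeasurableSet (⋃ i, B i) :=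
  MeasurableSet.iUnion hB

lemma measure_iUnion_sides_lt_top (hfin : ∀ i, μ (B i) < ∞) : μ (⋃ i, B i) < ∞ :=
  (measure_iUnion_fintype_le _ _).trans_lt (ENNReal.sum_lt_top.2 fun i _ => hfin i)

lemma PolyBounded.rectIntegral (hB : ∀ i, MeasurableSet (B i)) :
    PolyBounded (⋃ i, B i) fun χ => rectIntegral μ χ q B := by
  simp only [← compensatedOn_univ]
  exact PolyBounded.compensatedOn hB (Set.subset_iUnion B) _

lemma IsMeckeLaw.integrable_of_polyBounded (hΛ : IsMeckeLaw Λ μ) (hS : MeasurableSet S)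
    (hfin : μ S < ∞) {g : Measure Z → ℝ} (hg : PolyBounded S g) : Integrable g Λ := by
  have h := (hΛ.hasWeightedMoments_const hS hfin 1).mul hg
  simp only [one_mul] at h
  exact h.integrable hg.measurable

lemma IsMeckeLaw.memLp_of_polyBounded (hΛ : IsMeckeLaw Λ μ) (hS : MeasurableSet S)
    (hfin : μ S < ∞) {g : Measure Z → ℝ} (hg : PolyBounded S g) : MemLp g 2 Λ := by
  rw [memLp_two_iff_integrable_sq hg.measurable.aestronglyMeasurable]
  simpa [sq] using hΛ.integrable_of_polyBounded hS hfin (hg.mul hg)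

/-- Integration by parts for multiple integrals of rectangles. -/
lemma IsMeckeLaw.integral_mul_rectIntegral [SigmaFinite μ] (hΛ : IsMeckeLaw Λ μ)
    (hB : ∀ i, MeasurableSet (B i)) (hfin : ∀ i, μ (B i) < ∞) {φ : Measure Z → ℝ}
    (hφm : Measurable φ) (hφ : MemLp φ 2 Λ) :
    ∫ χ, φ χ * rectIntegral μ χ q B ∂Λ
      = ∫ z in Set.univ.pi B, meanDiff Λ q φ z ∂(powMeasure μ q) := by
  have hS := measurableSet_iUnion_sides hB
  have hSf := measure_iUnion_sides_lt_top hfin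
  have h := hΛ.integral_mul_compensatedOn hS hSf hB (Set.subset_iUnion B) q
    (e := id) Function.injective_id hφm (hΛ.hasWeightedMoments hS hSf hφm hφ)
  simpa [compensatedOn_univ] using h

lemma IsMeckeLaw.iterDiff_rectIntegral (hΛ : IsMeckeLaw Λ μ) (hB : ∀ i, MeasurableSet (B i))
    (hfin : ∀ i, μ (B i) < ∞) (r : ℕ) : ∀ᵐ χ ∂Λ, ∀ z : Fin r → Z,
    iterDiff r z (fun χ => rectIntegral μ χ q B) χ
      = ∑ ε : Fin r → Fin q, if Function.Injective ε then
          (∏ i, (B (ε i)).indicator 1 (z i)) * compensatedOn μ χ B (Finset.univ \ Finset.univ.image ε)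
        else 0 := by
  filter_upwards [hΛ.ae_ne_top (measure_iUnion_sides_lt_top hfin) hB (Set.subset_iUnion B)]
    with χ hχ z
  simp only [← compensatedOn_univ]
  rw [iterDiff_compensatedOn Finset.univ hB r z hχ]
  simp

lemma IsMeckeLaw.iterDiff_rectIntegral_of_lt (hΛ : IsMeckeLaw Λ μ) (hB : ∀ i, MeasurableSet (B i))
    (hfin : ∀ i, μ (B i) < ∞) {r : ℕ} (hr : q < r) (z : Fin r → Z) :
    ∀ᵐ χ ∂Λ, iterDiff r z (fun χ => rectIntegral μ χ q B) χ = 0 := by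
  filter_upwards [hΛ.iterDiff_rectIntegral hB hfin r] with χ hχ
  rw [hχ z]
  refine Finset.sum_eq_zero fun ε _ => if_neg fun h => ?_
  have := Fintype.card_le_of_injective ε h
  simp only [Fintype.card_fin] at this
  omega

lemma IsMeckeLaw.vanishAfter_rectIntegral [SigmaFinite μ] (hΛ : IsMeckeLaw Λ μ)
    (hB : ∀ i, MeasurableSet (B i)) (hfin : ∀ i, μ (B i) < ∞) :
    VanishAfter Λ μ (q + 1) fun χ => rectIntegral μ χ q B := by
  have := hΛ.prob
  rw [vanishAfter_iff _ (PolyBounded.rectIntegral hB).measurable]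
  exact Filter.Eventually.of_forall fun z =>
    hΛ.iterDiff_rectIntegral_of_lt hB hfin (Nat.lt_succ_self q) z

lemma IsMeckeLaw.meanDiff_rectIntegral (hΛ : IsMeckeLaw Λ μ)
    (hB : ∀ i, MeasurableSet (B i)) (hfin : ∀ i, μ (B i) < ∞) (r : ℕ) (z : Fin r → Z) :
    meanDiff Λ r (fun χ => rectIntegral μ χ q B) z
      = ∑ ε : Fin r → Fin q, if Function.Injective ε then
          (∏ i, (B (ε i)).indicator 1 (z i))
            * ∫ χ, compensatedOn μ χ B (Finset.univ \ Finset.univ.image ε) ∂Λ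
        else 0 := by
  have hS := measurableSet_iUnion_sides hB
  have hSf := measure_iUnion_sides_lt_top hfin
  have hX : ∀ I, Integrable (fun χ => compensatedOn μ χ B I) Λ := fun I =>
    hΛ.integrable_of_polyBounded hS hSf (PolyBounded.compensatedOn hB (Set.subset_iUnion B) I)
  have h1 : ∀ᵐ χ ∂Λ, iterDiff r z (fun χ => rectIntegral μ χ q B) χ
      = ∑ ε : Fin r → Fin q, if Function.Injective ε then
          (∏ i, (B (ε i)).indicator 1 (z i)) * compensatedOn μ χ B (Finset.univ \ Finset.univ.image ε)
        else 0 := by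
    filter_upwards [hΛ.iterDiff_rectIntegral hB hfin r] with χ hχ using hχ z
  rw [meanDiff, integral_congr_ae h1, integral_finsetSum]
  · refine Finset.sum_congr rfl fun ε _ => ?_
    split_ifs
    · rw [integral_const_mul]
    · simp
  · intro ε _
    split_ifs
    · exact (hX _).const_mul _
    · exact integrable_zero _ _ _

/-- For `r > q` there is no injection from `Fin r` to `Fin q`; for `r < q` a compensated integral
over the remaining sides is left, and its mean is zero. -/
lemma IsMeckeLaw.meanDiff_rectIntegral_of_ne (hΛ : IsMeckeLaw Λ μ)
    (hB : ∀ i, MeasurableSet (B i)) (hfin : ∀ i, μ (B i) < ∞) {r : ℕ} (hr : r ≠ q)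
    (z : Fin r → Z) : meanDiff Λ r (fun χ => rectIntegral μ χ q B) z = 0 := by
  rw [hΛ.meanDiff_rectIntegral hB hfin r z]
  refine Finset.sum_eq_zero fun ε _ => ?_
  split_ifs with hε
  · have hcard := Finset.card_image_of_injective Finset.univ hε
    rw [hΛ.integral_compensatedOn (measurableSet_iUnion_sides hB)
      (measure_iUnion_sides_lt_top hfin) hB (Set.subset_iUnion B), mul_zero]
    rw [Finset.sdiff_nonempty]
    intro h
    have h2 := Finset.card_le_card h
    have h3 := Fintype.card_le_of_injective ε hε
    simp only [Finset.card_univ, Fintype.card_fin] at h2 h3 hcard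
    omega
  · rfl

/-- Injections of `Fin q` into itself are permutations and leave no side over. The inverse of `ε`
appears since the indicator of `B (ε i)` is evaluated at `z i`. -/
lemma IsMeckeLaw.meanDiff_rectIntegral_self (hΛ : IsMeckeLaw Λ μ)
    (hB : ∀ i, MeasurableSet (B i)) (hfin : ∀ i, μ (B i) < ∞) (z : Fin q → Z) :
    meanDiff Λ q (fun χ => rectIntegral μ χ q B) z
      = ∑ s : Equiv.Perm (Fin q), (Set.univ.pi B).indicator (fun _ => (1 : ℝ)) fun i => z (s i) := by
  have := hΛ.prob
  rw [hΛ.meanDiff_rectIntegral hB hfin q z, ← Finset.sum_filter]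
  have hind : ∀ w : Fin q → Z, (Set.univ.pi B).indicator (fun _ => (1 : ℝ)) w
      = ∏ i, (B i).indicator 1 (w i) := by
    intro w
    by_cases h : w ∈ Set.univ.pi B
    · rw [Set.indicator_of_mem h]
      symm
      exact Finset.prod_eq_one fun i _ => by simp [h i (Set.mem_univ i)]
    · rw [Set.indicator_of_notMem h]
      simp only [Set.mem_pi, Set.mem_univ, true_implies, not_forall] at h
      obtain ⟨i, hi⟩ := h
      exact (Finset.prod_eq_zero (Finset.mem_univ i) (by simp [hi])).symm
  refine Finset.sum_bij' (fun ε hε => (Equiv.ofBijective ε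
    (Finite.injective_iff_bijective.1 (Finset.mem_filter.1 hε).2)).symm) (fun s _ => ⇑s.symm)
    (fun _ _ => Finset.mem_univ _)
    (fun s _ => Finset.mem_filter.2 ⟨Finset.mem_univ _, s.symm.injective⟩)
    (fun ε hε => by simp) (fun s _ => by ext; simp) (fun ε hε => ?_)
  have hε' := Finite.injective_iff_bijective.1 (Finset.mem_filter.1 hε).2
  set s := Equiv.ofBijective ε hε' with hs
  have h1 : Finset.univ \ Finset.univ.image ε = ∅ := by
    rw [Finset.image_univ_of_surjective hε'.2, Finset.sdiff_self]
  rw [h1, hind]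
  simp only [compensatedOn_empty, integral_const, probReal_univ, smul_eq_mul, mul_one]
  rw [← Equiv.prod_comp s fun i => (B i).indicator (1 : Z → ℝ) (z (s.symm i))]
  refine Finset.prod_congr rfl fun i _ => ?_
  rw [Equiv.symm_apply_apply]
  rfl

end Rectangle

end PoissonChaos

namespace PoissonChaos

variable {Z : Type*} [MeasurableSpace Z] {Λ : Measure (Measure Z)} {μ : Measure Z}

/-! ### Functions with vanishing integrals over rectangles -/

lemma ae_eq_zero_of_setIntegral_pi_of_finite {ν : Measure Z} [IsFiniteMeasure ν] {q : ℕ}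
    {k : (Fin q → Z) → ℝ} (hk : Integrable k (powMeasure ν q))
    (h : ∀ B : Fin q → Set Z, (∀ i, MeasurableSet (B i)) →
      ∫ z in Set.univ.pi B, k z ∂(powMeasure ν q) = 0) : k =ᵐ[powMeasure ν q] 0 := by
  refine hk.ae_eq_zero_of_forall_setIntegral_eq_zero fun E hE _ => ?_
  have huniv : ∫ z, k z ∂(powMeasure ν q) = 0 := by
    have := h (fun _ => Set.univ) fun _ => MeasurableSet.univ
    rwa [Set.pi_univ, Measure.restrict_univ] at this
  refine MeasurableSpace.induction_on_inter
    (C := fun E _ => ∫ z in E, k z ∂(powMeasure ν q) = 0) generateFrom_pi.symm isPiSystem_pi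
    (by simp) ?_ ?_ ?_ E hE
  · rintro _ ⟨B, hB, rfl⟩
    exact h B fun i => hB i (Set.mem_univ i)
  · intro t ht h0
    have := integral_add_compl ht hk
    rw [h0, huniv, zero_add] at this
    exact this
  · intro f hd hm h0
    rw [integral_iUnion hm hd hk.integrableOn]
    simp [h0]

lemma ae_eq_zero_of_setIntegral_pi [SigmaFinite μ] {q : ℕ} {k : (Fin q → Z) → ℝ}
    (hk : ∀ B : Fin q → Set Z, (∀ i, MeasurableSet (B i)) → (∀ i, μ (B i) < ∞) →
      IntegrableOn k (Set.univ.pi B) (powMeasure μ q))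
    (h : ∀ B : Fin q → Set Z, (∀ i, MeasurableSet (B i)) → (∀ i, μ (B i) < ∞) →
      ∫ z in Set.univ.pi B, k z ∂(powMeasure μ q) = 0) : k =ᵐ[powMeasure μ q] 0 := by
  refine ae_powMeasure_of_restrict q fun n => ?_
  have hS := measurableSet_spanningSets μ n
  have hfin := measure_spanningSets_lt_top μ n
  have : IsFiniteMeasure (μ.restrict (spanningSets μ n)) := ⟨by simpa using hfin⟩
  refine ae_eq_zero_of_setIntegral_pi_of_finite ?_ fun B hB => ?_
  · have := hk (fun _ => spanningSets μ n) (fun _ => hS) fun _ => hfin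
    rwa [IntegrableOn, Measure.restrict_pi_pi] at this
  · rw [powMeasure, ← Measure.restrict_pi_pi, Measure.restrict_restrict (MeasurableSet.univ_pi hB),
      ← Set.pi_inter_distrib]
    exact h _ (fun i => (hB i).inter hS) fun i =>
      (measure_mono Set.inter_subset_right).trans_lt hfin

/-! ### Linearity of the expected iterated add-one costs -/

section Linear

variable [SigmaFinite μ]

lemma IsMeckeLaw.iterDiff_congr (hΛ : IsMeckeLaw Λ μ) {f g : Measure Z → ℝ} (hf : Measurable f)
    (hg : Measurable g) (h : f =ᵐ[Λ] g) (r : ℕ) :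
    ∀ᵐ z ∂(powMeasure μ r), iterDiff r z f =ᵐ[Λ] iterDiff r z g := by
  have := hΛ.prob
  have h0 : VanishAfter Λ μ 0 (f - g) := by
    filter_upwards [h] with χ hχ
    simp [hχ]
  filter_upwards [(vanishAfter_iff r (hf.sub hg)).1 (h0.mono hΛ (Nat.zero_le r))] with z hz
  filter_upwards [hz] with χ hχ
  rw [iterDiff_sub, Pi.sub_apply, sub_eq_zero] at hχ
  exact hχ

lemma IsMeckeLaw.meanDiff_congr (hΛ : IsMeckeLaw Λ μ) {f g : Measure Z → ℝ} (hf : Measurable f)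
    (hg : Measurable g) (h : f =ᵐ[Λ] g) (r : ℕ) :
    meanDiff Λ r f =ᵐ[powMeasure μ r] meanDiff Λ r g := by
  filter_upwards [hΛ.iterDiff_congr hf hg h r] with z hz
  exact integral_congr_ae hz

lemma IsMeckeLaw.meanDiff_add (hΛ : IsMeckeLaw Λ μ) {f g : Measure Z → ℝ} (hf : Measurable f)
    (hg : Measurable g) (hf2 : MemLp f 2 Λ) (hg2 : MemLp g 2 Λ) (r : ℕ) :
    meanDiff Λ r (f + g) =ᵐ[powMeasure μ r] meanDiff Λ r f + meanDiff Λ r g := by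
  filter_upwards [hΛ.ae_integrable_iterDiff hf hf2 r, hΛ.ae_integrable_iterDiff hg hg2 r]
    with z h1 h2
  simp only [meanDiff, iterDiff_add, Pi.add_apply]
  exact integral_add h1 h2

lemma meanDiff_smul (c : ℝ) (f : Measure Z → ℝ) (r : ℕ) :
    meanDiff Λ r (c • f) = c • meanDiff Λ r f := by
  funext z
  simp only [meanDiff, iterDiff_smul, Pi.smul_apply, smul_eq_mul, integral_const_mul]

lemma IsMeckeLaw.meanDiff_sub (hΛ : IsMeckeLaw Λ μ) {f g : Measure Z → ℝ} (hf : Measurable f)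
    (hg : Measurable g) (hf2 : MemLp f 2 Λ) (hg2 : MemLp g 2 Λ) (r : ℕ) :
    meanDiff Λ r (f - g) =ᵐ[powMeasure μ r] meanDiff Λ r f - meanDiff Λ r g := by
  filter_upwards [hΛ.ae_integrable_iterDiff hf hf2 r, hΛ.ae_integrable_iterDiff hg hg2 r]
    with z h1 h2
  simp only [meanDiff, iterDiff_sub, Pi.sub_apply]
  exact integral_sub h1 h2

lemma IsMeckeLaw.meanDiff_sum (hΛ : IsMeckeLaw Λ μ) {ι : Type*} (s : Finset ι)
    {f : ι → Measure Z → ℝ} (hf : ∀ i ∈ s, Measurable (f i)) (hf2 : ∀ i ∈ s, MemLp (f i) 2 Λ)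
    (r : ℕ) : meanDiff Λ r (∑ i ∈ s, f i) =ᵐ[powMeasure μ r] ∑ i ∈ s, meanDiff Λ r (f i) := by
  have h : ∀ᵐ z ∂(powMeasure μ r), ∀ i ∈ s, Integrable (iterDiff r z (f i)) Λ :=
    (ae_ball_iff s.countable_toSet).2 fun i hi => hΛ.ae_integrable_iterDiff (hf i hi) (hf2 i hi) r
  filter_upwards [h] with z hz
  simp only [meanDiff, iterDiff_sum, Finset.sum_apply]
  exact integral_finsetSum _ hz

lemma Lp.measurable_coe {p : ℝ≥0∞} (g : Lp ℝ p Λ) : Measurable g := (Lp.stronglyMeasurable g).measurable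

/-- `lintegral_iterDiff_le` for the difference of two elements of `L²`. -/
lemma IsMeckeLaw.lintegral_iterDiff_sub_le (hΛ : IsMeckeLaw Λ μ) {S : Set Z}
    (hS : MeasurableSet S) (hfin : μ S < ∞) (g g' : Lp ℝ 2 Λ) (r : ℕ) :
    ∫⁻ z, ∫⁻ χ, ‖iterDiff r z g χ - iterDiff r z g' χ‖ₑ ∂Λ ∂(powMeasure (μ.restrict S) r)
      ≤ (1 + μ S) ^ r * weightNorm Λ S r * edist g g' := by
  refine le_trans ?_ ((hΛ.lintegral_iterDiff_le hS hfin
    ((Lp.measurable_coe g).sub (Lp.measurable_coe g')) r).trans_eq ?_)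
  · simp only [iterDiff_sub, Pi.sub_apply, le_refl]
  · rw [Lp.edist_def, mul_assoc, mul_comm (eLpNorm _ _ _)]

lemma ae_restrict_powMeasure {r : ℕ} {S : Set Z} {p : (Fin r → Z) → Prop}
    (h : ∀ᵐ z ∂(powMeasure μ r), p z) : ∀ᵐ z ∂(powMeasure (μ.restrict S) r), p z := by
  rw [powMeasure, ← Measure.restrict_pi_pi]
  exact ae_restrict_of_ae h

lemma IsMeckeLaw.lintegral_meanDiff_sub_le (hΛ : IsMeckeLaw Λ μ) {S : Set Z}
    (hS : MeasurableSet S) (hfin : μ S < ∞) (g g' : Lp ℝ 2 Λ) (r : ℕ) :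
    ∫⁻ z, ‖meanDiff Λ r g z - meanDiff Λ r g' z‖ₑ ∂(powMeasure (μ.restrict S) r)
      ≤ (1 + μ S) ^ r * weightNorm Λ S r * edist g g' := by
  refine le_trans (lintegral_mono_ae ?_) (hΛ.lintegral_iterDiff_sub_le hS hfin g g' r)
  refine ae_restrict_powMeasure ?_
  filter_upwards [hΛ.ae_integrable_iterDiff (Lp.measurable_coe g) (Lp.memLp g) r,
    hΛ.ae_integrable_iterDiff (Lp.measurable_coe g') (Lp.memLp g') r] with z h1 h2
  rw [meanDiff, meanDiff, ← integral_sub h1 h2]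
  exact enorm_integral_le_lintegral_enorm _

end Linear

/-! ### Multiple integrals -/

/-- A Lipschitz estimate with a finite constant is enough, even where `N` is infinite. It turns
local `L¹` bounds into closedness in `L²`. -/
lemma isClosed_setOf_eq_zero {E : Type*} [PseudoEMetricSpace E] {N : E → ℝ≥0∞} {C : ℝ≥0∞}
    (hC : C ≠ ∞) (hN : ∀ x y, N x ≤ N y + C * edist x y) : IsClosed {x | N x = 0} := by
  refine isClosed_of_closure_subset fun x hx => ?_
  obtain ⟨y, hy, hlim⟩ := mem_closure_iff_seq_limit.1 hx
  have h1 : Filter.Tendsto (fun n => C * edist x (y n)) Filter.atTop (nhds (C * 0)) := by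
    refine ENNReal.Tendsto.const_mul ?_ (Or.inr hC)
    simpa only [edist_comm x] using tendsto_iff_edist_tendsto_0.1 hlim
  rw [mul_zero] at h1
  have h2 : N x ≤ 0 := ge_of_tendsto' h1 fun n => by
    have := hN x (y n)
    rwa [show N (y n) = 0 from hy n, zero_add] at this
  exact le_antisymm h2 bot_le

lemma ae_powMeasure_iff_restrict [SigmaFinite μ] (r : ℕ) {p : (Fin r → Z) → Prop} :
    (∀ᵐ z ∂(powMeasure μ r), p z)
      ↔ ∀ n, ∀ᵐ z ∂(powMeasure (μ.restrict (spanningSets μ n)) r), p z :=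
  ⟨fun h _ => ae_restrict_powMeasure h, ae_powMeasure_of_restrict r⟩

/-- The sum of `h` over all permutations of its arguments. -/
noncomputable def symmSum {q : ℕ} (h : (Fin q → Z) → ℝ) (z : Fin q → Z) : ℝ :=
  ∑ s : Equiv.Perm (Fin q), h fun i => z (s i)

lemma measurable_symmSum {q : ℕ} {h : (Fin q → Z) → ℝ} (hh : Measurable h) :
    Measurable (symmSum h) :=
  Finset.measurable_fun_sum _ fun s _ => hh.comp (measurable_pi_lambda _ fun i =>
    measurable_pi_apply (s i))

lemma symmSum_congr [SigmaFinite μ] {q : ℕ} {h h' : (Fin q → Z) → ℝ}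
    (hh : h =ᵐ[powMeasure μ q] h') : symmSum h =ᵐ[powMeasure μ q] symmSum h' := by
  have : ∀ᵐ z ∂(powMeasure μ q), ∀ s : Equiv.Perm (Fin q),
      h (fun i => z (s i)) = h' fun i => z (s i) :=
    ae_all_iff.2 fun s => (measurePreserving_comp_perm μ q s).quasiMeasurePreserving.ae hh
  filter_upwards [this] with z hz
  exact Finset.sum_congr rfl fun s _ => hz s

lemma symmSum_of_symm [SigmaFinite μ] {q : ℕ} {h : (Fin q → Z) → ℝ}
    (hh : ∀ s : Equiv.Perm (Fin q), (fun z => h fun i => z (s i)) =ᵐ[powMeasure μ q] h) :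
    symmSum h =ᵐ[powMeasure μ q] fun z => q.factorial * h z := by
  filter_upwards [ae_all_iff.2 hh] with z hz
  simp [symmSum, hz, Fintype.card_perm]

lemma eLpNorm_symmSum_le [SigmaFinite μ] {q : ℕ} {p : ℝ≥0∞} (hp : 1 ≤ p) {h : (Fin q → Z) → ℝ}
    (hh : AEStronglyMeasurable h (powMeasure μ q)) :
    eLpNorm (symmSum h) p (powMeasure μ q) ≤ q.factorial * eLpNorm h p (powMeasure μ q) := by
  have hs : symmSum h = ∑ s : Equiv.Perm (Fin q), h ∘ fun z : Fin q → Z => fun i => z (s i) := by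
    funext z
    simp [symmSum]
  rw [hs]
  refine (eLpNorm_sum_le (fun s _ => hh.comp_measurePreserving
    (measurePreserving_comp_perm μ q s)) hp).trans_eq ?_
  simp [eLpNorm_comp_measurePreserving hh (measurePreserving_comp_perm μ q _), Fintype.card_perm]

/-- The properties that characterize the multiple integral `g` of the kernel `h`. -/
structure IsIntegral (Λ : Measure (Measure Z)) (μ : Measure Z) [SigmaFinite μ] (q : ℕ)
    (h : (Fin q → Z) → ℝ) (g : Measure Z → ℝ) : Prop where
  vanish : VanishAfter Λ μ (q + 1) g
  meanDiff_of_ne : ∀ r, r ≠ q → meanDiff Λ r g =ᵐ[powMeasure μ r] 0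
  meanDiff_self : meanDiff Λ q g =ᵐ[powMeasure μ q] symmSum h

section Integral

variable [SigmaFinite μ] {q : ℕ}

lemma IsIntegral.congr (hΛ : IsMeckeLaw Λ μ) {h h' : (Fin q → Z) → ℝ} {g g' : Measure Z → ℝ}
    (hg : Measurable g) (hg' : Measurable g') (hgg : g =ᵐ[Λ] g') (hhh : h =ᵐ[powMeasure μ q] h')
    (H : IsIntegral Λ μ q h g) : IsIntegral Λ μ q h' g' where
  vanish := H.vanish.congr hΛ hgg
  meanDiff_of_ne r hr := (hΛ.meanDiff_congr hg hg' hgg r).symm.trans (H.meanDiff_of_ne r hr)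
  meanDiff_self := ((hΛ.meanDiff_congr hg hg' hgg q).symm.trans H.meanDiff_self).trans
    (symmSum_congr hhh)

lemma IsMeckeLaw.isIntegral_rectIntegral (hΛ : IsMeckeLaw Λ μ) {B : Fin q → Set Z}
    (hB : ∀ i, MeasurableSet (B i)) (hfin : ∀ i, μ (B i) < ∞) :
    IsIntegral Λ μ q ((Set.univ.pi B).indicator fun _ => (1 : ℝ))
      (fun χ => rectIntegral μ χ q B) where
  vanish := hΛ.vanishAfter_rectIntegral hB hfin
  meanDiff_of_ne _ hr := Filter.Eventually.of_forall fun z =>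
    hΛ.meanDiff_rectIntegral_of_ne hB hfin hr z
  meanDiff_self := Filter.Eventually.of_forall fun z => hΛ.meanDiff_rectIntegral_self hB hfin z

/-- The pairs of a kernel and its multiple integral, in terms of the law of the point process. -/
noncomputable def integralPairs (hΛ : IsMeckeLaw Λ μ) (q : ℕ) :
    Submodule ℝ (Lp ℝ 2 (powMeasure μ q) × Lp ℝ 2 Λ) where
  carrier := {x | IsIntegral Λ μ q x.1 x.2}
  zero_mem' := by
    have h0 : VanishAfter Λ μ 0 (0 : Measure Z → ℝ) := Filter.Eventually.of_forall fun _ => rfl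
    have : IsIntegral Λ μ q 0 (0 : Measure Z → ℝ) :=
      ⟨h0.mono hΛ (Nat.zero_le _), fun r _ => Filter.Eventually.of_forall fun z => by
        simpa using congrFun (meanDiff_smul (Λ := Λ) 0 0 r) z,
        Filter.Eventually.of_forall fun z => by
          simpa [symmSum] using congrFun (meanDiff_smul (Λ := Λ) 0 0 q) z⟩
    exact this.congr hΛ measurable_zero (Lp.measurable_coe _) (Lp.coeFn_zero _ _ _).symm
      (Lp.coeFn_zero _ _ _).symm
  add_mem' := by
    rintro ⟨h, g⟩ ⟨h', g'⟩ (H : IsIntegral Λ μ q h g) (H' : IsIntegral Λ μ q h' g')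
    have hm := Lp.measurable_coe g
    have hm' := Lp.measurable_coe g'
    have : IsIntegral Λ μ q (⇑h + ⇑h') (⇑g + ⇑g') := by
      refine ⟨H.vanish.add H'.vanish, fun r hr => ?_, ?_⟩
      · filter_upwards [hΛ.meanDiff_add hm hm' (Lp.memLp g) (Lp.memLp g') r,
          H.meanDiff_of_ne r hr, H'.meanDiff_of_ne r hr] with z h1 h2 h3
        simp [h1, h2, h3]
      · filter_upwards [hΛ.meanDiff_add hm hm' (Lp.memLp g) (Lp.memLp g') q,
          H.meanDiff_self, H'.meanDiff_self] with z h1 h2 h3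
        simp [h1, h2, h3, symmSum, Finset.sum_add_distrib]
    exact this.congr hΛ (hm.add hm') (Lp.measurable_coe _) (Lp.coeFn_add _ _).symm
      (Lp.coeFn_add _ _).symm
  smul_mem' := by
    rintro c ⟨h, g⟩ (H : IsIntegral Λ μ q h g)
    have hm := Lp.measurable_coe g
    have : IsIntegral Λ μ q (c • ⇑h) (c • ⇑g) := by
      refine ⟨H.vanish.smul c, fun r hr => ?_, ?_⟩
      · filter_upwards [H.meanDiff_of_ne r hr] with z h2
        simp [meanDiff_smul, h2]
      · filter_upwards [H.meanDiff_self] with z h2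
        simp [meanDiff_smul, h2, symmSum, Finset.mul_sum]
    exact this.congr hΛ (hm.const_smul c) (Lp.measurable_coe _) (Lp.coeFn_smul _ _).symm
      (Lp.coeFn_smul _ _).symm

lemma mem_integralPairs {hΛ : IsMeckeLaw Λ μ} {x : Lp ℝ 2 (powMeasure μ q) × Lp ℝ 2 Λ} :
    x ∈ integralPairs hΛ q ↔ IsIntegral Λ μ q x.1 x.2 := Iff.rfl

/-- Vanishing of the differences means that their `L¹`-norms over each spanning set are zero, and
these norms are Lipschitz for the `L²`-distance by `lintegral_iterDiff_sub_le`. -/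
lemma isClosed_setOf_vanishAfter (hΛ : IsMeckeLaw Λ μ) (r : ℕ) :
    IsClosed {g : Lp ℝ 2 Λ | VanishAfter Λ μ r g} := by
  have := hΛ.prob
  have h1 : {g : Lp ℝ 2 Λ | VanishAfter Λ μ r g} = ⋂ n, {g : Lp ℝ 2 Λ |
      ∫⁻ z, ∫⁻ χ, ‖iterDiff r z g χ‖ₑ ∂Λ ∂(powMeasure (μ.restrict (spanningSets μ n)) r) = 0} := by
    ext g
    simp only [Set.mem_ofPred_eq, Set.mem_iInter]
    rw [vanishAfter_iff r (Lp.measurable_coe g), ae_powMeasure_iff_restrict]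
    refine forall_congr' fun n => ?_
    have hm := measurable_iterDiff_uncurry (Lp.measurable_coe g) r
    rw [lintegral_eq_zero_iff (Measurable.lintegral_prod_right' (f := fun p : (Fin r → Z) ×
      Measure Z => ‖iterDiff r p.1 g p.2‖ₑ) hm.enorm)]
    refine Filter.eventually_congr (Filter.Eventually.of_forall fun z => ?_)
    rw [Pi.zero_apply, lintegral_eq_zero_iff (measurable_iterDiff (Lp.measurable_coe g) r z).enorm]
    refine Filter.eventually_congr (Filter.Eventually.of_forall fun χ => ?_)
    simp
  rw [h1]
  refine isClosed_iInter fun n => ?_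
  have hS := measurableSet_spanningSets μ n
  have hfin := measure_spanningSets_lt_top μ n
  refine isClosed_setOf_eq_zero (C := (1 + μ (spanningSets μ n)) ^ r
    * weightNorm Λ (spanningSets μ n) r) (ENNReal.mul_ne_top (by finiteness)
      (hΛ.weightNorm_ne_top hS hfin r)) fun g g' => ?_
  refine le_trans ?_ (add_le_add le_rfl (hΛ.lintegral_iterDiff_sub_le hS hfin g g' r))
  have hm' := measurable_iterDiff_uncurry (Lp.measurable_coe g') r
  rw [← lintegral_add_left (Measurable.lintegral_prod_right' (f := fun p : (Fin r → Z) ×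
      Measure Z => ‖iterDiff r p.1 g' p.2‖ₑ) hm'.enorm)]
  refine lintegral_mono fun z => ?_
  rw [← lintegral_add_left (measurable_iterDiff (Lp.measurable_coe g') r z).enorm]
  refine lintegral_mono fun χ => ?_
  calc ‖iterDiff r z g χ‖ₑ = ‖iterDiff r z g' χ + (iterDiff r z g χ - iterDiff r z g' χ)‖ₑ := by
        rw [add_sub_cancel]
    _ ≤ _ := enorm_add_le _ _

lemma lintegral_symmSum_sub_le {S : Set Z} (hfin : μ S < ∞)
    (h h' : Lp ℝ 2 (powMeasure μ q)) :
    ∫⁻ z, ‖symmSum h z - symmSum h' z‖ₑ ∂(powMeasure (μ.restrict S) q)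
      ≤ q.factorial * (powMeasure (μ.restrict S) q Set.univ) ^ (1 / 2 : ℝ) * edist h h' := by
  have : IsFiniteMeasure (μ.restrict S) := ⟨by simpa using hfin⟩
  have h1 : (fun z => symmSum h z - symmSum h' z) = symmSum (⇑h - ⇑h') := by
    funext z
    simp [symmSum, Finset.sum_sub_distrib]
  have hle : powMeasure (μ.restrict S) q ≤ powMeasure μ q := by
    rw [powMeasure, ← Measure.restrict_pi_pi]
    exact Measure.restrict_le_self
  have hm : AEStronglyMeasurable (⇑h - ⇑h') (powMeasure μ q) :=
    (Lp.aestronglyMeasurable h).sub (Lp.aestronglyMeasurable h')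
  have hm' := hm.mono_measure hle
  rw [Lp.edist_def, ← eLpNorm_one_eq_lintegral_enorm, h1]
  refine (eLpNorm_symmSum_le le_rfl hm').trans ?_
  rw [mul_assoc]
  gcongr
  refine (eLpNorm_le_eLpNorm_mul_rpow_measure_univ (q := 2) (by norm_num) hm').trans ?_
  rw [mul_comm]
  norm_num
  gcongr

lemma isClosed_integralPairs (hΛ : IsMeckeLaw Λ μ) (q : ℕ) :
    IsClosed (integralPairs hΛ q : Set (Lp ℝ 2 (powMeasure μ q) × Lp ℝ 2 Λ)) := by
  have := hΛ.prob
  have h1 : (integralPairs hΛ q : Set (Lp ℝ 2 (powMeasure μ q) × Lp ℝ 2 Λ))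
      = {x | VanishAfter Λ μ (q + 1) x.2} ∩
        ((⋂ r, ⋂ _ : r ≠ q, ⋂ n, {x | ∫⁻ z, ‖meanDiff Λ r x.2 z‖ₑ
          ∂(powMeasure (μ.restrict (spanningSets μ n)) r) = 0}) ∩
        ⋂ n, {x | ∫⁻ z, ‖meanDiff Λ q x.2 z - symmSum x.1 z‖ₑ
          ∂(powMeasure (μ.restrict (spanningSets μ n)) q) = 0}) := by
    ext ⟨h, g⟩
    have hm := fun r => measurable_meanDiff (Λ := Λ) r (Lp.measurable_coe g)
    have hm' : Measurable fun z => meanDiff Λ q g z - symmSum h z :=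
      (hm q).sub (measurable_symmSum (Lp.stronglyMeasurable h).measurable)
    have e1 : ∀ r, meanDiff Λ r g =ᵐ[powMeasure μ r] 0 ↔ ∀ n, ∫⁻ z, ‖meanDiff Λ r g z‖ₑ
          ∂(powMeasure (μ.restrict (spanningSets μ n)) r) = 0 := fun r => by
      rw [Filter.EventuallyEq, ae_powMeasure_iff_restrict]
      refine forall_congr' fun n => ?_
      rw [lintegral_eq_zero_iff (hm r).enorm]
      refine Filter.eventually_congr (Filter.Eventually.of_forall fun z => ?_)
      simp
    have e2 : meanDiff Λ q g =ᵐ[powMeasure μ q] symmSum h ↔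
        ∀ n, ∫⁻ z, ‖meanDiff Λ q g z - symmSum h z‖ₑ
          ∂(powMeasure (μ.restrict (spanningSets μ n)) q) = 0 := by
      rw [Filter.EventuallyEq, ae_powMeasure_iff_restrict]
      refine forall_congr' fun n => ?_
      rw [lintegral_eq_zero_iff hm'.enorm]
      refine Filter.eventually_congr (Filter.Eventually.of_forall fun z => ?_)
      simp [sub_eq_zero]
    simp only [SetLike.mem_coe, mem_integralPairs, Set.mem_inter_iff, Set.mem_ofPred_eq,
      Set.mem_iInter, ← e1, ← e2]
    exact ⟨fun H => ⟨H.1, H.2, H.3⟩, fun H => ⟨H.1, H.2.1, H.2.2⟩⟩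
  rw [h1]
  refine ((isClosed_setOf_vanishAfter hΛ (q + 1)).preimage continuous_snd).inter
    (IsClosed.inter ?_ ?_)
  · refine isClosed_iInter fun r => isClosed_iInter fun _ => isClosed_iInter fun n => ?_
    have hS := measurableSet_spanningSets μ n
    have hfin := measure_spanningSets_lt_top μ n
    refine (isClosed_setOf_eq_zero (N := fun g : Lp ℝ 2 Λ => ∫⁻ z, ‖meanDiff Λ r g z‖ₑ
          ∂(powMeasure (μ.restrict (spanningSets μ n)) r)) (C := (1 + μ (spanningSets μ n)) ^ r
      * weightNorm Λ (spanningSets μ n) r) (ENNReal.mul_ne_top (by finiteness)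
        (hΛ.weightNorm_ne_top hS hfin r)) fun g g' => ?_).preimage continuous_snd
    refine le_trans ?_ (add_le_add le_rfl (hΛ.lintegral_meanDiff_sub_le hS hfin g g' r))
    rw [← lintegral_add_left (measurable_meanDiff r (Lp.measurable_coe g')).enorm]
    refine lintegral_mono fun z => ?_
    calc ‖meanDiff Λ r g z‖ₑ = ‖meanDiff Λ r g' z + (meanDiff Λ r g z - meanDiff Λ r g' z)‖ₑ := by
          rw [add_sub_cancel]
      _ ≤ _ := enorm_add_le _ _
  · refine isClosed_iInter fun n => ?_
    have hS := measurableSet_spanningSets μ n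
    have hfin := measure_spanningSets_lt_top μ n
    have : IsFiniteMeasure (μ.restrict (spanningSets μ n)) := ⟨by simpa using hfin⟩
    refine isClosed_setOf_eq_zero (C := (1 + μ (spanningSets μ n)) ^ q
      * weightNorm Λ (spanningSets μ n) q + q.factorial *
        (powMeasure (μ.restrict (spanningSets μ n)) q Set.univ) ^ (1 / 2 : ℝ))
      (ENNReal.add_ne_top.2 ⟨ENNReal.mul_ne_top (by finiteness)
        (hΛ.weightNorm_ne_top hS hfin q), by finiteness⟩) fun x y => ?_
    have hme : Measurable fun z => meanDiff Λ q x.2 z - meanDiff Λ q y.2 z :=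
      (measurable_meanDiff q (Lp.measurable_coe x.2)).sub
        (measurable_meanDiff q (Lp.measurable_coe y.2))
    have hms : Measurable fun z => meanDiff Λ q y.2 z - symmSum y.1 z :=
      (measurable_meanDiff q (Lp.measurable_coe y.2)).sub
        (measurable_symmSum (Lp.stronglyMeasurable y.1).measurable)
    calc ∫⁻ z, ‖meanDiff Λ q x.2 z - symmSum x.1 z‖ₑ
          ∂(powMeasure (μ.restrict (spanningSets μ n)) q)
        ≤ ∫⁻ z, (‖meanDiff Λ q y.2 z - symmSum y.1 z‖ₑ
            + (‖meanDiff Λ q x.2 z - meanDiff Λ q y.2 z‖ₑ + ‖symmSum x.1 z - symmSum y.1 z‖ₑ))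
          ∂(powMeasure (μ.restrict (spanningSets μ n)) q) := by
          refine lintegral_mono fun z => ?_
          have e : meanDiff Λ q x.2 z - symmSum x.1 z = (meanDiff Λ q y.2 z - symmSum y.1 z)
              + ((meanDiff Λ q x.2 z - meanDiff Λ q y.2 z)
                - (symmSum x.1 z - symmSum y.1 z)) := by ring
          rw [e]
          exact (enorm_add_le _ _).trans (add_le_add le_rfl enorm_sub_le)
      _ = _ := by rw [lintegral_add_left hms.enorm, lintegral_add_left hme.enorm]
      _ ≤ _ := by
          rw [add_mul]
          refine add_le_add le_rfl (add_le_add ?_ ?_)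
          · refine (hΛ.lintegral_meanDiff_sub_le hS hfin x.2 y.2 q).trans ?_
            gcongr
            exact le_max_right _ _
          · refine (lintegral_symmSum_sub_le hfin x.1 y.1).trans ?_
            gcongr
            exact le_max_left _ _

/-- Multiple integrals are controlled by their kernels. -/
lemma IsIntegral.eLpNorm_le (hΛ : IsMeckeLaw Λ μ) {h : (Fin q → Z) → ℝ} {g : Measure Z → ℝ}
    (hh : AEStronglyMeasurable h (powMeasure μ q)) (hg : Measurable g) (hg2 : MemLp g 2 Λ)
    (H : IsIntegral Λ μ q h g) :
    eLpNorm g 2 Λ ≤ (192 ^ q * 2) ^ (1 / 2 : ℝ) * q.factorial * eLpNorm h 2 (powMeasure μ q) := by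
  have h1 := hΛ.lintegral_le_sum_meanDiff one_le_two le_rfl (q + 1) hg H.vanish
    fun r _ => hΛ.ae_integrable_iterDiff hg hg2 r
  -- In the iterated Poincaré inequality only the mean difference of order `q` is non-zero.
  rw [Finset.sum_range_succ, Finset.sum_eq_zero, zero_add, lintegral_congr_ae
    (g := fun z => ‖symmSum h z‖ₑ ^ (2 : ℝ))] at h1
  · have h2 := ENNReal.rpow_le_rpow h1 (z := 1 / 2) (by norm_num)
    rw [← mul_assoc, ENNReal.mul_rpow_of_nonneg _ _ (by norm_num)] at h2
    have h3 := eLpNorm_symmSum_le (μ := μ) (p := 2) (by norm_num) hh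
    rw [mul_assoc]
    refine le_trans ?_ (mul_le_mul_right h3 _)
    simp only [eLpNorm_eq_lintegral_rpow_enorm_toReal two_ne_zero ENNReal.ofNat_ne_top,
      ENNReal.toReal_ofNat]
    exact h2
  · filter_upwards [H.meanDiff_self] with z hz
    rw [hz]
  · intro r hr
    rw [lintegral_congr_ae (g := fun _ => 0)]
    · simp
    · filter_upwards [H.meanDiff_of_ne r (Finset.mem_range.1 hr).ne] with z hz
      simp [hz]

end Integral

end PoissonChaos

namespace PoissonChaos

variable {Z : Type*} [MeasurableSpace Z] {Λ : Measure (Measure Z)} {μ : Measure Z}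

/-! ### Multiple Wiener-Itô integrals -/

lemma exists_continuousLinearMap_of_graph {E F : Type*} [NormedAddCommGroup E] [NormedSpace ℝ E]
    [NormedAddCommGroup F] [NormedSpace ℝ F] (Γ : Submodule ℝ (E × F)) (C : ℝ)
    (hex : ∀ x, ∃ y, (x, y) ∈ Γ) (hbound : ∀ p ∈ Γ, ‖p.2‖ ≤ C * ‖p.1‖) :
    ∃ I : E →L[ℝ] F, ∀ p, p ∈ Γ ↔ p.2 = I p.1 := by
  choose I hI using hex
  have huniq : ∀ p ∈ Γ, p.2 = I p.1 := by
    intro p hp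
    have h1 := hbound _ (Submodule.sub_mem _ hp (hI p.1))
    simp only [Prod.snd_sub, Prod.fst_sub, sub_self, norm_zero, mul_zero] at h1
    exact sub_eq_zero.1 (norm_le_zero_iff.1 h1)
  let L : E →ₗ[ℝ] F :=
    { toFun := I
      map_add' := fun x y => (huniq _ (Submodule.add_mem _ (hI x) (hI y))).symm
      map_smul' := fun c x => (huniq _ (Submodule.smul_mem _ c (hI x))).symm }
  refine ⟨L.mkContinuous C fun x => hbound _ (hI x), fun p => ⟨huniq p, fun hp => ?_⟩⟩
  have h1 : p = (p.1, I p.1) := Prod.ext rfl hp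
  rw [h1]
  exact hI p.1

section WienerIto

variable {Ω : Type*} [MeasurableSpace Ω] {P : Measure Ω} {η : Ω → Measure Z} [SigmaFinite μ]
  {q : ℕ}

/-- Composition with `η` is an isometry from `L²(Λ)` to `L²(P)`, so the image of the closed subspace
`integralPairs` is closed. It contains the rectangles, hence the closed span that defines the graph.
-/
lemma exists_isIntegral_of_mem_integralGraph (hη : Measurable η) (hΛ : IsMeckeLaw (P.map η) μ)
    {x : Lp ℝ 2 (powMeasure μ q) × Lp ℝ 2 P} (hx : x ∈ integralGraph η μ P q) :
    ∃ g : Lp ℝ 2 (P.map η), IsIntegral (P.map η) μ q x.1 g ∧ x.2 =ᵐ[P] fun ω => g (η ω) := by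
  have hmp : MeasurePreserving η P (P.map η) := hη.measurePreserving P
  set J := Lp.compMeasurePreservingₗᵢ (E := ℝ) (p := 2) ℝ η hmp with hJ
  set T := LinearMap.prodMap (LinearMap.id (R := ℝ) (M := Lp ℝ 2 (powMeasure μ q))) J.toLinearMap
  have hT : Isometry T := Isometry.prodMap isometry_id J.isometry
  have hcl : IsClosed (((integralPairs hΛ q).map T : Submodule ℝ _) :
      Set (Lp ℝ 2 (powMeasure μ q) × Lp ℝ 2 P)) := by
    rw [Submodule.map_coe]
    exact hT.isClosedEmbedding.isClosedMap _ (isClosed_integralPairs hΛ q)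
  have hle : integralGraph η μ P q ≤ (integralPairs hΛ q).map T := by
    refine Submodule.topologicalClosure_minimal _ (Submodule.span_le.2 ?_) hcl
    rintro ⟨h, G⟩ ⟨B, hB, hfin, hh, hG⟩
    have hrect := PolyBounded.rectIntegral (μ := μ) hB
    have hmem : MemLp (fun χ => rectIntegral μ χ q B) 2 (P.map η) :=
      hΛ.memLp_of_polyBounded (measurableSet_iUnion_sides hB) (measure_iUnion_sides_lt_top hfin)
        hrect
    refine ⟨(h, hmem.toLp), ?_, ?_⟩
    · exact (hΛ.isIntegral_rectIntegral hB hfin).congr hΛ hrect.measurable (Lp.measurable_coe _)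
        hmem.coeFn_toLp.symm hh.symm
    · refine Prod.ext rfl (Lp.ext ?_)
      refine (Lp.coeFn_compMeasurePreserving _ hmp).trans (Filter.EventuallyEq.trans ?_ hG.symm)
      exact hmp.quasiMeasurePreserving.ae_eq_comp hmem.coeFn_toLp
  obtain ⟨⟨h, g⟩, hg, rfl⟩ := hle hx
  exact ⟨g, hg, Lp.coeFn_compMeasurePreserving _ hmp⟩

/-- The norm of the multiple integral of order `q` is at most this constant. -/
noncomputable def integralBound (q : ℕ) : NNReal := (192 ^ q * 2) ^ (1 / 2 : ℝ) * q.factorial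

lemma norm_le_of_mem_integralGraph (hη : Measurable η) (hΛ : IsMeckeLaw (P.map η) μ)
    {x : Lp ℝ 2 (powMeasure μ q) × Lp ℝ 2 P} (hx : x ∈ integralGraph η μ P q) :
    ‖x.2‖ ≤ integralBound q * ‖x.1‖ := by
  obtain ⟨g, H, hG⟩ := exists_isIntegral_of_mem_integralGraph hη hΛ hx
  have h1 := H.eLpNorm_le hΛ (Lp.aestronglyMeasurable _) (Lp.measurable_coe g) (Lp.memLp g)
  have h2 : eLpNorm x.2 2 P = eLpNorm g 2 (P.map η) := by
    rw [eLpNorm_congr_ae hG]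
    exact eLpNorm_comp_measurePreserving (Lp.aestronglyMeasurable g) (hη.measurePreserving P)
  have h3 : ((192 : ℝ≥0∞) ^ q * 2) ^ (1 / 2 : ℝ) * q.factorial = integralBound q := by
    rw [integralBound, ENNReal.coe_mul, ENNReal.coe_rpow_of_nonneg _ (by norm_num)]
    norm_cast
  rw [h3, ← h2] at h1
  rw [Lp.norm_def, Lp.norm_def, ← ENNReal.coe_toReal, ← ENNReal.toReal_mul]
  exact ENNReal.toReal_mono (ENNReal.mul_ne_top ENNReal.coe_ne_top (Lp.eLpNorm_ne_top _)) h1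

lemma exists_rectangle_mem_integralGraph (hη : Measurable η) (hΛ : IsMeckeLaw (P.map η) μ)
    {B : Fin q → Set Z} (hB : ∀ i, MeasurableSet (B i)) (hfin : ∀ i, μ (B i) < ∞)
    (hne : powMeasure μ q (Set.univ.pi B) ≠ ∞) :
    ∃ G : Lp ℝ 2 P, (indicatorConstLp 2 (MeasurableSet.univ_pi hB) hne (1 : ℝ), G)
        ∈ integralGraph η μ P q ∧ G =ᵐ[P] fun ω => rectIntegral μ (η ω) q B := by
  have hmem : MemLp (fun χ => rectIntegral μ χ q B) 2 (P.map η) :=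
    hΛ.memLp_of_polyBounded (measurableSet_iUnion_sides hB) (measure_iUnion_sides_lt_top hfin)
      (PolyBounded.rectIntegral hB)
  have hmem' : MemLp (fun ω => rectIntegral μ (η ω) q B) 2 P :=
    hmem.comp_measurePreserving (hη.measurePreserving P)
  exact ⟨hmem'.toLp, Submodule.le_topologicalClosure _ (Submodule.subset_span
    ⟨B, hB, hfin, indicatorConstLp_coeFn (hs := MeasurableSet.univ_pi hB) (hμs := hne),
      hmem'.coeFn_toLp⟩), hmem'.coeFn_toLp⟩

lemma powMeasure_pi_ne_top {B : Fin q → Set Z} (hfin : ∀ i, μ (B i) < ∞) :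
    powMeasure μ q (Set.univ.pi B) ≠ ∞ := by
  rw [Measure.pi_pi]
  exact (ENNReal.prod_lt_top fun i _ => hfin i).ne

lemma Lp.integrableOn_pi (k : Lp ℝ 2 (powMeasure μ q)) {B : Fin q → Set Z}
    (hfin : ∀ i, μ (B i) < ∞) : IntegrableOn k (Set.univ.pi B) (powMeasure μ q) := by
  have : IsFiniteMeasure ((powMeasure μ q).restrict (Set.univ.pi B)) :=
    ⟨by simpa using (powMeasure_pi_ne_top hfin).lt_top⟩
  exact ((Lp.memLp k).restrict _).integrable (by norm_num)

/-- The norm bound makes the projection of the complete graph onto the kernels antilipschitz, so its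
range is closed. The range is also dense, because a kernel orthogonal to the indicators of all
rectangles with sides of finite measure is zero. -/
lemma exists_mem_integralGraph (hη : Measurable η) (hΛ : IsMeckeLaw (P.map η) μ)
    (h : Lp ℝ 2 (powMeasure μ q)) : ∃ G : Lp ℝ 2 P, (h, G) ∈ integralGraph η μ P q := by
  set Γ := integralGraph η μ P q with hΓ
  have hΓcl : IsClosed (Γ : Set (Lp ℝ 2 (powMeasure μ q) × Lp ℝ 2 P)) :=
    Submodule.isClosed_topologicalClosure _
  have : CompleteSpace Γ := hΓcl.completeSpace_coe
  set f : Γ →ₗ[ℝ] Lp ℝ 2 (powMeasure μ q) := (LinearMap.fst ℝ _ _).comp Γ.subtype with hf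
  have hanti : AntilipschitzWith (1 + integralBound q) f := by
    refine AddMonoidHomClass.antilipschitz_of_bound f fun x => ?_
    have h1 := norm_le_of_mem_integralGraph hη hΛ x.2
    change ‖(x : Lp ℝ 2 (powMeasure μ q) × Lp ℝ 2 P)‖ ≤ _ * ‖x.1.1‖
    rw [Prod.norm_def]
    push_cast
    have h2 : 0 ≤ (integralBound q : ℝ) * ‖x.1.1‖ := by positivity
    exact max_le (by nlinarith) (by nlinarith [norm_nonneg x.1.1])
  have hcont : UniformContinuous f := uniformContinuous_fst.comp uniformContinuous_subtype_val
  have hcl : IsClosed (f.range : Set (Lp ℝ 2 (powMeasure μ q))) := by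
    rw [LinearMap.coe_range]
    exact hanti.isClosed_range hcont
  have htop : f.range = ⊤ := by
    rw [← hcl.submodule_topologicalClosure_eq, Submodule.topologicalClosure_eq_top_iff,
      Submodule.eq_bot_iff]
    intro k hk
    have h0 : k =ᵐ[powMeasure μ q] 0 := by
      refine ae_eq_zero_of_setIntegral_pi (fun B _ hfin => Lp.integrableOn_pi k hfin)
        fun B hB hfin => ?_
      have hne := powMeasure_pi_ne_top hfin
      obtain ⟨G, hG, _⟩ := exists_rectangle_mem_integralGraph hη hΛ hB hfin hne
      rw [← L2.inner_indicatorConstLp_one (𝕜 := ℝ) (MeasurableSet.univ_pi hB) hne k]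
      exact (Submodule.mem_orthogonal _ _).1 hk _ ⟨⟨_, hG⟩, rfl⟩
    exact Lp.ext (h0.trans (Lp.coeFn_zero _ _ _).symm)
  obtain ⟨⟨⟨h', G⟩, hG⟩, hh⟩ : h ∈ f.range := htop ▸ Submodule.mem_top
  obtain rfl : h' = h := hh
  exact ⟨G, hG⟩

/-- The multiple Wiener-Itô integral is a continuous linear map. -/
lemma exists_integralCLM (hη : Measurable η) (hΛ : IsMeckeLaw (P.map η) μ) (q : ℕ) :
    ∃ I : Lp ℝ 2 (powMeasure μ q) →L[ℝ] Lp ℝ 2 P,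
      ∀ x, x ∈ integralGraph η μ P q ↔ x.2 = I x.1 :=
  exists_continuousLinearMap_of_graph _ (integralBound q) (exists_mem_integralGraph hη hΛ)
    fun _ hx => norm_le_of_mem_integralGraph hη hΛ hx

/-- The expected iterated add-one costs of a square-integrable functional are
square-integrable. -/
lemma memLp_meanDiff (hη : Measurable η) (hΛ : IsMeckeLaw (P.map η) μ) {φ : Measure Z → ℝ}
    (hφ : Measurable φ) (hφ2 : MemLp φ 2 (P.map η)) (q : ℕ) :
    MemLp (meanDiff (P.map η) q φ) 2 (powMeasure μ q) := by
  have hmp : MeasurePreserving η P (P.map η) := hη.measurePreserving P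
  obtain ⟨I, hI⟩ := exists_integralCLM (μ := μ) hη hΛ q
  have hΦ : MemLp (fun ω => φ (η ω)) 2 P := hφ2.comp_measurePreserving hmp
  -- Integration by parts says that `k` and the mean difference have the same integral over every
  -- rectangle with sides of finite measure, which identifies them almost everywhere.
  set k : Lp ℝ 2 (powMeasure μ q) := ContinuousLinearMap.adjoint I hΦ.toLp with hk
  have hloc : ∀ B : Fin q → Set Z, (∀ i, MeasurableSet (B i)) → (∀ i, μ (B i) < ∞) →
      IntegrableOn (meanDiff (P.map η) q φ) (Set.univ.pi B) (powMeasure μ q) :=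
    fun B hB hfin => hΛ.integrableOn_meanDiff (measurableSet_iUnion_sides hB)
      (measure_iUnion_sides_lt_top hfin) hφ (hΛ.hasWeightedMoments (measurableSet_iUnion_sides hB)
      (measure_iUnion_sides_lt_top hfin) hφ hφ2) (Set.subset_iUnion B)
  have h0 : meanDiff (P.map η) q φ - ⇑k =ᵐ[powMeasure μ q] 0 := by
    refine ae_eq_zero_of_setIntegral_pi (fun B hB hfin =>
      (hloc B hB hfin).sub (Lp.integrableOn_pi k hfin)) fun B hB hfin => ?_
    have hne := powMeasure_pi_ne_top hfin
    obtain ⟨G, hG, hGr⟩ := exists_rectangle_mem_integralGraph hη hΛ hB hfin hne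
    have hG' : G = I _ := (hI _).1 hG
    have hm : Measurable fun χ => φ χ * rectIntegral μ χ q B :=
      hφ.mul (PolyBounded.rectIntegral hB).measurable
    have h1 : ∫ z in Set.univ.pi B, k z ∂(powMeasure μ q)
        = ∫ z in Set.univ.pi B, meanDiff (P.map η) q φ z ∂(powMeasure μ q) := by
      rw [← L2.inner_indicatorConstLp_one (𝕜 := ℝ) (MeasurableSet.univ_pi hB) hne k, hk,
        ContinuousLinearMap.adjoint_inner_right, ← hG', L2.inner_def,
        ← hΛ.integral_mul_rectIntegral hB hfin hφ hφ2, integral_map hη.aemeasurable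
        hm.aestronglyMeasurable]
      refine integral_congr_ae ?_
      filter_upwards [hGr, hΦ.coeFn_toLp] with ω h2 h3
      rw [h2, h3]
      rfl
    simp only [Pi.sub_apply]
    rw [integral_sub (hloc B hB hfin) (Lp.integrableOn_pi k hfin), h1, sub_self]
  refine (memLp_congr_ae ?_).2 (Lp.memLp k)
  filter_upwards [h0] with z hz
  simpa [sub_eq_zero] using hz

end WienerIto

end PoissonChaos

namespace PoissonChaos

variable {Z : Type*} [MeasurableSpace Z] {Λ : Measure (Measure Z)} {μ : Measure Z}

/-! ### Chaos decompositions -/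

section Chaos

variable {Ω : Type*} [MeasurableSpace Ω] {P : Measure Ω} {η : Ω → Measure Z} [SigmaFinite μ]

lemma ae_eq_map_of_comp (hη : Measurable η) {f g : Measure Z → ℝ} (hf : Measurable f)
    (hg : Measurable g) (h : (fun ω => f (η ω)) =ᵐ[P] fun ω => g (η ω)) : f =ᵐ[P.map η] g := by
  rw [Filter.EventuallyEq, ae_map_iff hη.aemeasurable (measurableSet_eq_fun hf hg)]
  exact h

/-- The random variables that depend on `η` through a functional whose iterated add-one costs
vanish from order `n` on. -/
noncomputable def vanishingSubmodule (hΛ : IsMeckeLaw (P.map η) μ) (n : ℕ) :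
    Submodule ℝ (Lp ℝ 2 P) where
  carrier := {F | ∃ g : Measure Z → ℝ, Measurable g ∧ (F =ᵐ[P] fun ω => g (η ω)) ∧
    VanishAfter (P.map η) μ n g}
  zero_mem' := ⟨0, measurable_zero, Lp.coeFn_zero _ _ _,
    VanishAfter.mono hΛ (Nat.zero_le n) (Filter.Eventually.of_forall fun _ => rfl)⟩
  add_mem' := by
    rintro F F' ⟨g, hg, hF, hv⟩ ⟨g', hg', hF', hv'⟩
    refine ⟨g + g', hg.add hg', ?_, hv.add hv'⟩
    filter_upwards [Lp.coeFn_add F F', hF, hF'] with ω h1 h2 h3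
    rw [h1, Pi.add_apply, h2, h3, Pi.add_apply]
  smul_mem' := by
    rintro c F ⟨g, hg, hF, hv⟩
    refine ⟨c • g, hg.const_smul c, ?_, hv.smul c⟩
    filter_upwards [Lp.coeFn_smul c F, hF] with ω h1 h2
    rw [h1, Pi.smul_apply, h2, Pi.smul_apply]

lemma iSup_wienerChaos_le (hη : Measurable η) (hΛ : IsMeckeLaw (P.map η) μ) (k : ℕ) :
    ⨆ q ∈ Finset.range (k + 1), wienerChaos η μ P q ≤ vanishingSubmodule hΛ (k + 1) := by
  refine iSup₂_le fun q hq => ?_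
  rintro _ ⟨⟨h, G⟩, hx, rfl⟩
  obtain ⟨g, H, hG⟩ := exists_isIntegral_of_mem_integralGraph hη hΛ hx
  have := Finset.mem_range.1 hq
  exact ⟨g, Lp.measurable_coe g, hG, H.vanish.mono hΛ (by omega)⟩

lemma vanishAfter_of_mem_chaos (hη : Measurable η) (hΛ : IsMeckeLaw (P.map η) μ) {k : ℕ}
    {F : Lp ℝ 2 P} (hF : F ∈ ⨆ q ∈ Finset.range (k + 1), wienerChaos η μ P q)
    {f : Measure Z → ℝ} (hf : Measurable f) (hFf : F =ᵐ[P] fun ω => f (η ω)) :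
    VanishAfter (P.map η) μ (k + 1) f := by
  obtain ⟨g, hg, hFg, hv⟩ := iSup_wienerChaos_le hη hΛ k hF
  exact hv.congr hΛ (ae_eq_map_of_comp hη hg hf (hFg.symm.trans hFf))

lemma measurable_finsetSum_coe {p : ℝ≥0∞} (g : ℕ → Lp ℝ p Λ) (s : Finset ℕ) :
    Measurable (∑ q ∈ s, ⇑(g q)) := by
  rw [Finset.sum_fn]
  exact Finset.measurable_fun_sum _ fun q _ => Lp.measurable_coe (g q)

lemma meanDiff_finsetSum_of_isIntegral (hΛ : IsMeckeLaw Λ μ)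
    {h : (q : ℕ) → (Fin q → Z) → ℝ} {g : ℕ → Lp ℝ 2 Λ}
    (H : ∀ q, IsIntegral Λ μ q (h q) (g q)) (s : Finset ℕ) {r : ℕ} (hr : r ∈ s) :
    meanDiff Λ r (∑ q ∈ s, ⇑(g q)) =ᵐ[powMeasure μ r] symmSum (h r) := by
  have h1 : ∀ᵐ z ∂(powMeasure μ r), ∀ q, q ≠ r → meanDiff Λ r (g q) z = 0 :=
    ae_all_iff.2 fun q => by
      by_cases hq : q = r
      · simp [hq]
      · filter_upwards [(H q).meanDiff_of_ne r (Ne.symm hq)] with z hz _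
        exact hz
  filter_upwards [hΛ.meanDiff_sum s (fun q _ => Lp.measurable_coe (g q))
    (fun q _ => Lp.memLp (g q)) r, h1, (H r).meanDiff_self] with z h2 h3 h4
  rw [h2, Finset.sum_apply, Finset.sum_eq_single_of_mem r hr fun q _ hq => h3 q hq, h4]

/-- Once a partial sum contains the index `r`, its mean difference of order `r` is already the final
one. Over a spanning set, the `L¹`-error for the full sum is bounded by the `L²`-distance to the
partial sum, which tends to zero. -/
lemma meanDiff_of_hasSum (hΛ : IsMeckeLaw Λ μ) {h : (q : ℕ) → Lp ℝ 2 (powMeasure μ q)}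
    {g : ℕ → Lp ℝ 2 Λ} (H : ∀ q, IsIntegral Λ μ q (h q) (g q)) {γ : Lp ℝ 2 Λ} (hγ : HasSum g γ)
    (r : ℕ) : meanDiff Λ r γ =ᵐ[powMeasure μ r] symmSum (h r) := by
  have := hΛ.prob
  refine ae_powMeasure_of_restrict r fun n => ?_
  have hS := measurableSet_spanningSets μ n
  have hfin := measure_spanningSets_lt_top μ n
  have hm : Measurable fun z => meanDiff Λ r γ z - symmSum (h r) z :=
    (measurable_meanDiff r (Lp.measurable_coe γ)).sub
      (measurable_symmSum (Lp.stronglyMeasurable (h r)).measurable)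
  set C := (1 + μ (spanningSets μ n)) ^ r * weightNorm Λ (spanningSets μ n) r with hC
  have hCt : C ≠ ∞ := ENNReal.mul_ne_top (by finiteness) (hΛ.weightNorm_ne_top hS hfin r)
  have hle : ∀ s : Finset ℕ, r ∈ s → ∫⁻ z, ‖meanDiff Λ r γ z - symmSum (h r) z‖ₑ
      ∂(powMeasure (μ.restrict (spanningSets μ n)) r) ≤ C * edist (∑ q ∈ s, g q) γ := by
    intro s hs
    refine le_trans (le_of_eq ?_) ((hΛ.lintegral_meanDiff_sub_le hS hfin γ (∑ q ∈ s, g q) r).trans_eq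
      (by rw [edist_comm]))
    refine lintegral_congr_ae (ae_restrict_powMeasure ?_)
    have hcoe : ⇑(∑ q ∈ s, g q) =ᵐ[Λ] ∑ q ∈ s, ⇑(g q) := by
      refine (Lp.coeFn_finsetSum s g).trans (Filter.Eventually.of_forall fun χ => ?_)
      simp
    filter_upwards [meanDiff_finsetSum_of_isIntegral hΛ H s hs,
      hΛ.meanDiff_congr (Lp.measurable_coe _)
        (measurable_finsetSum_coe g s) hcoe r] with z h1 h2
    rw [h2, h1]
  have hlim : Filter.Tendsto (fun s : Finset ℕ => C * edist (∑ q ∈ s, g q) γ) Filter.atTop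
      (nhds (C * 0)) :=
    ENNReal.Tendsto.const_mul (tendsto_iff_edist_tendsto_0.1 hγ) (Or.inr hCt)
  rw [mul_zero] at hlim
  have h0 : ∫⁻ z, ‖meanDiff Λ r γ z - symmSum (h r) z‖ₑ
      ∂(powMeasure (μ.restrict (spanningSets μ n)) r) ≤ 0 := by
    refine ge_of_tendsto hlim ?_
    filter_upwards [Filter.eventually_ge_atTop {r}] with s hs
    exact hle s (Finset.singleton_subset_iff.1 hs)
  filter_upwards [(lintegral_eq_zero_iff hm.enorm).1 (le_antisymm h0 bot_le)] with z hz
  simpa [sub_eq_zero] using hz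

/-- The kernels of a chaos decomposition are the normalized expected iterated add-one costs. -/
lemma IsChaosDecomposition.kernel_ae_eq (hη : Measurable η) (hΛ : IsMeckeLaw (P.map η) μ)
    {h : (q : ℕ) → Lp ℝ 2 (powMeasure μ q)} {Φ : Lp ℝ 2 P} (H : IsChaosDecomposition η μ P h Φ)
    {φ : Measure Z → ℝ} (hφ : Measurable φ) (hφ2 : MemLp φ 2 (P.map η))
    (hΦ : Φ =ᵐ[P] fun ω => φ (η ω)) (r : ℕ) :
    h r =ᵐ[powMeasure μ r] fun z => (1 / (r.factorial : ℝ)) * meanDiff (P.map η) r φ z := by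
  obtain ⟨hsymm, G, hG, hsum⟩ := H
  have hmp : MeasurePreserving η P (P.map η) := hη.measurePreserving P
  choose g hint hgG using fun q => exists_isIntegral_of_mem_integralGraph hη hΛ (hG q)
  set J := Lp.compMeasurePreservingₗᵢ (E := ℝ) (p := 2) ℝ η hmp with hJ
  have hJG : ∀ q, J (g q) = G q := fun q =>
    Lp.ext ((Lp.coeFn_compMeasurePreserving (g q) hmp).trans (hgG q).symm)
  have hJΦ : J hφ2.toLp = Φ := Lp.ext <| (Lp.coeFn_compMeasurePreserving _ hmp).trans <|
    (hmp.quasiMeasurePreserving.ae_eq_comp hφ2.coeFn_toLp).trans hΦ.symm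
  have hsum' : HasSum g hφ2.toLp := by
    rw [← J.isometry.isUniformInducing.isInducing.hasSum_iff (g := J)]
    rw [hJΦ]
    convert hsum using 1
    exact funext hJG
  have h1 := meanDiff_of_hasSum hΛ hint hsum' r
  have h2 := hΛ.meanDiff_congr (Lp.measurable_coe _) hφ hφ2.coeFn_toLp r
  filter_upwards [h1, h2, symmSum_of_symm (hsymm r)] with z e1 e2 e3
  rw [← e2, e1, e3, one_div, inv_mul_cancel_left₀ (by positivity)]

/-- The kernels are taken to be the normalized mean differences, which are square-integrable by
`memLp_meanDiff`. No general chaos expansion is needed, since vanishing of the differences of order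
`K + 1` makes the sum finite. -/
lemma exists_isChaosDecomposition (hη : Measurable η) (hΛ : IsMeckeLaw (P.map η) μ) (K : ℕ)
    {φ : Measure Z → ℝ} (hφ : Measurable φ) (hφ2 : MemLp φ 2 (P.map η))
    (hK : VanishAfter (P.map η) μ (K + 1) φ) {Φ : Lp ℝ 2 P}
    (hΦ : Φ =ᵐ[P] fun ω => φ (η ω)) :
    ∃ h : (q : ℕ) → Lp ℝ 2 (powMeasure μ q), IsChaosDecomposition η μ P h Φ ∧
      ∀ q, K < q → h q = 0 := by
  have := hΛ.prob
  have hmem : ∀ q, MemLp (fun z => (1 / (q.factorial : ℝ)) * meanDiff (P.map η) q φ z) 2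
      (powMeasure μ q) := fun q => (memLp_meanDiff hη hΛ hφ hφ2 q).const_mul _
  set h : (q : ℕ) → Lp ℝ 2 (powMeasure μ q) := fun q => (hmem q).toLp with hh
  have hcoe : ∀ q, h q =ᵐ[powMeasure μ q]
      fun z => (1 / (q.factorial : ℝ)) * meanDiff (P.map η) q φ z := fun q => (hmem q).coeFn_toLp
  have hsymm : ∀ (q : ℕ) (s : Equiv.Perm (Fin q)),
      (fun z : Fin q → Z => h q (fun i => z (s i))) =ᵐ[powMeasure μ q] h q := by
    intro q s
    filter_upwards [hcoe q, (measurePreserving_comp_perm μ q s).quasiMeasurePreserving.ae (hcoe q)]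
      with z h1 h2
    rw [h2, h1, meanDiff_perm]
  have hzero : ∀ q, K < q → h q = 0 := by
    intro q hq
    refine Lp.ext ((hcoe q).trans (Filter.EventuallyEq.trans ?_ (Lp.coeFn_zero _ _ _).symm))
    filter_upwards [(vanishAfter_iff q hφ).1 (hK.mono hΛ hq)] with z hz
    rw [meanDiff, integral_congr_ae hz]
    simp
  choose G hG using fun q => exists_mem_integralGraph hη hΛ (h q)
  choose g hint hgG using fun q => exists_isIntegral_of_mem_integralGraph hη hΛ (hG q)
  have hGzero : ∀ q, q ∉ Finset.range (K + 1) → G q = 0 := by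
    intro q hq
    have h1 := norm_le_of_mem_integralGraph hη hΛ (hG q)
    simp only [hzero q (by simpa using hq), norm_zero, mul_zero] at h1
    exact norm_le_zero_iff.1 h1
  set ψ : Measure Z → ℝ := ∑ q ∈ Finset.range (K + 1), ⇑(g q) with hψ
  have hψm : Measurable ψ := measurable_finsetSum_coe g _
  have hψ2 : MemLp ψ 2 (P.map η) := memLp_finsetSum' _ fun q _ => Lp.memLp (g q)
  have hv : VanishAfter (P.map η) μ (K + 1) (φ - ψ) := by
    have h1 : VanishAfter (P.map η) μ (K + 1) ψ := VanishAfter.sum hΛ _ fun q hq =>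
      (hint q).vanish.mono hΛ (by have := Finset.mem_range.1 hq; omega)
    have h2 : φ - ψ = φ + (-1 : ℝ) • ψ := by
      simp [sub_eq_add_neg]
    rw [h2]
    exact hK.add (h1.smul (-1))
  have hmean : ∀ r ∈ Finset.range (K + 1),
      meanDiff (P.map η) r (φ - ψ) =ᵐ[powMeasure μ r] 0 := by
    intro r hr
    filter_upwards [hΛ.meanDiff_sub hφ hψm hφ2 hψ2 r,
      meanDiff_finsetSum_of_isIntegral hΛ hint _ hr, symmSum_of_symm (hsymm r), hcoe r]
      with z h1 h2 h3 h4
    rw [h1, Pi.sub_apply, h2, h3, h4, one_div, mul_inv_cancel_left₀ (by positivity), sub_self]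
    rfl
  -- The remainder `φ - ψ` has no differences of order `K + 1` and no mean differences of lower
  -- order, so the bound on its second moment is zero.
  have hle := hΛ.lintegral_le_sum_meanDiff one_le_two le_rfl (K + 1) (hφ.sub hψm) hv
    fun q _ => hΛ.ae_integrable_iterDiff (hφ.sub hψm) (hφ2.sub hψ2) q
  rw [Finset.sum_eq_zero fun r hr => by
    rw [lintegral_congr_ae (g := fun _ => 0)]
    · simp
    · filter_upwards [hmean r hr] with z hz
      simp [hz]] at hle
  have hae : φ =ᵐ[P.map η] ψ := by
    have h1 := (lintegral_eq_zero_iff ((hφ.sub hψm).enorm.pow_const 2)).1 (le_antisymm hle bot_le)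
    filter_upwards [h1] with χ hχ
    simpa [sub_eq_zero] using hχ
  have hsum : ∑ q ∈ Finset.range (K + 1), G q = Φ := by
    refine Lp.ext ?_
    have h1 : ∀ᵐ ω ∂P, ∀ q, G q ω = g q (η ω) := ae_all_iff.2 hgG
    filter_upwards [Lp.coeFn_finsetSum (Finset.range (K + 1)) G, h1, hΦ,
      ae_of_ae_map hη.aemeasurable hae] with ω e1 e2 e3 e4
    rw [e1, e3, e4, hψ, Finset.sum_apply, Finset.sum_apply]
    exact Finset.sum_congr rfl fun q _ => e2 q
  exact ⟨h, ⟨hsymm, G, hG, hsum ▸ hasSum_sum_of_ne_finset_zero hGzero⟩, hzero⟩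

end Chaos

end PoissonChaos

/-! ### Proof of the theorem. -/

open PoissonChaos

theorem theorem5p1 {Ω Z : Type*} [MeasurableSpace Ω] [MeasurableSpace Z]
    (P : Measure Ω) [IsProbabilityMeasure P] (μ : Measure Z) [SigmaFinite μ]
    (η : Ω → Measure Z) (hη : PoissonChaos.IsPoissonRandomMeasure η μ P)
    (m : ℕ) (hm : 1 ≤ m) (k : Fin m → ℕ) (hk : ∀ i, 1 ≤ k i)
    (F : Fin m → Lp ℝ 2 P)
    (hF : ∀ i, F i ∈ ⨆ q ∈ Finset.range (k i + 1), PoissonChaos.wienerChaos η μ P q)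
    (f : Fin m → Measure Z → ℝ) (hf : ∀ i, Measurable (f i))
    (hFf : ∀ i, F i =ᵐ[P] fun ω => f i (η ω))
    (K : ℕ) (hK : K = ∑ i, k i) (Φ : Ω → ℝ) (hΦ : Φ = fun ω => ∏ i, F i ω) :
    (∀ p : ℝ≥0∞, 1 ≤ p → p ≤ 2 → PoissonChaos.WordCondition η μ P f K p → MemLp Φ p P) ∧
    (MemLp Φ 2 P ↔ PoissonChaos.WordCondition η μ P f K 2) ∧
    (∀ hL2 : MemLp Φ 2 P,
      ∃ h : (q : ℕ) → Lp ℝ 2 (PoissonChaos.powMeasure μ q),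
        PoissonChaos.IsChaosDecomposition η μ P h hL2.toLp ∧
        (∀ h' : (q : ℕ) → Lp ℝ 2 (PoissonChaos.powMeasure μ q),
          PoissonChaos.IsChaosDecomposition η μ P h' hL2.toLp → h' = h) ∧
        (h 0 =ᵐ[PoissonChaos.powMeasure μ 0] fun _ => ∫ ω, Φ ω ∂P) ∧
        (∀ q, 1 ≤ q → q ≤ K →
          h q =ᵐ[PoissonChaos.powMeasure μ q]
            fun z => (1 / (q.factorial : ℝ)) * PoissonChaos.meanWordExpansion η P f q z) ∧
        (∀ q, K < q → h q = 0)) := by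
  have hηm := hη.measurable
  have hΛ := hη.isMeckeLaw
  have := hΛ.prob
  set Λ := P.map η with hΛdef
  have hmp : MeasurePreserving η P Λ := hηm.measurePreserving P
  set φ : Measure Z → ℝ := fun χ => ∏ i, f i χ with hφdef
  have hφ : Measurable φ := Finset.measurable_fun_prod _ fun i _ => hf i
  have hΦφ : Φ =ᵐ[P] fun ω => φ (η ω) := by
    filter_upwards [ae_all_iff.2 hFf] with ω hω
    rw [hΦ]
    exact Finset.prod_congr rfl fun i _ => hω i
  -- This is an almost-everywhere statement and requires no integrability of the product, so it is
  -- available before `Φ` is known to lie in any `L^p`.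
  have hvan : VanishAfter Λ μ (K + 1) φ := by
    have h1 := VanishAfter.prod hΛ Finset.univ (k := k) (f := f) fun i _ =>
      vanishAfter_of_mem_chaos hηm hΛ (hF i) (hf i) (hFf i)
    rw [← hK] at h1
    convert h1 using 1
    funext χ
    simp [hφdef]
  have hword : ∀ (q : ℕ) (z : Fin q → Z), wordExpansion f q z = iterDiff q z φ :=
    fun q z => wordExpansion_eq f q z
  have hint : ∀ (q : ℕ) (z : Fin q → Z), Integrable (fun ω => wordExpansion f q z (η ω)) P ↔
      Integrable (iterDiff q z φ) Λ := fun q z => by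
    rw [hword, hΛdef, integrable_map_measure
      (measurable_iterDiff hφ q z).aestronglyMeasurable hηm.aemeasurable]
    rfl
  have hmean : ∀ q, meanWordExpansion η P f q = meanDiff Λ q φ := fun q => by
    funext z
    rw [meanWordExpansion, hword, meanDiff, hΛdef, integral_map hηm.aemeasurable
      (measurable_iterDiff hφ q z).aestronglyMeasurable]
  have hmem : ∀ p, MemLp Φ p P ↔ MemLp φ p Λ := fun p => by
    rw [memLp_congr_ae hΦφ, hΛdef, memLp_map_measure_iff hφ.aestronglyMeasurable hηm.aemeasurable]
    rfl
  have hsuff : ∀ p : ℝ≥0∞, 1 ≤ p → p ≤ 2 → WordCondition η μ P f K p → MemLp Φ p P := by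
    intro p hp1 hp2 hW
    have hp0 : p ≠ 0 := (lt_of_lt_of_le one_pos hp1).ne'
    have hpt : p ≠ ∞ := ne_top_of_le_ne_top (by norm_num) hp2
    rw [hmem]
    refine ⟨hφ.aestronglyMeasurable,
      (eLpNorm_lt_top_iff_lintegral_rpow_enorm_lt_top hp0 hpt).2 ?_⟩
    refine hΛ.lintegral_lt_top_of_meanDiff ?_ ?_ K hφ hvan (fun q h1 h2 => ?_) fun q h1 h2 => ?_
    · simpa using ENNReal.toReal_mono hpt hp1
    · simpa using ENNReal.toReal_mono (by norm_num) hp2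
    · filter_upwards [(hW q h1 h2).1] with z hz
      exact (hint q z).1 hz
    · rw [← hmean]
      exact (eLpNorm_lt_top_iff_lintegral_rpow_enorm_lt_top hp0 hpt).1 (hW q h1 h2).2.2
  refine ⟨hsuff, ⟨fun hL2 q _ _ => ⟨?_, ?_⟩, hsuff 2 one_le_two le_rfl⟩, fun hL2 => ?_⟩
  · filter_upwards [hΛ.ae_integrable_iterDiff hφ ((hmem 2).1 hL2) q] with z hz
    exact (hint q z).2 hz
  · rw [hmean]
    exact memLp_meanDiff hηm hΛ hφ ((hmem 2).1 hL2) q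
  · have hφ2 := (hmem 2).1 hL2
    have hcoe : hL2.toLp =ᵐ[P] fun ω => φ (η ω) := hL2.coeFn_toLp.trans hΦφ
    obtain ⟨h, hdec, hzero⟩ := exists_isChaosDecomposition hηm hΛ K hφ hφ2 hvan hcoe
    -- The same formula holds for the kernels of any decomposition, whence uniqueness; at order zero
    -- it gives the mean of `Φ`.
    have hker := hdec.kernel_ae_eq hηm hΛ hφ hφ2 hcoe
    refine ⟨h, hdec, fun h' hdec' => ?_, ?_, fun q _ _ => ?_, hzero⟩
    · funext q
      exact Lp.ext ((hdec'.kernel_ae_eq hηm hΛ hφ hφ2 hcoe q).trans (hker q).symm)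
    · filter_upwards [hker 0] with z hz
      rw [hz, integral_congr_ae hΦφ, meanDiff, integral_map hηm.aemeasurable
        (measurable_iterDiff hφ 0 z).aestronglyMeasurable]
      simp
    · rw [hmean]
      exact hker q
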